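/- Let $F$ be a field. A \emph{variety} is an integral separated $F$-scheme of finite type; $\mathbf{Var}$ is the category of varieties and $F$-morphisms. A morphism of varieties $X\to Y$ is \emph{birational} if it is dominant and induces an isomorphism of function fields; it is \emph{strict birational} if, both function fields being viewed in one common field, this isomorphism is an equality. Up to isomorphism, cofiltered systems of varieties with strict birational transition morphisms are the same as those with birational transition morphisms. Let $\mathcal R$ be the category of locally ringed spaces over $\operatorname{Spec}F$ (i.e. locally ringed spaces whose structure sheaf is a sheaf of $F$-algebras). All limits of varieties below are taken in $\mathcal R$. \textbf{(1)} Let $K/F$ be a finitely generated field extension. The \emph{Riemann–Zariski variety} $\Sigma_K\in\mathcal R$ is the set of valuation rings $\mathcal O_v$ of $K$ containing $F$ (including $\mathcal O_{\eta_K}=K$), with the topology having as a basis the sets $E(R)=\{v\mid R\subseteq\mathcal O_v\}$, $R\subseteq K$ a finitely generated $F$-subalgebra, and with structure sheaf $U\mapsto\bigcap_{v\in U}\mathcal O_v$ for $U\neq\emptyset$ open. A \emph{Zariski–Samuel model} of $K$ is a variety $X$ with a dominant $F$-morphism $\operatorname{Spec}K\to X$ (i.e. an $F$-embedding $F(X)\subseteq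 K$); it is a \emph{model} if $F(X)=K$. Morphisms of (Zariski–Samuel) models are the $F$-morphisms compatible with the morphisms from $\operatorname{Spec} K$. If $X$ is a proper Zariski–Samuel model, $c_X:\Sigma_K\to X$ denotes the morphism in $\mathcal R$ which sends $v$ to its centre (the point $x$ such that $\mathcal O_v$ dominates $\mathcal O_{X,x}$) and is given on structure sheaves by the inclusions $\mathcal O_{X,c_X(v)}\subseteq\mathcal O_v$. Then: a) the proper Zariski–Samuel models of $K$ form a cofiltered category, the morphisms $c_X$ exist and are compatible, and they induce an isomorphism $\Sigma_K\xrightarrow{\sim}\lim X$ in $\mathcal R$, where $X$ runs through the proper Zariski–Samuel models of $K$. The point $\eta_K$ is dense in $\Sigma_K$. b) The same holds if $X$ runs only through the proper models of $K$, or only through the models of $K$ which belong to $\mathcal C$, where $\mathcal C$ is any full subcategory of the category of proper varieties such that every proper variety $X$ receives a birational morphism $Y\to X$ with $Y\in\mathcal C$. \textbf{(2)} Let $(X_\alpha)$ and $(Y_\beta)$ be small cofiltered systems of varieties with strict birational transition morphisms, and let $X=\lim X_\alpha$, $Y=\lim Y_\beta$ in $\mathcal R$. Then the canonical map \[\varprojlim_\beta\varinjlim_\alpha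 \mathbf{Var}(X_\alpha,Y_\beta)\longrightarrow\mathcal R(X,Y)\] is bijective. \textbf{(3)} Let $\mathrm{pro}_{\underline S_b}\mathbf{Var}$ be the category whose objects are the small cofiltered systems of varieties with strict birational transition morphisms and whose morphisms are given by $\operatorname{Hom}((X_\alpha),(Y_\beta))=\varprojlim_\beta\varinjlim_\alpha \mathbf{Var}(X_\alpha,Y_\beta)$, and let $\widehat{\mathbf{Var}}$ be the full subcategory of $\mathcal R$ whose objects are the limits of such systems. Then the functor \[\lim:\mathrm{pro}_{\underline S_b}\mathbf{Var}\to\widehat{\mathbf{Var}}\] exists and is an equivalence of categories. -/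

import Mathlib

open CategoryTheory CategoryTheory.Limits AlgebraicGeometry TopologicalSpace Opposite

universe u

noncomputable section

namespace BirGeom

/-! ## Varieties and locally ringed spaces over a field -/

section Varieties

variable (F : Type u) [Field F]

/-- `F`-varieties: integral separated `F`-schemes of finite type. -/
def isVariety : ObjectProperty (Over (Spec (CommRingCat.of F))) := fun X =>
  IsIntegral X.left ∧ IsSeparated X.hom ∧ LocallyOfFiniteType X.hom ∧ QuasiCompact X.hom

/-- The category `Var(F)`: morphisms are all `F`-morphisms. -/
abbrev Var : Type (u + 1) := (isVariety F).FullSubcategory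

/-- The category of locally ringed spaces over `F`. By the adjunction between global sections and
`Spec`, a morphism of locally ringed spaces `X ⟶ Spec F` is the same thing as a structure of sheaf
of `F`-algebras on the structure sheaf of `X`. -/
abbrev LRSOver : Type (u + 1) :=
  Over (Scheme.forgetToLocallyRingedSpace.obj (Spec (CommRingCat.of F)))

/-- The inclusion of varieties in locally ringed spaces over `F`. -/
def Var.toLRS : Var F ⥤ LRSOver F :=
  (isVariety F).ι ⋙ Over.post Scheme.forgetToLocallyRingedSpace

instance (X : Var F) : IsIntegral X.obj.left := X.property.1

end Varieties

/-- A morphism of integral schemes is birational if it is dominant and induces an isomorphism of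
function fields. (If `f` is dominant, it maps the generic point of `X` to that of `Y`, so that the
source of the stalk map below is the function field of `Y`.) -/
structure IsBirational {X Y : Scheme.{u}} [IsIntegral X] (f : X ⟶ Y) : Prop where
  dominant : IsDominant f
  isIso : IsIso (f.stalkMap (genericPoint X))

/-! ## Pro-varieties with birational transition morphisms -/

section Pro

variable (F : Type u) [Field F]

/-- A small cofiltered system of varieties with birational transition morphisms. Such morphisms
identify the function fields of all members of the system with one field; up to isomorphism of
systems the identifications are equalities, i.e. the transitions are strict birational. -/
structure ProVar where
  J : Type u
  [category : SmallCategory J]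
  [cofiltered : IsCofiltered J]
  diag : J ⥤ Var F
  birational : ∀ {i j : J} (f : i ⟶ j), IsBirational (diag.map f).hom.left

attribute [instance] ProVar.category ProVar.cofiltered

variable {F}

namespace ProVar

/-- The functor `V ↦ colim_α Var(X_α, V)`. -/
def homTo (P : ProVar F) : Var F ⥤ Type u :=
  (P.diag.op ⋙ coyoneda).flip ⋙ colim

/-- The class of `g : X_α ⟶ V` in `colim_α Var(X_α, V)`. -/
def cls (P : ProVar F) {V : Var F} (α : P.J) (g : P.diag.obj α ⟶ V) : P.homTo.obj V :=
  colimit.ι ((P.diag.op ⋙ coyoneda).flip.obj V) (op α) g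

lemma exists_cls (P : ProVar F) {V : Var F} (x : P.homTo.obj V) :
    ∃ (α : P.J) (g : P.diag.obj α ⟶ V), P.cls α g = x := by
  obtain ⟨α, g, h⟩ := Types.jointly_surjective' x
  exact ⟨α.unop, g, h⟩

lemma homTo_map_cls (P : ProVar F) {V W : Var F} (h : V ⟶ W) (α : P.J) (g : P.diag.obj α ⟶ V) :
    P.homTo.map h (P.cls α g) = P.cls α (g ≫ h) :=
  ConcreteCategory.congr_hom
    (ι_colimMap ((P.diag.op ⋙ coyoneda).flip.map h) (op α)) g

lemma cls_map (P : ProVar F) {V : Var F} {α α' : P.J} (a : α' ⟶ α) (g : P.diag.obj α ⟶ V) :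
    P.cls α' (P.diag.map a ≫ g) = P.cls α g :=
  ConcreteCategory.congr_hom
    (colimit.w ((P.diag.op ⋙ coyoneda).flip.obj V) a.op) g

/-- Morphisms of pro-objects `(X_α) ⟶ (Y_β)`: the set `lim_β colim_α Var(X_α, Y_β)`, i.e. the
compatible families of elements of the sets `colim_α Var(X_α, Y_β)`. -/
@[ext]
structure Hom (P Q : ProVar F) : Type u where
  app : ∀ β : Q.J, P.homTo.obj (Q.diag.obj β)
  w : ∀ {β β' : Q.J} (b : β ⟶ β'), P.homTo.map (Q.diag.map b) (app β) = app β'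

/-- Precomposition with a morphism of pro-objects `P ⟶ Q`, as a map
`colim_β Var(Y_β, V) → colim_α Var(X_α, V)`. -/
def Hom.act {P Q : ProVar F} (s : Hom P Q) (V : Var F) : Q.homTo.obj V → P.homTo.obj V :=
  fun x => colimit.desc ((Q.diag.op ⋙ coyoneda).flip.obj V)
    { pt := P.homTo.obj V
      ι :=
        { app := fun β => ↾fun (g : Q.diag.obj β.unop ⟶ V) => P.homTo.map g (s.app β.unop)
          naturality := fun β β' b => by
            ext g
            have h := s.w b.unop
            change P.homTo.map (Q.diag.map b.unop ≫ g) (s.app β'.unop) = P.homTo.map g (s.app β.unop)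
            rw [← h, Functor.map_comp]
            rfl } } x

lemma Hom.act_cls {P Q : ProVar F} (s : Hom P Q) {V : Var F} (β : Q.J) (g : Q.diag.obj β ⟶ V) :
    s.act V (Q.cls β g) = P.homTo.map g (s.app β) :=
  ConcreteCategory.congr_hom
    (colimit.ι_desc (F := (Q.diag.op ⋙ coyoneda).flip.obj V) _ (op β)) g

lemma Hom.act_map {P Q : ProVar F} (s : Hom P Q) {V W : Var F} (h : V ⟶ W) (x : Q.homTo.obj V) :
    s.act W (Q.homTo.map h x) = P.homTo.map h (s.act V x) := by
  obtain ⟨β, g, rfl⟩ := Q.exists_cls x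
  rw [homTo_map_cls, act_cls, act_cls, Functor.map_comp]
  rfl

/-- The category of pro-objects of `Var(F)` with birational transition morphisms. -/
instance : Category (ProVar F) where
  Hom := Hom
  id P :=
    { app := fun α => P.cls α (𝟙 _)
      w := fun {α α'} a => by
        rw [homTo_map_cls, Category.id_comp, ← P.cls_map a, Category.comp_id] }
  comp {P Q R} s t :=
    { app := fun γ => s.act _ (t.app γ)
      w := fun {γ γ'} c => by rw [← Hom.act_map, t.w] }
  id_comp {P Q} s := Hom.ext <| funext fun β => by
    obtain ⟨α, g, h⟩ := P.exists_cls (s.app β)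
    dsimp only
    rw [← h, Hom.act_cls, homTo_map_cls, Category.id_comp]
  comp_id {P Q} s := Hom.ext <| funext fun β => by
    dsimp only
    rw [Hom.act_cls, CategoryTheory.Functor.map_id]
    rfl
  assoc {P Q R S} s t r := Hom.ext <| funext fun δ => by
    obtain ⟨γ, g, h⟩ := R.exists_cls (r.app δ)
    dsimp only
    rw [← h, Hom.act_cls, Hom.act_cls, Hom.act_map]

/-- The system of locally ringed spaces over `F` underlying a pro-variety. -/
abbrev lrsDiag (P : ProVar F) : P.J ⥤ LRSOver F := P.diag ⋙ Var.toLRS F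

/-- For a cone `X ⟶ X_α` over the system `P`, the canonical map
`colim_α Var(X_α, V) → Hom(X, V)`, which sends the class of `g : X_α ⟶ V` to `X ⟶ X_α ⟶ V`. -/
def eval {P : ProVar F} (c : Cone P.lrsDiag) (V : Var F) (x : P.homTo.obj V) :
    c.pt ⟶ (Var.toLRS F).obj V :=
  colimit.desc ((P.diag.op ⋙ coyoneda).flip.obj V)
    { pt := c.pt ⟶ (Var.toLRS F).obj V
      ι :=
        { app := fun α => ↾fun (g : P.diag.obj α.unop ⟶ V) =>
            c.π.app α.unop ≫ (Var.toLRS F).map g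
          naturality := fun α α' a => by
            ext g
            have h := c.w a.unop
            change c.π.app α'.unop ≫ (Var.toLRS F).map (P.diag.map a.unop ≫ g) =
              c.π.app α.unop ≫ (Var.toLRS F).map g
            rw [Functor.map_comp, ← h, Category.assoc]
            rfl } } x

lemma eval_cls {P : ProVar F} (c : Cone P.lrsDiag) {V : Var F} (α : P.J)
    (g : P.diag.obj α ⟶ V) :
    eval c V (P.cls α g) = c.π.app α ≫ (Var.toLRS F).map g :=
  ConcreteCategory.congr_hom
    (colimit.ι_desc (F := (P.diag.op ⋙ coyoneda).flip.obj V) _ (op α)) g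

lemma eval_map {P : ProVar F} (c : Cone P.lrsDiag) {V W : Var F} (h : V ⟶ W)
    (x : P.homTo.obj V) :
    eval c W (P.homTo.map h x) = eval c V x ≫ (Var.toLRS F).map h := by
  obtain ⟨α, g, rfl⟩ := P.exists_cls x
  rw [homTo_map_cls, eval_cls, eval_cls, Functor.map_comp, Category.assoc]

/-- The canonical map `lim_β colim_α Var(X_α, Y_β) → Hom(X, Y)` for `X` with compatible morphisms
to the `X_α` and `Y = lim Y_β`: the composite of the image of `s` with the projection `Y ⟶ Y_β` is
represented by the `β`-component of `s`. -/
def limMap {P Q : ProVar F} (c : Cone P.lrsDiag) {d : Cone Q.lrsDiag} (hd : IsLimit d)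
    (s : P ⟶ Q) : c.pt ⟶ d.pt :=
  hd.lift
    { pt := c.pt
      π :=
        { app := fun β => eval c (Q.diag.obj β) (s.app β)
          naturality := fun β β' b => by
            have h := s.w b
            change 𝟙 _ ≫ eval c (Q.diag.obj β') (s.app β') =
              eval c (Q.diag.obj β) (s.app β) ≫ (Var.toLRS F).map (Q.diag.map b)
            rw [Category.id_comp, ← eval_map, ← h] } }

end ProVar

variable (F) in
/-- Locally ringed spaces over `F` which are cofiltered limits, in the category of locally ringed
spaces over `F`, of varieties under birational morphisms. -/
def isLimOfVar : ObjectProperty (LRSOver F) := fun X =>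
  ∃ (P : ProVar F) (π : (Functor.const P.J).obj X ⟶ P.lrsDiag), Nonempty (IsLimit (Cone.mk X π))

variable (F) in
/-- The full subcategory of locally ringed spaces over `F` on the limits of pro-varieties. -/
abbrev VarHat : Type (u + 1) := (isLimOfVar F).FullSubcategory

variable (F) in
/-- A functor `lim` from pro-varieties to locally ringed spaces over `F`: a functor together with
projections which make its value at each `P` a limit of the system `P`, and whose value on a
morphism of pro-objects is the induced morphism of limits. -/
structure LimFunctor where
  functor : ProVar F ⥤ VarHat F
  π : ∀ P : ProVar F, (Functor.const P.J).obj (functor.obj P).obj ⟶ P.lrsDiag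
  isLimit : ∀ P : ProVar F, IsLimit (Cone.mk _ (π P))
  map_eq : ∀ {P Q : ProVar F} (s : P ⟶ Q),
    (functor.map s).hom = ProVar.limMap (Cone.mk _ (π P)) (isLimit Q) s

end Pro

/-! ## The Riemann variety of a field extension -/

section Riemann

variable (F K : Type u) [Field F] [Field K] [Algebra F K]

/-- The points of the Riemann variety: the valuations of `K` trivial on `F`, up to equivalence,
i.e. the valuation rings of `K` containing `F` (the trivial valuation included). -/
def RPoint : Type u := {A : ValuationSubring K // (algebraMap F K).range ≤ A.toSubring}

namespace RPoint

variable {F K}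

/-- The valuation ring of a point. -/
def ring (v : RPoint F K) : ValuationSubring K := v.1

/-- The set `E(R)` of valuations whose valuation ring contains `R`. -/
def E (R : Subalgebra F K) : Set (RPoint F K) := {v | ∀ r ∈ R, r ∈ v.ring}

/-- The trivial valuation. -/
def eta : RPoint F K := ⟨⊤, fun _ _ => ValuationSubring.mem_top _⟩

/-- The topology with basis the sets `E(R)`, for `R` a finitely generated `F`-algebra in `K`. -/
instance : TopologicalSpace (RPoint F K) :=
  TopologicalSpace.generateFrom {s | ∃ R : Subalgebra F K, R.FG ∧ s = E R}

lemma isOpen_E {R : Subalgebra F K} (hR : R.FG) : IsOpen (E R) :=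
  TopologicalSpace.isOpen_generateFrom_of_mem ⟨R, hR, rfl⟩

lemma eta_mem {U : Set (RPoint F K)} (hU : IsOpen U) (hne : U.Nonempty) : eta ∈ U := by
  induction hU with
  | basic s hs =>
    obtain ⟨R, -, rfl⟩ := hs
    exact fun r _ => ValuationSubring.mem_top r
  | univ => trivial
  | inter s t _ _ hs ht => exact ⟨hs (hne.mono fun _ h => h.1), ht (hne.mono fun _ h => h.2)⟩
  | sUnion S _ ih =>
    obtain ⟨v, s, hs, hv⟩ := hne
    exact ⟨s, hs, ih s hs ⟨v, hv⟩⟩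

lemma algebraMap_mem (v : RPoint F K) (a : F) : algebraMap F K a ∈ v.ring := v.2 ⟨a, rfl⟩

lemma isOpen_mem (f : K) : IsOpen {v : RPoint F K | f ∈ v.ring} := by
  have h : {v : RPoint F K | f ∈ v.ring} = E (Algebra.adjoin F {f}) := by
    ext v
    refine ⟨fun hf r hr => ?_, fun h => h f (Algebra.subset_adjoin rfl)⟩
    induction hr using Algebra.adjoin_induction with
    | mem x hx => rw [Set.mem_singleton_iff.1 hx]; exact hf
    | algebraMap a => exact v.algebraMap_mem a
    | add x y _ _ hx hy => exact add_mem hx hy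
    | mul x y _ _ hx hy => exact mul_mem hx hy
  rw [h]
  exact isOpen_E ⟨{f}, by simp⟩

end RPoint

/-- The underlying topological space of the Riemann variety. -/
abbrev rTop : TopCat.{u} := TopCat.of (RPoint F K)

/-- A section of the structure sheaf over a nonempty open set `U` is an element of the intersection
of the valuation rings `O_v`, `v ∈ U`. Such an element is encoded as the constant function on `U`
with that value; in this form the formula holds over the empty set too, where there is exactly one
section. -/
def rPredicate : TopCat.LocalPredicate (fun _ : rTop F K => K) where
  pred {U} s := ∃ f : K, ∀ v : U, f ∈ v.1.ring ∧ s v = f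
  res := by
    rintro U V i s ⟨f, hf⟩
    exact ⟨f, fun v => hf ⟨v.1, leOfHom i v.2⟩⟩
  locality := by
    intro U s hs
    by_cases hU : (U : Set (RPoint F K)).Nonempty
    · refine ⟨s ⟨RPoint.eta, RPoint.eta_mem U.2 hU⟩, fun v => ?_⟩
      obtain ⟨V, hv, i, f, hf⟩ := hs v
      have h1 := hf ⟨v.1, hv⟩
      have h2 := (hf ⟨RPoint.eta, RPoint.eta_mem V.2 ⟨v.1, hv⟩⟩).2
      have h3 : s ⟨RPoint.eta, RPoint.eta_mem U.2 hU⟩ = f := h2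
      rw [h3]
      exact h1
    · exact ⟨0, fun v => (hU ⟨v.1, v.2⟩).elim⟩

/-- The ring of sections over `U`. -/
def rSections (U : Opens (rTop F K)) : Subring (U → K) where
  carrier := {s | (rPredicate F K).pred s}
  mul_mem' := by
    rintro s t ⟨f, hf⟩ ⟨g, hg⟩
    exact ⟨f * g, fun v => ⟨mul_mem (hf v).1 (hg v).1, by
      rw [Pi.mul_apply, (hf v).2, (hg v).2]⟩⟩
  one_mem' := ⟨1, fun v => ⟨one_mem _, rfl⟩⟩
  add_mem' := by
    rintro s t ⟨f, hf⟩ ⟨g, hg⟩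
    exact ⟨f + g, fun v => ⟨add_mem (hf v).1 (hg v).1, by
      rw [Pi.add_apply, (hf v).2, (hg v).2]⟩⟩
  zero_mem' := ⟨0, fun v => ⟨zero_mem _, rfl⟩⟩
  neg_mem' := by
    rintro s ⟨f, hf⟩
    exact ⟨-f, fun v => ⟨neg_mem (hf v).1, by rw [Pi.neg_apply, (hf v).2]⟩⟩

/-- The structure presheaf of the Riemann variety. -/
def rPresheaf : TopCat.Presheaf CommRingCat.{u} (rTop F K) where
  obj U := CommRingCat.of (rSections F K U.unop)
  map {U V} i := CommRingCat.ofHom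
    { toFun := fun s => ⟨fun v => s.1 ⟨v.1, leOfHom i.unop v.2⟩, (rPredicate F K).res i.unop s.1 s.2⟩
      map_one' := rfl
      map_mul' := fun _ _ => rfl
      map_zero' := rfl
      map_add' := fun _ _ => rfl }

lemma rPresheaf_isSheaf : (rPresheaf F K).IsSheaf :=
  (TopCat.Presheaf.isSheaf_iff_isSheaf_comp (forget CommRingCat) _).mpr
    (TopCat.Presheaf.isSheaf_of_iso
      (NatIso.ofComponents (fun _ => Iso.refl _) (fun _ => rfl) : TopCat.subpresheafToTypes
        (rPredicate F K).toPrelocalPredicate ≅ rPresheaf F K ⋙ forget CommRingCat)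
      (TopCat.subpresheafToTypes.isSheaf (rPredicate F K)))

/-- Evaluation at `v` of the germs at `v`, with values in the valuation ring of `v`. -/
def rStalkEval (v : rTop F K) :
    (rPresheaf F K).stalk v ⟶ CommRingCat.of v.ring :=
  colimit.desc ((OpenNhds.inclusion v).op ⋙ rPresheaf F K)
    { pt := CommRingCat.of v.ring
      ι :=
        { app := fun U => CommRingCat.ofHom
            { toFun := fun (s : rSections F K U.unop.1) => ⟨s.1 ⟨v, U.unop.2⟩, by
                obtain ⟨f, hf⟩ := s.2
                have h := hf ⟨v, U.unop.2⟩
                rw [h.2]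
                exact h.1⟩
              map_one' := rfl
              map_mul' := fun _ _ => rfl
              map_zero' := rfl
              map_add' := fun _ _ => rfl }
          naturality := fun _ _ _ => by
            ext s
            rfl } }

lemma rStalkEval_germ (v : rTop F K) (U : Opens (rTop F K)) (hv : v ∈ U)
    (s : rSections F K U) :
    ((rStalkEval F K v ((rPresheaf F K).germ U v hv s) : v.ring) : K) = s.1 ⟨v, hv⟩ := by
  have h : (rPresheaf F K).germ U v hv ≫ rStalkEval F K v = _ :=
    colimit.ι_desc (F := (OpenNhds.inclusion v).op ⋙ rPresheaf F K) _ (op ⟨U, hv⟩)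
  exact congrArg (Subtype.val (p := fun x => x ∈ v.ring)) (ConcreteCategory.congr_hom h s)

lemma rStalkEval_isLocalHom (v : rTop F K) : IsLocalHom (rStalkEval F K v).hom where
  map_nonunit x hx := by
    obtain ⟨U, hv, s, rfl⟩ := (rPresheaf F K).exists_germ_eq x
    obtain ⟨f, hf⟩ := s.2
    obtain ⟨y, hy⟩ := hx.exists_right_inv
    have hy' : f * (y : K) = 1 := by
      have h := congrArg Subtype.val hy
      rw [← (hf ⟨v, hv⟩).2, ← rStalkEval_germ F K v U hv s]
      exact h
    have hVo : IsOpen ({w : RPoint F K | (y : K) ∈ w.ring} ∩ U) :=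
      (RPoint.isOpen_mem (y : K)).inter U.2
    let V : Opens (rTop F K) := ⟨_, hVo⟩
    have hvV : v ∈ V := ⟨y.2, hv⟩
    let i : V ⟶ U := homOfLE fun w hw => hw.2
    let t : (rPresheaf F K).obj (op V) := (⟨fun _ => (y : K), (y : K), fun w => ⟨w.2.1, rfl⟩⟩ : rSections F K V)
    have hst : (rPresheaf F K).map i.op s * t = 1 := by
      apply Subtype.ext
      funext w
      change s.1 ⟨w.1, w.2.2⟩ * (y : K) = 1
      rw [(hf ⟨w.1, w.2.2⟩).2]
      exact hy'
    have hg := congrArg ((rPresheaf F K).germ V v hvV).hom hst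
    rw [map_mul, map_one] at hg
    have hs : ((rPresheaf F K).germ V v hvV).hom ((rPresheaf F K).map i.op s) =
        (rPresheaf F K).germ U v hv s := TopCat.Presheaf.germ_res_apply _ i v hvV s
    rw [hs] at hg
    exact IsUnit.of_mul_eq_one _ hg

/-- The Riemann variety of `K` as a locally ringed space. -/
def rSpace : LocallyRingedSpace.{u} where
  carrier := rTop F K
  presheaf := rPresheaf F K
  IsSheaf := rPresheaf_isSheaf F K
  isLocalRing v :=
    haveI := rStalkEval_isLocalHom F K v
    RingHom.domain_isLocalRing (rStalkEval F K v).hom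

/-- The `F`-algebra structure on the global sections of the Riemann variety, by constants. -/
def rAlgebra : CommRingCat.of F ⟶ LocallyRingedSpace.Γ.obj (op (rSpace F K)) :=
  CommRingCat.ofHom
    { toFun := fun a => (⟨fun _ => algebraMap F K a, algebraMap F K a,
        fun v => ⟨v.1.algebraMap_mem a, rfl⟩⟩ : rSections F K ⊤)
      map_one' := Subtype.ext (funext fun _ => map_one _)
      map_mul' := fun a b => Subtype.ext (funext fun _ => map_mul _ a b)
      map_zero' := Subtype.ext (funext fun _ => map_zero _)
      map_add' := fun a b => Subtype.ext (funext fun _ => map_add _ a b) }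

/-- The Riemann variety `Σ_K` as a locally ringed space over `F`. -/
def riemannVariety : LRSOver F :=
  Over.mk (Y := rSpace F K)
    ((ΓSpec.locallyRingedSpaceAdjunction.homEquiv (rSpace F K) (op (CommRingCat.of F)))
      (rAlgebra F K).op)

/-! ## Models of a field extension -/

/-- `Spec K` over `Spec F`. -/
abbrev specOver : Over (Spec (CommRingCat.of F)) :=
  Over.mk (Spec.map (CommRingCat.ofHom (algebraMap F K)))

/-- Zariski-Samuel models of `K`: varieties `X` with a dominant `F`-morphism `Spec K ⟶ X`, that is,
with an embedding of the function field of `X` in `K` over `F`. Morphisms are the morphisms of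
varieties which commute with the given morphisms from `Spec K`. -/
abbrev ZSModel : Type (u + 1) :=
  ObjectProperty.FullSubcategory
    (fun M : StructuredArrow (specOver F K) (isVariety F).ι => IsDominant M.hom.left)

variable {F K}

namespace ZSModel

/-- The variety of a Zariski-Samuel model. -/
abbrev variety (M : ZSModel F K) : Var F := M.obj.right

/-- The scheme of a Zariski-Samuel model. -/
abbrev scheme (M : ZSModel F K) : Scheme.{u} := M.variety.obj.left

/-- The dominant morphism `Spec K ⟶ X` of a Zariski-Samuel model `X`. -/
abbrev point (M : ZSModel F K) : Spec (CommRingCat.of K) ⟶ M.scheme := M.obj.hom.left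

variable (F K) in
/-- Proper Zariski-Samuel models. -/
def isProper : ObjectProperty (ZSModel F K) := fun M => IsProper M.variety.obj.hom

variable (F K) in
/-- Models of `K`: Zariski-Samuel models whose function field is the whole of `K`. -/
def isModel : ObjectProperty (ZSModel F K) := fun M => IsBirational M.point

lemma point_specializes (M : ZSModel F K) (x : M.scheme) :
    M.point (IsLocalRing.closedPoint K) ⤳ x := by
  rw [specializes_iff_mem_closure]
  have h := M.property.denseRange x
  have hr : Set.range M.point = {M.point (IsLocalRing.closedPoint K)} := by
    ext y
    constructor
    · rintro ⟨z, rfl⟩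
      exact congrArg M.point (Subsingleton.elim (α := PrimeSpectrum K) z _)
    · rintro rfl
      exact ⟨_, rfl⟩
  rwa [hr] at h

/-- The embedding `O_{X,x} → F(X) → K` of the local ring of a Zariski-Samuel model at `x`. -/
def toField (M : ZSModel F K) (x : M.scheme) : M.scheme.presheaf.stalk x ⟶ CommRingCat.of K :=
  M.scheme.presheaf.stalkSpecializes (M.point_specializes x) ≫ Scheme.stalkClosedPointTo M.point

/-- `x` is a centre of the valuation ring `O_v`: `O_v` dominates the local ring at `x`. -/
def IsCentre (M : ZSModel F K) (v : RPoint F K) (x : M.scheme) : Prop :=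
  ∀ s : M.scheme.presheaf.stalk x, ∃ h : M.toField x s ∈ v.ring,
    s ∈ IsLocalRing.maximalIdeal (M.scheme.presheaf.stalk x) →
      (⟨M.toField x s, h⟩ : v.ring) ∈ IsLocalRing.maximalIdeal v.ring

/-- The morphism `c_X : Σ_K ⟶ X` to a (proper) Zariski-Samuel model `X`: it maps each valuation to
its centre, and on the structure sheaves it is given by the inclusions `O_{X,c_X(v)} ⊆ O_v`. -/
structure IsCentreMap (M : ZSModel F K)
    (c : riemannVariety F K ⟶ (Var.toLRS F).obj M.variety) : Prop where
  isCentre : ∀ v : RPoint F K, M.IsCentre v (c.left.base v)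
  comorphism : ∀ (U : M.scheme.Opens) (s : M.scheme.presheaf.obj (op U)) (v : RPoint F K)
    (hv : c.left.base v ∈ U),
    (c.left.c.app (op U) s : rSections F K ((Opens.map c.left.base).obj U)).1 ⟨v, hv⟩ =
      M.toField (c.left.base v) (M.scheme.presheaf.germ U (c.left.base v) hv s)

variable (F K) in
/-- The system of the Zariski-Samuel models of `K` with property `S`, in locally ringed spaces
over `F`. -/
def diag (S : ObjectProperty (ZSModel F K)) : S.FullSubcategory ⥤ LRSOver F :=
  S.ι ⋙ ObjectProperty.ι _ ⋙ StructuredArrow.proj _ _ ⋙ Var.toLRS F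

variable (F K) in
/-- The Riemann variety is, through the morphisms `c_X`, the cofiltered limit in locally ringed
spaces over `F` of the Zariski-Samuel models of `K` with property `S`. -/
def IsRiemannLimit (S : ObjectProperty (ZSModel F K)) : Prop :=
  IsCofiltered S.FullSubcategory ∧
    ∃ π : (Functor.const S.FullSubcategory).obj (riemannVariety F K) ⟶ diag F K S,
      (∀ M : S.FullSubcategory, M.obj.IsCentreMap (π.app M)) ∧
        Nonempty (IsLimit (Cone.mk (riemannVariety F K) π))

end ZSModel

end Riemann

end BirGeom

end

/-!
The theorem is proved by comparing everything with one field `K`. A Zariski–Samuel model `M` of `K`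
is known by its points, its topology and its local rings, which are subrings of `K`; a morphism of
models is compatible with these inclusions, so that a morphism of models is unique if it exists.
Accordingly a limit of models is a space whose points carry local subrings of `K` (`ZData`), with
structure sheaf the intersections of these rings. `IsZLimit` lists three properties of such a space
over a cofiltered system of models: its points are the compatible families of points, its topology
is the limit topology, and the local ring at a point is the union of the local rings of its images.
By `IsZLimit.isLimit` they make it the limit in locally ringed spaces over `F`, and the space of
compatible families `LimPoint` has them (`LimPoint.isZLimit`), so that limits exist.

*Pro-varieties.* The transition morphisms being birational, a generic point of one member of a
system lifts uniquely to all members (`IsBirational.existsUnique_lift`), and the system becomes a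
system of models of one function field (`ProVar.exists_toModels`). It remains to compare the
morphisms from a limit `Z` of models to a variety `V` with the germs of morphisms from the models.
They are determined by their restrictions to `Spec K` (`IsZLimit.hom_ext_pt`), which gives
injectivity. For surjectivity, let `φ : Z ⟶ V` restrict to `ψ : Spec K ⟶ V`. On each model the set
of points near which `ψ` does not extend to a morphism to `V` is closed. If it were nonempty on all
models, these closed sets would have a compatible family of points: by noetherianity and sobriety
each ultrafilter on a model has a point which lies in exactly the closed sets of the ultrafilter,
and this choice commutes with the transition maps (`exists_compatible_points`). But at this point of
`Z` the morphism `φ` gives an extension of `ψ` to the spectrum of the local ring, which is a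
filtered union of local rings of models; as `V` is of finite type, the extension is defined near a
point of one of the models, a contradiction. So `ψ` extends locally on some model, and globally
because `V` is separated (`LimPoint.exists_factor`). As the target is itself a limit, morphisms of
limits are compatible families of such germs (`ProVar.limMap_bijective`). This is full faithfulness
of the functor `lim` (`LimFunctor.isEquivalence`), and the existence of limits yields the functor
(`nonempty_limFunctor`).

*Riemann varieties.* By the valuative criterion a valuation ring of `K` dominates a local ring of
each proper model, for a unique point, its centre (`ZSModel.dominates_centre`), and taking centres
is continuous (`ZSModel.continuous_centre`). The scheme-theoretic image of `Spec K` in the product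
of two proper models dominates both (`ZSModel.exists_join`), so that proper models are cofiltered.
For `f` in `K` the closure of the point `(1 : f)` of the projective line is a proper model, on each
local ring of which `f` or `f⁻¹` is regular (`ZSModel.exists_mem_or_inv_mem`). Hence a compatible
family of points on the proper models has as union of its local rings a valuation ring, and each
finitely generated subalgebra of a valuation ring is regular near the centre on some proper model.
This proves that the Riemann variety is the limit of any cofinal system of proper models
(`ZSModel.isRiemannLimit_of_cofinal`). If `K` is finitely generated over `F`, the models with
function field `K` are cofinal, since the join with the closure of a point whose coordinates
generate `K` is one of them (`ZSModel.exists_proper_model_over`); those which belong to a class `C`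
as in the statement are cofinal because a birational morphism to a model comes from a morphism of
models (`ZSModel.exists_of_isBirational`).
-/

universe v w

noncomputable section

namespace BirGeom

/-! ### Morphisms and local rings of Zariski–Samuel models -/

section Models

variable {F K : Type u} [Field F] [Field K] [Algebra F K]

instance (X : Var F) : IsSeparated X.obj.hom := X.property.2.1
instance (X : Var F) : LocallyOfFiniteType X.obj.hom := X.property.2.2.1
instance (X : Var F) : QuasiCompact X.obj.hom := X.property.2.2.2

namespace ZSModel

instance (M : ZSModel F K) : IsDominant M.point := M.property

/-- The structure morphism of the scheme of a Zariski–Samuel model. -/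
abbrev str (M : ZSModel F K) : M.scheme ⟶ Spec (CommRingCat.of F) := M.variety.obj.hom

/-- The morphism of schemes underlying a morphism of Zariski–Samuel models. -/
abbrev mor {M N : ZSModel F K} (f : M ⟶ N) : M.scheme ⟶ N.scheme := f.hom.right.hom.left

lemma point_mor {M N : ZSModel F K} (f : M ⟶ N) : M.point ≫ mor f = N.point := by
  have h := StructuredArrow.w f.hom
  exact congrArg CommaMorphism.left h

lemma mor_str {M N : ZSModel F K} (f : M ⟶ N) : mor f ≫ N.str = M.str :=
  Over.w f.hom.right.hom

lemma point_str (M : ZSModel F K) :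
    M.point ≫ M.str = Spec.map (CommRingCat.ofHom (algebraMap F K)) :=
  Over.w M.obj.hom

variable (F K) in
/-- The locally ringed spaces over `F` underlying Zariski–Samuel models. -/
abbrev toLRS : ZSModel F K ⥤ LRSOver F :=
  ObjectProperty.ι _ ⋙ StructuredArrow.proj _ _ ⋙ Var.toLRS F

lemma hom_ext {M N : ZSModel F K} (f g : M ⟶ N) (h : mor f = mor g) : f = g := by
  apply ObjectProperty.hom_ext
  apply StructuredArrow.ext
  apply ObjectProperty.hom_ext
  exact Over.OverMorphism.ext h

/-- Construction of Zariski–Samuel models. -/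
def mk' (X : Scheme.{u}) (s : X ⟶ Spec (CommRingCat.of F)) [IsIntegral X] [IsSeparated s]
    [LocallyOfFiniteType s] [QuasiCompact s] (p : Spec (CommRingCat.of K) ⟶ X) [IsDominant p]
    (hp : p ≫ s = Spec.map (CommRingCat.ofHom (algebraMap F K))) : ZSModel F K :=
  ⟨StructuredArrow.mk (S := specOver F K) (T := (isVariety F).ι)
    (Y := (⟨Over.mk s, ‹_›, ‹_›, ‹_›, ‹_›⟩ : Var F))
    (Over.homMk (U := specOver F K) (V := Over.mk s) p hp), ‹IsDominant p›⟩

/-- Construction of morphisms of Zariski–Samuel models. -/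
def homMk' {M N : ZSModel F K} (f : M.scheme ⟶ N.scheme) (hf : f ≫ N.str = M.str)
    (hp : M.point ≫ f = N.point) : M ⟶ N :=
  ObjectProperty.homMk (StructuredArrow.homMk (ObjectProperty.homMk (Over.homMk f hf))
    (Over.OverMorphism.ext hp))

/-- There is at most one morphism between two models, since `Spec K` is dense in the source and the
target is separated. -/
instance {M N : ZSModel F K} : Subsingleton (M ⟶ N) where
  allEq f g := hom_ext f g <| ext_of_isDominant_of_isSeparated N.str
    ((mor_str f).trans (mor_str g).symm) M.point ((point_mor f).trans (point_mor g).symm)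

lemma SpecMap_toField (M : ZSModel F K) (x : M.scheme) :
    Spec.map (M.toField x) ≫ M.scheme.fromSpecStalk x = M.point := by
  rw [toField, Spec.map_comp, Category.assoc, Scheme.SpecMap_stalkSpecializes_fromSpecStalk,
    Scheme.Spec_stalkClosedPointTo_fromSpecStalk]

/-- As `Spec O_{X,x} ⟶ X` is a monomorphism, a homomorphism `O_{X,x} → K` which induces the given
morphism `Spec K ⟶ X` is the embedding `toField`. -/
lemma eq_toField (M : ZSModel F K) (x : M.scheme)
    (φ : M.scheme.presheaf.stalk x ⟶ CommRingCat.of K)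
    (h : Spec.map φ ≫ M.scheme.fromSpecStalk x = M.point) : φ = M.toField x := by
  rw [← M.SpecMap_toField x, cancel_mono] at h
  exact Spec.map_injective h

/-- Morphisms of models respect the embeddings of the local rings in `K`. -/
lemma toField_mor {M N : ZSModel F K} (f : M ⟶ N) (x : M.scheme) :
    (mor f).stalkMap x ≫ M.toField x = N.toField (mor f x) := by
  apply eq_toField
  rw [Spec.map_comp, Category.assoc, Scheme.SpecMap_stalkMap_fromSpecStalk,
    reassoc_of% SpecMap_toField, point_mor]

lemma toField_mor_apply {M N : ZSModel F K} (f : M ⟶ N) (x : M.scheme)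
    (a : N.scheme.presheaf.stalk (mor f x)) :
    M.toField x ((mor f).stalkMap x a) = N.toField (mor f x) a :=
  ConcreteCategory.congr_hom (toField_mor f x) a

/-- The element of `K` defined by a section does not depend on the point at which its germ is
taken. -/
lemma germ_toField (M : ZSModel F K) {U : M.scheme.Opens} {x y : M.scheme} (hx : x ∈ U)
    (hy : y ∈ U) :
    M.scheme.presheaf.germ U x hx ≫ M.toField x = M.scheme.presheaf.germ U y hy ≫ M.toField y := by
  simp [toField]

lemma germ_toField_apply (M : ZSModel F K) {U : M.scheme.Opens} {x y : M.scheme} (hx : x ∈ U)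
    (hy : y ∈ U) (s : M.scheme.presheaf.obj (op U)) :
    M.toField x (M.scheme.presheaf.germ U x hx s) =
      M.toField y (M.scheme.presheaf.germ U y hy s) :=
  ConcreteCategory.congr_hom (M.germ_toField hx hy) s

lemma toField_injective (M : ZSModel F K) (x : M.scheme) :
    Function.Injective (M.toField x) := by
  rw [injective_iff_map_eq_zero]
  intro a ha
  obtain ⟨U, hx, s, rfl⟩ := M.scheme.presheaf.exists_germ_eq a
  have hg : genericPoint M.scheme ∈ U := (genericPoint_specializes x).mem_open U.2 hx
  rw [M.germ_toField_apply hx hg] at ha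
  have h1 := (injective_iff_map_eq_zero
    (M.toField (genericPoint M.scheme)).hom).1
      (RingHom.injective (R := M.scheme.functionField) (M.toField (genericPoint M.scheme)).hom) _ ha
  have : Nonempty U := ⟨⟨_, hg⟩⟩
  have h2 := (injective_iff_map_eq_zero (M.scheme.germToFunctionField U).hom).1
    (Scheme.germToFunctionField_injective M.scheme U) s h1
  rw [h2, map_zero]

/-- The structure morphism induces the inclusion `F ⊆ O_{X,x} ⊆ K`. -/
lemma exists_toField_algebraMap (M : ZSModel F K) (x : M.scheme) (a : F) :
    ∃ s, M.toField x s = algebraMap F K a := by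
  obtain ⟨φ, hφ⟩ : ∃ φ : CommRingCat.of F ⟶ M.scheme.presheaf.stalk x,
      Spec.map φ = M.scheme.fromSpecStalk x ≫ M.str := Spec.map_surjective _
  refine ⟨φ.hom a, ?_⟩
  have h : φ ≫ M.toField x = CommRingCat.ofHom (algebraMap F K) := by
    apply Spec.map_injective
    rw [Spec.map_comp, hφ, reassoc_of% SpecMap_toField, point_str]
  exact DFunLike.congr_fun (congrArg CommRingCat.Hom.hom h) a

end ZSModel

end Models

/-! ### Local rings in a field dominating local rings of models -/

section Dominating

variable {F K : Type u} [Field F] [Field K] [Algebra F K]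

namespace ZSModel

/-- The local ring `O ⊆ K` dominates the local ring of `M` at `x`. -/
structure Dominates (M : ZSModel F K) (O : Subring K) (x : M.scheme) : Prop where
  mem : ∀ s, M.toField x s ∈ O
  isUnit : ∀ s (t : K), t ∈ O → M.toField x s * t = 1 → IsUnit s

/-- If `O ⊆ K` contains the local ring at `x`, then `Spec K ⟶ M` extends to `Spec O ⟶ M`. -/
def fromSub (M : ZSModel F K) (O : Subring K) (x : M.scheme) (h : ∀ s, M.toField x s ∈ O) :
    Spec (CommRingCat.of O) ⟶ M.scheme :=
  Spec.map (CommRingCat.ofHom ((M.toField x).hom.codRestrict O h)) ≫ M.scheme.fromSpecStalk x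

/-- `Spec K ⟶ Spec O` for a subring `O` of `K`. -/
abbrev specIncl (O : Subring K) : Spec (CommRingCat.of K) ⟶ Spec (CommRingCat.of O) :=
  Spec.map (CommRingCat.ofHom O.subtype)

instance (O : Subring K) : IsDominant (specIncl O) := by
  constructor
  exact PrimeSpectrum.denseRange_comap_iff_ker_le_nilRadical _ |>.2 (by
    rw [(RingHom.injective_iff_ker_eq_bot _).1 Subtype.val_injective]; exact bot_le)

@[simp]
lemma specIncl_fromSub (M : ZSModel F K) (O : Subring K) (x : M.scheme)
    (h : ∀ s, M.toField x s ∈ O) : specIncl O ≫ M.fromSub O x h = M.point := by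
  rw [fromSub, ← Spec.map_comp_assoc, ← M.SpecMap_toField x]
  rfl

/-- `Spec O ⟶ Spec F` for an `F`-subalgebra `O` of `K`. -/
abbrev specStr (O : Subring K) (hO : ∀ a, algebraMap F K a ∈ O) :
    Spec (CommRingCat.of O) ⟶ Spec (CommRingCat.of F) :=
  Spec.map (CommRingCat.ofHom ((algebraMap F K).codRestrict O hO))

lemma specIncl_specStr (O : Subring K) (hO : ∀ a, algebraMap F K a ∈ O) :
    specIncl O ≫ specStr O hO = Spec.map (CommRingCat.ofHom (algebraMap F K)) := by
  rw [← Spec.map_comp]; rfl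

/-- Morphisms from `Spec O` to an affine scheme are determined by their restrictions to `Spec K`. -/
lemma specIncl_cancel {R : CommRingCat.{u}} (O : Subring K)
    (f g : Spec (CommRingCat.of O) ⟶ Spec R) (h : specIncl O ≫ f = specIncl O ≫ g) : f = g := by
  obtain ⟨f, rfl⟩ := Spec.map_surjective f
  obtain ⟨g, rfl⟩ := Spec.map_surjective g
  rw [← Spec.map_comp, ← Spec.map_comp] at h
  congr 1
  ext r
  exact congrArg (fun φ : R ⟶ CommRingCat.of K => φ r) (Spec.map_injective h)

omit [Algebra F K] in
/-- Two `F`-morphisms from `Spec O` to a separated `F`-scheme which agree on `Spec K` are equal. -/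
lemma specIncl_cancel_of_isSeparated {X : Scheme.{u}} (s : X ⟶ Spec (CommRingCat.of F))
    [IsSeparated s] (O : Subring K) (f g : Spec (CommRingCat.of O) ⟶ X)
    (h : specIncl O ≫ f = specIncl O ≫ g) : f = g := by
  have : IsDomain (CommRingCat.of O) := inferInstanceAs (IsDomain O)
  refine ext_of_isDominant_of_isSeparated s ?_ (specIncl O) h
  exact specIncl_cancel O _ _ (by rw [reassoc_of% h])

lemma fromSub_str (M : ZSModel F K) (O : Subring K) (x : M.scheme) (h : ∀ s, M.toField x s ∈ O)
    (hO : ∀ a, algebraMap F K a ∈ O) : M.fromSub O x h ≫ M.str = specStr O hO :=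
  specIncl_cancel O _ _ (by rw [reassoc_of% specIncl_fromSub, specIncl_specStr, point_str])

/-- The extensions `Spec O ⟶ M` are compatible with morphisms of models: since `N` is separated, it
suffices to compare them on `Spec K`. -/
lemma fromSub_mor {M N : ZSModel F K} (f : M ⟶ N) (O : Subring K) (x : M.scheme) (y : N.scheme)
    (h : ∀ s, M.toField x s ∈ O) (h' : ∀ s, N.toField y s ∈ O) :
    M.fromSub O x h ≫ mor f = N.fromSub O y h' :=
  specIncl_cancel_of_isSeparated N.str O _ _ (by
    rw [reassoc_of% specIncl_fromSub, point_mor, specIncl_fromSub])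

/-- The local homomorphism `O_{M,x} → O` sends the closed point to the closed point. -/
lemma Dominates.fromSub_closedPoint {M : ZSModel F K} {O : Subring K} [IsLocalRing O]
    {x : M.scheme} (h : M.Dominates O x) :
    M.fromSub O x h.mem (IsLocalRing.closedPoint O) = x := by
  have : IsLocalHom ((M.toField x).hom.codRestrict O h.mem) := by
    constructor
    intro s hs
    obtain ⟨t, ht⟩ := hs.exists_right_inv
    exact h.isUnit s t t.2 (congrArg Subtype.val ht)
  have h1 : Spec.map (CommRingCat.ofHom ((M.toField x).hom.codRestrict O h.mem))
      (IsLocalRing.closedPoint O) = IsLocalRing.closedPoint (M.scheme.presheaf.stalk x) :=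
    IsLocalRing.comap_closedPoint _
  exact (congrArg (M.scheme.fromSpecStalk x) h1).trans Scheme.fromSpecStalk_closedPoint

/-- A local ring in `K` dominates at most one local ring of a model, since models are separated. -/
lemma Dominates.unique {M : ZSModel F K} {O : Subring K} [IsLocalRing O]
    {x y : M.scheme} (hx : M.Dominates O x) (hy : M.Dominates O y) : x = y := by
  rw [← hx.fromSub_closedPoint, ← hy.fromSub_closedPoint,
    specIncl_cancel_of_isSeparated M.str O (M.fromSub O x hx.mem) (M.fromSub O y hy.mem) (by simp)]

/-- An extension `Spec O ⟶ M` of `Spec K ⟶ M` exhibits the image of the closed point as a point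
whose local ring is dominated by `O`. -/
lemma dominates_of_spec (M : ZSModel F K) (O : Subring K) [IsLocalRing O]
    (f : Spec (CommRingCat.of O) ⟶ M.scheme) (hf : specIncl O ≫ f = M.point) :
    M.Dominates O (f (IsLocalRing.closedPoint O)) := by
  have : IsLocalRing (CommRingCat.of O) := ‹IsLocalRing O›
  have h : Scheme.stalkClosedPointTo f ≫ CommRingCat.ofHom O.subtype =
      M.toField (f (IsLocalRing.closedPoint O)) := by
    apply eq_toField
    rw [Spec.map_comp, Category.assoc]
    erw [Scheme.Spec_stalkClosedPointTo_fromSpecStalk f]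
    exact hf
  have h' (s) : M.toField (f (IsLocalRing.closedPoint O)) s =
      ((Scheme.stalkClosedPointTo f s : O) : K) :=
    (ConcreteCategory.congr_hom h s).symm
  refine ⟨fun s => h' s ▸ SetLike.coe_mem _, fun s t ht hst => ?_⟩
  have hu : IsUnit ((Scheme.stalkClosedPointTo f).hom s) := by
    refine IsUnit.of_mul_eq_one ⟨t, ht⟩ (Subtype.ext ?_)
    rw [h' s] at hst
    exact hst
  exact (isUnit_map_iff (Scheme.stalkClosedPointTo f).hom s).1 hu

lemma Dominates.mor {M N : ZSModel F K} (f : M ⟶ N) {O : Subring K} {x : M.scheme}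
    (h : M.Dominates O x) : N.Dominates O (mor f x) where
  mem s := by rw [← toField_mor_apply]; exact h.mem _
  isUnit s t ht hst := by
    rw [← toField_mor_apply] at hst
    exact (isUnit_map_iff ((ZSModel.mor f).stalkMap x).hom s).1 (h.isUnit _ t ht hst)

end ZSModel

end Dominating

/-! ### Locally ringed spaces of local rings in a field -/

section ZSpace

variable (F K : Type u) [Field F] [Field K] [Algebra F K]

/-- A topological space with a point `eta` which specializes to every point, and with a local
`F`-subalgebra of `K` at each point such that every `f ∈ K` belongs to the local rings over an open
set. Both the Riemann variety and the limits of varieties arise from such data. -/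
structure ZData where
  carrier : Type u
  [top : TopologicalSpace carrier]
  ring : carrier → Subring K
  isLocalRing : ∀ x, IsLocalRing (ring x)
  algebraMap_mem : ∀ x a, algebraMap F K a ∈ ring x
  isOpen_mem : ∀ f : K, IsOpen {x | f ∈ ring x}
  eta : carrier
  eta_specializes : ∀ x, eta ⤳ x

attribute [instance] ZData.top ZData.isLocalRing

variable {F K}

namespace ZData

variable (Z : ZData F K)

/-- The underlying space. -/
abbrev zTop : TopCat.{u} := TopCat.of Z.carrier

/-- Functions which are constant with a value in all local rings involved. Over a nonempty open set
they correspond to the elements of the intersection of the local rings. -/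
def zPredicate : TopCat.LocalPredicate (fun _ : Z.zTop => K) where
  pred {U} s := ∃ f : K, ∀ v : U, f ∈ Z.ring v.1 ∧ s v = f
  res := by
    rintro U V i s ⟨f, hf⟩
    exact ⟨f, fun v => hf ⟨v.1, leOfHom i v.2⟩⟩
  locality := by
    intro U s hs
    by_cases hU : (U : Set Z.carrier).Nonempty
    · have hm {V : Opens Z.zTop} {x : Z.carrier} (hx : x ∈ V) : Z.eta ∈ V :=
        (Z.eta_specializes x).mem_open V.2 hx
      refine ⟨s ⟨Z.eta, hm hU.some_mem⟩, fun v => ?_⟩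
      obtain ⟨V, hv, i, f, hf⟩ := hs v
      have h1 := hf ⟨v.1, hv⟩
      have h3 : s ⟨Z.eta, hm hU.some_mem⟩ = f := (hf ⟨Z.eta, hm hv⟩).2
      rw [h3]
      exact h1
    · exact ⟨0, fun v => (hU ⟨v.1, v.2⟩).elim⟩

/-- The ring of sections over `U`. -/
def zSections (U : Opens Z.zTop) : Subring (U → K) where
  carrier := {s | Z.zPredicate.pred s}
  mul_mem' := by
    rintro s t ⟨f, hf⟩ ⟨g, hg⟩
    exact ⟨f * g, fun v => ⟨mul_mem (hf v).1 (hg v).1, by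
      rw [Pi.mul_apply, (hf v).2, (hg v).2]⟩⟩
  one_mem' := ⟨1, fun v => ⟨one_mem _, rfl⟩⟩
  add_mem' := by
    rintro s t ⟨f, hf⟩ ⟨g, hg⟩
    exact ⟨f + g, fun v => ⟨add_mem (hf v).1 (hg v).1, by
      rw [Pi.add_apply, (hf v).2, (hg v).2]⟩⟩
  zero_mem' := ⟨0, fun v => ⟨zero_mem _, rfl⟩⟩
  neg_mem' := by
    rintro s ⟨f, hf⟩
    exact ⟨-f, fun v => ⟨neg_mem (hf v).1, by rw [Pi.neg_apply, (hf v).2]⟩⟩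

lemma zSections_mem {U : Opens Z.zTop} (s : Z.zSections U) (v : U) : s.1 v ∈ Z.ring v.1 := by
  obtain ⟨f, hf⟩ := s.2
  rw [(hf v).2]
  exact (hf v).1

/-- Sections are constant functions. -/
lemma zSections_eq {U : Opens Z.zTop} (s : Z.zSections U) (v w : U) : s.1 v = s.1 w := by
  obtain ⟨f, hf⟩ := s.2
  rw [(hf v).2, (hf w).2]

/-- Evaluation of sections at a point. -/
def evalHom (U : Opens Z.zTop) (v : U) : Z.zSections U →+* Z.ring v.1 where
  toFun s := ⟨s.1 v, Z.zSections_mem s v⟩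
  map_one' := rfl
  map_mul' _ _ := rfl
  map_zero' := rfl
  map_add' _ _ := rfl

/-- The structure presheaf, with sections `⋂ x ∈ U, ring x` over `U` nonempty. -/
def zPresheaf : TopCat.Presheaf CommRingCat.{u} Z.zTop where
  obj U := CommRingCat.of (Z.zSections U.unop)
  map {U V} i := CommRingCat.ofHom
    { toFun := fun s => ⟨fun v => s.1 ⟨v.1, leOfHom i.unop v.2⟩, Z.zPredicate.res i.unop s.1 s.2⟩
      map_one' := rfl
      map_mul' := fun _ _ => rfl
      map_zero' := rfl
      map_add' := fun _ _ => rfl }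

lemma zPresheaf_isSheaf : Z.zPresheaf.IsSheaf :=
  (TopCat.Presheaf.isSheaf_iff_isSheaf_comp (forget CommRingCat) _).mpr
    (TopCat.Presheaf.isSheaf_of_iso
      (NatIso.ofComponents (fun _ => Iso.refl _) (fun _ => rfl) : TopCat.subpresheafToTypes
        Z.zPredicate.toPrelocalPredicate ≅ Z.zPresheaf ⋙ forget CommRingCat)
      (TopCat.subpresheafToTypes.isSheaf Z.zPredicate))

/-- Evaluation at `v` of the germs at `v`. -/
def zEval (v : Z.zTop) : Z.zPresheaf.stalk v ⟶ CommRingCat.of (Z.ring v) :=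
  colimit.desc ((OpenNhds.inclusion v).op ⋙ Z.zPresheaf)
    { pt := CommRingCat.of (Z.ring v)
      ι :=
        { app := fun U => CommRingCat.ofHom
            { toFun := fun (s : Z.zSections U.unop.1) =>
                ⟨s.1 ⟨v, U.unop.2⟩, Z.zSections_mem s ⟨v, U.unop.2⟩⟩
              map_one' := rfl
              map_mul' := fun _ _ => rfl
              map_zero' := rfl
              map_add' := fun _ _ => rfl }
          naturality := fun _ _ _ => by
            ext s
            rfl } }

lemma zEval_germ (v : Z.zTop) (U : Opens Z.zTop) (hv : v ∈ U) (s : Z.zSections U) :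
    ((Z.zEval v (Z.zPresheaf.germ U v hv s) : Z.ring v) : K) = s.1 ⟨v, hv⟩ := by
  have h : Z.zPresheaf.germ U v hv ≫ Z.zEval v = _ :=
    colimit.ι_desc (F := (OpenNhds.inclusion v).op ⋙ Z.zPresheaf) _ (op ⟨U, hv⟩)
  exact congrArg (Subtype.val (p := fun x => x ∈ Z.ring v)) (ConcreteCategory.congr_hom h s)

/-- The section with value `f` over the open set where `f` belongs to the local rings. -/
def zConst (f : K) : Z.zSections ⟨_, Z.isOpen_mem f⟩ := ⟨fun _ => f, f, fun v => ⟨v.2, rfl⟩⟩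

/-- The stalks are the given local rings. -/
lemma zEval_bijective (v : Z.zTop) : Function.Bijective (Z.zEval v) := by
  constructor
  · intro a b hab
    obtain ⟨U, hU, s, rfl⟩ := Z.zPresheaf.exists_germ_eq a
    obtain ⟨V, hV, t, rfl⟩ := Z.zPresheaf.exists_germ_eq b
    have h : s.1 ⟨v, hU⟩ = t.1 ⟨v, hV⟩ := by
      rw [← Z.zEval_germ v U hU s, ← Z.zEval_germ v V hV t, hab]
    refine TopCat.Presheaf.germ_ext _ (U ⊓ V) ⟨hU, hV⟩ (homOfLE inf_le_left)
      (homOfLE inf_le_right) ?_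
    apply Subtype.ext
    funext w
    change s.1 ⟨w.1, w.2.1⟩ = t.1 ⟨w.1, w.2.2⟩
    rw [Z.zSections_eq s _ ⟨v, hU⟩, h, Z.zSections_eq t]
  · rintro ⟨f, hf⟩
    exact ⟨Z.zPresheaf.germ ⟨_, Z.isOpen_mem f⟩ v hf (Z.zConst f),
      Subtype.ext (Z.zEval_germ v _ hf (Z.zConst f))⟩

instance (v : Z.zTop) : IsIso (Z.zEval v) :=
  (ConcreteCategory.isIso_iff_bijective _).2 (Z.zEval_bijective v)

/-- The locally ringed space with the given local rings. -/
def zSpace : LocallyRingedSpace.{u} where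
  carrier := Z.zTop
  presheaf := Z.zPresheaf
  IsSheaf := Z.zPresheaf_isSheaf
  isLocalRing v :=
    haveI : IsLocalRing (CommRingCat.of (Z.ring v)) := Z.isLocalRing v
    haveI : IsLocalHom (Z.zEval v).hom := isLocalHom_of_isIso _
    RingHom.domain_isLocalRing (Z.zEval v).hom

/-- The `F`-algebra structure on the global sections, by constants. -/
def zAlgebra : CommRingCat.of F ⟶ LocallyRingedSpace.Γ.obj (op Z.zSpace) :=
  CommRingCat.ofHom
    { toFun := fun a => (⟨fun _ => algebraMap F K a, algebraMap F K a,
        fun v => ⟨Z.algebraMap_mem v.1 a, rfl⟩⟩ : Z.zSections ⊤)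
      map_one' := Subtype.ext (funext fun _ => map_one _)
      map_mul' := fun a b => Subtype.ext (funext fun _ => map_mul _ a b)
      map_zero' := Subtype.ext (funext fun _ => map_zero _)
      map_add' := fun a b => Subtype.ext (funext fun _ => map_add _ a b) }

/-- The locally ringed space over `F` with the given local rings. -/
def zOver : LRSOver F :=
  Over.mk (Y := Z.zSpace)
    ((ΓSpec.locallyRingedSpaceAdjunction.homEquiv Z.zSpace (op (CommRingCat.of F))) Z.zAlgebra.op)

end ZData

variable (F K) in
/-- The data defining the Riemann variety; `zOver` applied to them is the Riemann variety by
definition. -/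
def rData : ZData F K where
  carrier := RPoint F K
  ring v := v.ring.toSubring
  isLocalRing v := inferInstanceAs (IsLocalRing v.ring)
  algebraMap_mem v a := v.algebraMap_mem a
  isOpen_mem f := RPoint.isOpen_mem f
  eta := RPoint.eta
  eta_specializes x := specializes_iff_forall_open.2 fun _ hU hx => RPoint.eta_mem hU ⟨x, hx⟩

end ZSpace

/-! ### Morphisms from spaces of local rings to models -/

section ZHom

variable {F K : Type u} [Field F] [Field K] [Algebra F K]

namespace ZData

variable (Z : ZData F K) (M : ZSModel F K)

/-- The comorphism of `zHom`, given by the inclusions of local rings in `K`. -/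
def zComorphism (b : C(Z.carrier, M.scheme)) (hb : ∀ x, M.Dominates (Z.ring x) (b x)) :
    M.scheme.presheaf ⟶ (TopCat.Presheaf.pushforward CommRingCat
      (TopCat.ofHom b : Z.zTop ⟶ M.scheme.toTopCat)).obj Z.zPresheaf where
  app U := CommRingCat.ofHom
    { toFun := fun s => (⟨fun v =>
          M.toField (b v.1) (M.scheme.presheaf.germ U.unop (b v.1) v.2 s), by
        by_cases h : (b ⁻¹' (U.unop : Set M.scheme)).Nonempty
        · obtain ⟨w, hw⟩ := h
          exact ⟨M.toField (b w) (M.scheme.presheaf.germ U.unop (b w) hw s), fun v =>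
            ⟨by rw [M.germ_toField_apply hw v.2]; exact (hb v.1).mem _,
              M.germ_toField_apply v.2 hw s⟩⟩
        · exact ⟨0, fun v => (h ⟨v.1, v.2⟩).elim⟩⟩ :
        Z.zSections ((Opens.map (TopCat.ofHom b : Z.zTop ⟶ M.scheme.toTopCat)).obj U.unop))
      map_one' := Subtype.ext (funext fun v => by simp)
      map_mul' := fun s t => Subtype.ext (funext fun v => by simp)
      map_zero' := Subtype.ext (funext fun v => by simp)
      map_add' := fun s t => Subtype.ext (funext fun v => by simp) }
  naturality U V i := by
    ext s
    apply Subtype.ext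
    funext v
    change M.toField (b v.1) (M.scheme.presheaf.germ V.unop (b v.1) v.2
      (M.scheme.presheaf.map i s)) = M.toField (b v.1) (M.scheme.presheaf.germ U.unop (b v.1)
        (leOfHom i.unop v.2) s)
    congr 1
    exact TopCat.Presheaf.germ_res_apply' M.scheme.presheaf i _ v.2 s

/-- A continuous map from a space of local rings to a model, such that the local ring at each point
dominates that of its image, defines a morphism of locally ringed spaces. -/
def zHomLeft (b : C(Z.carrier, M.scheme)) (hb : ∀ x, M.Dominates (Z.ring x) (b x)) :
    Z.zSpace ⟶ M.scheme.toLocallyRingedSpace where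
  base := TopCat.ofHom b
  c := Z.zComorphism M b hb
  prop x := by
    constructor
    intro a ha
    obtain ⟨U, hU, s, rfl⟩ := M.scheme.presheaf.exists_germ_eq a
    have h := PresheafedSpace.stalkMap_germ_apply
      (X := Z.zSpace.toPresheafedSpace) (Y := M.scheme.toPresheafedSpace)
      ⟨TopCat.ofHom b, Z.zComorphism M b hb⟩ U x hU s
    obtain ⟨t, ht⟩ := (ha.map (Z.zEval x).hom).exists_right_inv
    refine (hb x).isUnit _ (t : Z.ring x).1 (t : Z.ring x).2 ?_
    have h1 := congrArg (Subtype.val (p := fun y => y ∈ Z.ring x)) ht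
    refine Eq.trans ?_ h1
    refine congrArg (· * (t : Z.ring x).1) ?_
    refine (Z.zEval_germ x ((Opens.map (TopCat.ofHom b : Z.zTop ⟶ M.scheme.toTopCat)).obj U) hU
      ((Z.zComorphism M b hb).app (op U) s)).symm.trans (congrArg Subtype.val ?_)
    exact congrArg (Z.zEval x) h.symm

/-- On sections, `zHom` is the inclusion of the local rings of `M` in `K`. -/
lemma zHomLeft_app_apply (b : C(Z.carrier, M.scheme)) (hb : ∀ x, M.Dominates (Z.ring x) (b x))
    (U : M.scheme.Opens) (s : M.scheme.presheaf.obj (op U)) (v : Z.carrier) (hv : b v ∈ U) :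
    ((Z.zHomLeft M b hb).c.app (op U) s :
      Z.zSections ((Opens.map (TopCat.ofHom b : Z.zTop ⟶ M.scheme.toTopCat)).obj U)).1 ⟨v, hv⟩ =
        M.toField (b v) (M.scheme.presheaf.germ U (b v) hv s) := rfl

/-- A morphism to the spectrum of a ring is determined by its effect on global sections. -/
lemma _root_.BirGeom.eq_homEquiv {X : LocallyRingedSpace.{u}} {R : CommRingCat.{u}}
    (g : X ⟶ (Spec R).toLocallyRingedSpace) (f : R ⟶ LocallyRingedSpace.Γ.obj (op X))
    (h : (Scheme.ΓSpecIso R).inv ≫ g.c.app (op ⊤) = f) :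
    g = ΓSpec.locallyRingedSpaceAdjunction.homEquiv X (op R) f.op := by
  refine (Equiv.symm_apply_eq
    (ΓSpec.locallyRingedSpaceAdjunction.homEquiv X (op R))).1 ?_
  refine (Adjunction.homEquiv_counit _ _ _ _).trans ?_
  rw [ΓSpec.locallyRingedSpaceAdjunction_counit_app, ← h]
  rfl

/-- The `F`-algebra structure on global sections is compatible with the embeddings in `K`. -/
lemma _root_.BirGeom.ZSModel.toField_germ_str (x : M.scheme) :
    (Scheme.ΓSpecIso (CommRingCat.of F)).inv ≫ M.str.appTop ≫
      M.scheme.presheaf.germ ⊤ x trivial ≫ M.toField x =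
        CommRingCat.ofHom (algebraMap F K) := by
  apply Spec.map_injective
  rw [Spec.map_comp, Spec.map_comp, Spec.map_comp, Category.assoc, Category.assoc,
    ← Scheme.fromSpecStalk_toSpecΓ, Category.assoc, reassoc_of% ZSModel.SpecMap_toField,
    ← Scheme.toSpecΓ_naturality_assoc, ← AlgebraicGeometry.SpecMap_ΓSpecIso_hom, ← Spec.map_comp,
    Iso.inv_hom_id, Spec.map_id, Category.comp_id, ZSModel.point_str]

/-- The morphism over `F` with underlying morphism `zHomLeft`. -/
def zHom (b : C(Z.carrier, M.scheme)) (hb : ∀ x, M.Dominates (Z.ring x) (b x)) :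
    Z.zOver ⟶ (ZSModel.toLRS F K).obj M :=
  Over.homMk (Z.zHomLeft M b hb) (by
    refine eq_homEquiv _ _ ?_
    ext a
    apply Subtype.ext
    funext v
    exact DFunLike.congr_fun (congrArg CommRingCat.Hom.hom (M.toField_germ_str (b v.1))) a)

end ZData

end ZHom

/-! ### Morphisms of locally ringed spaces and germs -/

section LRS

lemma lrs_section_ext {X : LocallyRingedSpace.{u}} {W : Opens X.toTopCat}
    (s t : X.presheaf.obj (op W))
    (h : ∀ x hx, X.presheaf.germ W x hx s = X.presheaf.germ W x hx t) : s = t :=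
  TopCat.Presheaf.section_ext X.sheaf W s t h

/-- Morphisms of locally ringed spaces are equal if they agree on points and on germs of sections.
-/
lemma lrs_hom_ext {X Y : LocallyRingedSpace.{u}} (f g : X ⟶ Y)
    (hb : ∀ x, f.base x = g.base x)
    (h : ∀ (U : Opens Y.toTopCat) (s : Y.presheaf.obj (op U)) (x : X) (hx : f.base x ∈ U)
      (hx' : g.base x ∈ U),
      X.presheaf.germ ((Opens.map f.base).obj U) x hx (f.c.app (op U) s) =
        X.presheaf.germ ((Opens.map g.base).obj U) x hx' (g.c.app (op U) s)) : f = g := by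
  have hbase : f.base = g.base := TopCat.hom_ext (ContinuousMap.ext hb)
  obtain ⟨⟨fb, fc⟩, fp⟩ := f
  obtain ⟨⟨gb, gc⟩, gp⟩ := g
  obtain rfl : fb = gb := hbase
  obtain rfl : fc = gc := by
    ext U s
    exact lrs_section_ext _ _ fun x hx => h U s x hx hx
  rfl

/-- A family of germs which is locally given by sections is given by a section. -/
lemma exists_section_of_germs {X : LocallyRingedSpace.{u}} (W : Opens X.toTopCat)
    (t : ∀ x ∈ W, X.presheaf.stalk x)
    (h : ∀ x ∈ W, ∃ (V : Opens X.toTopCat) (_ : x ∈ V) (s : X.presheaf.obj (op V)),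
      ∀ y (hy : y ∈ W) (hy' : y ∈ V), X.presheaf.germ V y hy' s = t y hy) :
    ∃ s : X.presheaf.obj (op W), ∀ x hx, X.presheaf.germ W x hx s = t x hx := by
  choose V hV s hs using h
  let V' : W → Opens X.toTopCat := fun x => V x.1 x.2 ⊓ W
  let i (x : W) : V' x ⟶ V x.1 x.2 := homOfLE inf_le_left
  let k (x : W) : V' x ⟶ W := homOfLE inf_le_right
  obtain ⟨σ, hσ, -⟩ := X.sheaf.existsUnique_gluing' V' W k
    (fun x hx => Opens.mem_iSup.2 ⟨⟨x, hx⟩, hV x hx, hx⟩)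
    (fun x => X.presheaf.map (i x).op (s x.1 x.2)) (by
      intro x y
      refine lrs_section_ext _ _ fun z hz => ?_
      erw [TopCat.Presheaf.germ_res_apply, TopCat.Presheaf.germ_res_apply,
        TopCat.Presheaf.germ_res_apply, TopCat.Presheaf.germ_res_apply]
      rw [hs _ _ z hz.1.2, hs _ _ z hz.1.2])
  refine ⟨σ, fun x hx => ?_⟩
  have h1 := congrArg (X.presheaf.germ (V' ⟨x, hx⟩) x ⟨hV x hx, hx⟩) (hσ ⟨x, hx⟩)
  erw [TopCat.Presheaf.germ_res_apply, TopCat.Presheaf.germ_res_apply] at h1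
  rw [hs x hx x hx] at h1
  exact h1

lemma lrs_stalkMap_germ_apply {X Y : LocallyRingedSpace.{u}} (f : X ⟶ Y) (U : Opens Y.toTopCat)
    (x : X) (hx : f.base x ∈ U) (s : Y.presheaf.obj (op U)) :
    f.stalkMap x (Y.presheaf.germ U (f.base x) hx s) =
      X.presheaf.germ ((Opens.map f.base).obj U) x hx (f.c.app (op U) s) :=
  PresheafedSpace.stalkMap_germ_apply f.toHom U x hx s

end LRS

/-! ### Recognition of cofiltered limits of models -/

section Limit

variable {F K : Type u} [Field F] [Field K] [Algebra F K]

/-- The morphism of locally ringed spaces underlying a morphism of models. -/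
abbrev ZSModel.lrsMor {M N : ZSModel F K} (p : M ⟶ N) :
    M.scheme.toLocallyRingedSpace ⟶ N.scheme.toLocallyRingedSpace :=
  (ZSModel.mor p).toLRSHom

variable {J : Type v} [Category.{w} J]

/-- Conditions under which the continuous maps `b j` exhibit the space of local rings `Z` as the
limit of the models `D j`: the points of `Z` are the compatible families of points, `Z` carries the
limit topology, and its local rings are the unions of the local rings of the models. -/
structure IsZLimit (Z : ZData F K) (D : J ⥤ ZSModel F K)
    (b : ∀ j, C(Z.carrier, (D.obj j).scheme)) : Prop where
  dominates : ∀ j x, (D.obj j).Dominates (Z.ring x) (b j x)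
  w : ∀ {i j} (f : i ⟶ j) x, ZSModel.mor (D.map f) (b i x) = b j x
  inj : ∀ x y, (∀ j, b j x = b j y) → x = y
  surj : ∀ y : ∀ j, (D.obj j).scheme,
    (∀ {i j} (f : i ⟶ j), ZSModel.mor (D.map f) (y i) = y j) → ∃ x, ∀ j, b j x = y j
  top_eq : Z.top = ⨅ j, TopologicalSpace.induced (b j) inferInstance
  exists_toField : ∀ x, ∀ f ∈ Z.ring x, ∃ j a, (D.obj j).toField (b j x) a = f

/-- A compatible family of morphisms from a locally ringed space to the members of a diagram of
models. -/
structure LRSCone (D : J ⥤ ZSModel F K) (X : LocallyRingedSpace.{u}) where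
  app : ∀ j, X ⟶ (D.obj j).scheme.toLocallyRingedSpace
  w : ∀ {i j} (f : i ⟶ j), app i ≫ ZSModel.lrsMor (D.map f) = app j

/-- A germ on a model pulls back to each model above it, without change of its value in `K` or of
its pullback to `X`. -/
lemma exists_lift_stalk {M N : ZSModel F K} (p : M ⟶ N) {X : LocallyRingedSpace.{u}}
    (g : X ⟶ M.scheme.toLocallyRingedSpace) (h : X ⟶ N.scheme.toLocallyRingedSpace)
    (w : g ≫ ZSModel.lrsMor p = h) (x : X) (a : N.scheme.presheaf.stalk (h.base x)) :
    ∃ a' : M.scheme.presheaf.stalk (g.base x), M.toField (g.base x) a' = N.toField (h.base x) a ∧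
      g.stalkMap x a' = h.stalkMap x a := by
  subst w
  refine ⟨(ZSModel.mor p).stalkMap (g.base x) a, ZSModel.toField_mor_apply p (g.base x) a, ?_⟩
  exact (ConcreteCategory.congr_hom
    (LocallyRingedSpace.stalkMap_comp g (ZSModel.lrsMor p) x) a).symm

namespace LRSCone

variable {D : J ⥤ ZSModel F K} {X : LocallyRingedSpace.{u}} (g : LRSCone D X)

/-- The pullback to `X` of an element of a local ring depends only on its value in `K`. -/
lemma stalkMap_eq [IsCofiltered J] (x : X) {j k : J}
    (a : (D.obj j).scheme.presheaf.stalk ((g.app j).base x))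
    (b : (D.obj k).scheme.presheaf.stalk ((g.app k).base x))
    (h : (D.obj j).toField _ a = (D.obj k).toField _ b) :
    (g.app j).stalkMap x a = (g.app k).stalkMap x b := by
  obtain ⟨i, p, q, -⟩ := IsCofilteredOrEmpty.cone_objs j k
  obtain ⟨a', ha, ha'⟩ := exists_lift_stalk (D.map p) _ _ (g.w p) x a
  obtain ⟨b', hb, hb'⟩ := exists_lift_stalk (D.map q) _ _ (g.w q) x b
  rw [← ha', ← hb', (D.obj i).toField_injective _ (ha.trans (h.trans hb.symm))]

end LRSCone

namespace IsZLimit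

variable {Z : ZData F K} {D : J ⥤ ZSModel F K} {b : ∀ j, C(Z.carrier, (D.obj j).scheme)}
  (hZ : IsZLimit Z D b) {X : LocallyRingedSpace.{u}} (g : LRSCone D X)

include hZ in
lemma exists_base (x : X) : ∃ z, ∀ j, b j z = (g.app j).base x := by
  refine hZ.surj _ fun {i j} f => ?_
  rw [← g.w f]
  rfl

/-- The map on points of the lift. -/
def base (x : X) : Z.carrier := (hZ.exists_base g x).choose

lemma b_base (x : X) (j : J) : b j (hZ.base g x) = (g.app j).base x :=
  (hZ.exists_base g x).choose_spec j

lemma continuous_base : Continuous (hZ.base g) := by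
  have h : @Continuous _ _ _ (⨅ j, TopologicalSpace.induced (b j) inferInstance) (hZ.base g) := by
    refine continuous_iInf_rng.2 fun j => continuous_induced_rng.2 ?_
    have : b j ∘ hZ.base g = (g.app j).base := funext fun x => hZ.b_base g x j
    rw [this]
    exact (g.app j).base.hom.continuous
  rw [← hZ.top_eq] at h
  exact h

lemma exists_stalk (x : X) (f : K) (hf : f ∈ Z.ring (hZ.base g x)) :
    ∃ j, ∃ a : (D.obj j).scheme.presheaf.stalk ((g.app j).base x), (D.obj j).toField _ a = f := by
  obtain ⟨j, a, ha⟩ := hZ.exists_toField _ f hf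
  refine ⟨j, ?_⟩
  rw [← hZ.b_base g x j]
  exact ⟨a, ha⟩

/-- The map on local rings of the lift: an element of the local ring of `Z` comes from a germ on
some model, which is pulled back to `X`. -/
def stalkFun (x : X) (f : Z.ring (hZ.base g x)) : X.presheaf.stalk x :=
  (g.app (hZ.exists_stalk g x f f.2).choose).stalkMap x
    (hZ.exists_stalk g x f f.2).choose_spec.choose

/-- Any morphism to `Z` is determined on germs by its composites with the projections. -/
lemma germ_eq (m : X ⟶ Z.zSpace) {j : J} (h : X ⟶ (D.obj j).scheme.toLocallyRingedSpace)
    (hm : m ≫ Z.zHomLeft (D.obj j) (b j) (hZ.dominates j) = h)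
    (U : Opens Z.zTop) (s : Z.zSections U) (x : X) (hx : m.base x ∈ U)
    (a : (D.obj j).scheme.presheaf.stalk (h.base x))
    (ha : (D.obj j).toField _ a = s.1 ⟨m.base x, hx⟩) :
    X.presheaf.germ ((Opens.map m.base).obj U) x hx (m.c.app (op U) s) = h.stalkMap x a := by
  subst hm
  have h1 := ConcreteCategory.congr_hom
    (LocallyRingedSpace.stalkMap_comp m (Z.zHomLeft (D.obj j) (b j) (hZ.dominates j)) x) a
  refine Eq.trans ?_ h1.symm
  refine (lrs_stalkMap_germ_apply m U x hx s).symm.trans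
    (congrArg (m.stalkMap x) ((Z.zEval_bijective (m.base x)).1 (Subtype.ext ?_)))
  refine (Z.zEval_germ _ U hx s).trans (ha.symm.trans ?_)
  obtain ⟨V, hV, r, rfl⟩ := (D.obj j).scheme.presheaf.exists_germ_eq a
  refine Eq.trans ?_ (congrArg (fun t => ((Z.zEval (m.base x) t : Z.ring (m.base x)) : K))
    (lrs_stalkMap_germ_apply (Z.zHomLeft (D.obj j) (b j) (hZ.dominates j)) V (m.base x) hV r).symm)
  exact (Z.zEval_germ (m.base x) ((Opens.map (TopCat.ofHom (b j) : Z.zTop ⟶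
    (D.obj j).scheme.toTopCat)).obj V) hV
    ((Z.zComorphism _ (b j) (hZ.dominates j)).app (op V) r)).symm

/-- Uniqueness of the lift. -/
lemma hom_ext (m m' : X ⟶ Z.zSpace)
    (h : ∀ j, m ≫ Z.zHomLeft (D.obj j) (b j) (hZ.dominates j) =
      m' ≫ Z.zHomLeft (D.obj j) (b j) (hZ.dominates j)) : m = m' := by
  have hb (x : X) : m.base x = m'.base x :=
    hZ.inj _ _ fun j =>
      congrArg (fun t : X ⟶ (D.obj j).scheme.toLocallyRingedSpace => t.base x) (h j)
  refine lrs_hom_ext _ _ hb fun U s x hx hx' => ?_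
  obtain ⟨j, a, ha⟩ := hZ.exists_toField _ _ (Z.zSections_mem s ⟨_, hx⟩)
  have key {k : X ⟶ (D.obj j).scheme.toLocallyRingedSpace}
      (hk : m ≫ Z.zHomLeft (D.obj j) (b j) (hZ.dominates j) = k) :
      ∃ a : (D.obj j).scheme.presheaf.stalk (k.base x),
        (D.obj j).toField _ a = s.1 ⟨m.base x, hx⟩ := by
    subst hk; exact ⟨a, ha⟩
  obtain ⟨c, hc⟩ := key (h j)
  exact (hZ.germ_eq m _ (h j) U s x hx c hc).trans
    (hZ.germ_eq m' _ rfl U s x hx' c (hc.trans (Z.zSections_eq s _ _))).symm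

/-- The projections are compatible with the transition morphisms. -/
lemma zHomLeft_comp {i j : J} (f : i ⟶ j) :
    Z.zHomLeft (D.obj i) (b i) (hZ.dominates i) ≫ ZSModel.lrsMor (D.map f) =
      Z.zHomLeft (D.obj j) (b j) (hZ.dominates j) := by
  refine lrs_hom_ext _ _ (hZ.w f) fun U s x hx hx' => ?_
  refine TopCat.Presheaf.germ_ext Z.zPresheaf
    ((Opens.map (TopCat.ofHom (b j) : Z.zTop ⟶ (D.obj j).scheme.toTopCat)).obj U) hx'
    (homOfLE fun v hv => ?_) (𝟙 _) ?_
  · change ZSModel.mor (D.map f) (b i v) ∈ U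
    rw [hZ.w f v]; exact hv
  · apply Subtype.ext
    funext v
    have h1 : ZSModel.mor (D.map f) (b i v.1) ∈ U := by rw [hZ.w f v.1]; exact v.2
    change (D.obj i).toField (b i v.1) ((D.obj i).scheme.presheaf.germ _ (b i v.1) h1
      ((ZSModel.mor (D.map f)).app U s)) =
        (D.obj j).toField (b j v.1) ((D.obj j).scheme.presheaf.germ U (b j v.1) v.2 s)
    refine Eq.trans ?_ ((D.obj j).germ_toField_apply h1 v.2 s)
    rw [← ZSModel.toField_mor_apply, Scheme.Hom.germ_stalkMap_apply]

/-- The projections from a limit. -/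
def cone : Cone (D ⋙ ZSModel.toLRS F K) where
  pt := Z.zOver
  π :=
    { app := fun j => Z.zHom (D.obj j) (b j) (hZ.dominates j)
      naturality := fun _ _ f => (Category.id_comp _).trans
        (Over.OverMorphism.ext (hZ.zHomLeft_comp f).symm) }

variable [IsCofiltered J]

lemma stalkFun_eq (x : X) (f : Z.ring (hZ.base g x)) {j : J}
    (a : (D.obj j).scheme.presheaf.stalk ((g.app j).base x)) (ha : (D.obj j).toField _ a = f) :
    hZ.stalkFun g x f = (g.app j).stalkMap x a :=
  g.stalkMap_eq x _ _ ((hZ.exists_stalk g x f f.2).choose_spec.choose_spec.trans ha.symm)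

lemma exists_stalk₂ (x : X) (f f' : Z.ring (hZ.base g x)) :
    ∃ j, ∃ a a' : (D.obj j).scheme.presheaf.stalk ((g.app j).base x),
      (D.obj j).toField _ a = f ∧ (D.obj j).toField _ a' = f' := by
  obtain ⟨j, a, ha⟩ := hZ.exists_stalk g x f f.2
  obtain ⟨k, a', ha'⟩ := hZ.exists_stalk g x f' f'.2
  obtain ⟨i, p, q, -⟩ := IsCofilteredOrEmpty.cone_objs j k
  obtain ⟨c, hc, -⟩ := exists_lift_stalk (D.map p) _ _ (g.w p) x a
  obtain ⟨c', hc', -⟩ := exists_lift_stalk (D.map q) _ _ (g.w q) x a'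
  exact ⟨i, c, c', hc.trans ha, hc'.trans ha'⟩

/-- The homomorphism of local rings of the lift. -/
def stalkHom (x : X) : Z.ring (hZ.base g x) →+* X.presheaf.stalk x where
  toFun := hZ.stalkFun g x
  map_one' := by
    obtain ⟨j, -⟩ := hZ.exists_stalk g x 1 (one_mem _)
    rw [hZ.stalkFun_eq g x 1 (j := j) 1 (map_one _), map_one]
  map_zero' := by
    obtain ⟨j, -⟩ := hZ.exists_stalk g x 1 (one_mem _)
    rw [hZ.stalkFun_eq g x 0 (j := j) 0 (map_zero _), map_zero]
  map_mul' f f' := by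
    obtain ⟨j, a, a', ha, ha'⟩ := hZ.exists_stalk₂ g x f f'
    rw [hZ.stalkFun_eq g x f a ha, hZ.stalkFun_eq g x f' a' ha',
      hZ.stalkFun_eq g x (f * f') (a * a') (by rw [map_mul, ha, ha']; rfl), map_mul]
  map_add' f f' := by
    obtain ⟨j, a, a', ha, ha'⟩ := hZ.exists_stalk₂ g x f f'
    rw [hZ.stalkFun_eq g x f a ha, hZ.stalkFun_eq g x f' a' ha',
      hZ.stalkFun_eq g x (f + f') (a + a') (by rw [map_add, ha, ha']; rfl), map_add]

lemma stalkHom_eq (x : X) (f : Z.ring (hZ.base g x)) {j : J}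
    (a : (D.obj j).scheme.presheaf.stalk ((g.app j).base x)) (ha : (D.obj j).toField _ a = f) :
    hZ.stalkHom g x f = (g.app j).stalkMap x a := hZ.stalkFun_eq g x f a ha

/-- The lift is local on stalks: if the pullback to `X` of a germ on a model is a unit, so is the
germ, because the morphism from `X` to the model is local. -/
lemma isLocalHom_stalkHom (x : X) : IsLocalHom (hZ.stalkHom g x) where
  map_nonunit f hf := by
    obtain ⟨j, a, ha⟩ := hZ.exists_stalk g x f f.2
    rw [hZ.stalkHom_eq g x f a ha] at hf
    have h1 : IsUnit a := (isUnit_map_iff ((g.app j).stalkMap x).hom a).1 hf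
    obtain ⟨c, hc⟩ := h1.exists_right_inv
    have h2 := congrArg ((D.obj j).toField _) hc
    rw [map_mul, map_one, ha] at h2
    have h3 : (D.obj j).toField _ c ∈ Z.ring (hZ.base g x) := by
      have := (hZ.dominates j (hZ.base g x)).mem
      rw [hZ.b_base g x j] at this
      exact this c
    exact IsUnit.of_mul_eq_one ⟨_, h3⟩ (Subtype.ext h2)

/-- The continuous map underlying the lift. -/
abbrev baseHom : X.toTopCat ⟶ Z.zTop := TopCat.ofHom ⟨hZ.base g, hZ.continuous_base g⟩

/-- The germs of the pullback of a section of `Z` are the germs of a section of `X`. -/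
lemma exists_app (U : Opens Z.zTop) (s : Z.zSections U) :
    ∃ t : X.presheaf.obj (op ((Opens.map (hZ.baseHom g)).obj U)), ∀ x hx,
      X.presheaf.germ _ x hx t =
        hZ.stalkHom g x ⟨s.1 ⟨hZ.base g x, hx⟩, Z.zSections_mem s ⟨hZ.base g x, hx⟩⟩ := by
  refine exists_section_of_germs _ (fun x hx => hZ.stalkHom g x
    ⟨s.1 ⟨hZ.base g x, hx⟩, Z.zSections_mem s ⟨hZ.base g x, hx⟩⟩) fun x hx => ?_
  obtain ⟨j, a, ha⟩ := hZ.exists_stalk g x (s.1 ⟨hZ.base g x, hx⟩) (Z.zSections_mem s ⟨_, hx⟩)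
  obtain ⟨V, hV, r, rfl⟩ := (D.obj j).scheme.presheaf.exists_germ_eq a
  refine ⟨(Opens.map (g.app j).base).obj V, hV, (g.app j).c.app (op V) r, fun y hy hy' => ?_⟩
  rw [hZ.stalkHom_eq g y _ ((D.obj j).scheme.presheaf.germ V _ hy' r)]
  · exact (lrs_stalkMap_germ_apply (g.app j) V y hy' r).symm
  · rw [(D.obj j).germ_toField_apply hy' hV r, ha]
    exact Z.zSections_eq s _ _

/-- The map on sections of the lift. -/
def appFun (U : Opens Z.zTop) (s : Z.zSections U) :
    X.presheaf.obj (op ((Opens.map (hZ.baseHom g)).obj U)) := (hZ.exists_app g U s).choose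

lemma germ_appFun (U : Opens Z.zTop) (s : Z.zSections U) (x : X) (hx : hZ.base g x ∈ U) :
    X.presheaf.germ ((Opens.map (hZ.baseHom g)).obj U) x hx (hZ.appFun g U s) =
      hZ.stalkHom g x ⟨s.1 ⟨hZ.base g x, hx⟩, Z.zSections_mem s ⟨hZ.base g x, hx⟩⟩ :=
  (hZ.exists_app g U s).choose_spec x hx

/-- The homomorphism on sections of the lift. -/
def appHom (U : Opens Z.zTop) :
    Z.zSections U →+* X.presheaf.obj (op ((Opens.map (hZ.baseHom g)).obj U)) :=
  have e (x : X) (hx : hZ.base g x ∈ U) (s : Z.zSections U) :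
      (X.presheaf.germ ((Opens.map (hZ.baseHom g)).obj U) x hx).hom (hZ.appFun g U s) =
        ((hZ.stalkHom g x).comp (Z.evalHom U ⟨_, hx⟩)) s := hZ.germ_appFun g U s x hx
  { toFun := hZ.appFun g U
    map_one' := lrs_section_ext _ _ fun x hx => ((e x hx 1).trans (map_one _)).trans
      (map_one (X.presheaf.germ ((Opens.map (hZ.baseHom g)).obj U) x hx).hom).symm
    map_zero' := lrs_section_ext _ _ fun x hx => ((e x hx 0).trans (map_zero _)).trans
      (map_zero (X.presheaf.germ ((Opens.map (hZ.baseHom g)).obj U) x hx).hom).symm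
    map_mul' := fun s t => lrs_section_ext _ _ fun x hx => by
      refine Eq.trans ?_ (map_mul (X.presheaf.germ _ x hx).hom _ _).symm
      exact (e x hx (s * t)).trans ((map_mul _ s t).trans
        (congrArg₂ (· * ·) (e x hx s).symm (e x hx t).symm))
    map_add' := fun s t => lrs_section_ext _ _ fun x hx => by
      refine Eq.trans ?_ (map_add (X.presheaf.germ _ x hx).hom _ _).symm
      exact (e x hx (s + t)).trans ((map_add _ s t).trans
        (congrArg₂ (· + ·) (e x hx s).symm (e x hx t).symm)) }

/-- The comorphism of the lift. -/
def comorphism : Z.zPresheaf ⟶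
    (TopCat.Presheaf.pushforward CommRingCat (hZ.baseHom g)).obj X.presheaf where
  app U := CommRingCat.ofHom (hZ.appHom g U.unop)
  naturality U V i := by
    ext s
    refine lrs_section_ext _ _ fun x hx => ?_
    refine (hZ.germ_appFun g V.unop (Z.zPresheaf.map i s) x hx).trans ?_
    refine Eq.trans ?_ (TopCat.Presheaf.germ_res_apply' X.presheaf
      ((Opens.map (hZ.baseHom g)).map i.unop).op x hx (hZ.appFun g U.unop s)).symm
    exact (hZ.germ_appFun g U.unop s x _).symm

/-- The lift of a compatible family of morphisms. -/
def lift : X ⟶ Z.zSpace where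
  base := hZ.baseHom g
  c := hZ.comorphism g
  prop x := by
    constructor
    intro a ha
    obtain ⟨U, hU, s, rfl⟩ := Z.zPresheaf.exists_germ_eq a
    have h := PresheafedSpace.stalkMap_germ_apply
      (X := X.toPresheafedSpace) (Y := Z.zSpace.toPresheafedSpace)
      ⟨hZ.baseHom g, hZ.comorphism g⟩ U x hU s
    have h2 := h.trans (hZ.germ_appFun g U s x hU)
    have h3 : IsUnit (hZ.stalkHom g x ⟨s.1 ⟨hZ.base g x, hU⟩, Z.zSections_mem s ⟨_, hU⟩⟩) := by
      rw [← h2]; exact ha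
    have := hZ.isLocalHom_stalkHom g x
    have h4 := (isUnit_map_iff (hZ.stalkHom g x) _).1 h3
    have : IsLocalHom (Z.zEval (hZ.base g x)).hom := isLocalHom_of_isIso _
    refine (isUnit_map_iff (Z.zEval (hZ.base g x)).hom _).1 ?_
    have h5 : (Z.zEval (hZ.base g x)).hom (Z.zPresheaf.germ U (hZ.base g x) hU s) =
      ⟨s.1 ⟨hZ.base g x, hU⟩, Z.zSections_mem s ⟨_, hU⟩⟩ := Subtype.ext (Z.zEval_germ _ U hU s)
    exact h5 ▸ h4

lemma lift_germ (U : Opens Z.zTop) (s : Z.zSections U) (x : X) (hx : hZ.base g x ∈ U) :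
    X.presheaf.germ ((Opens.map (hZ.baseHom g)).obj U) x hx ((hZ.lift g).c.app (op U) s) =
      hZ.stalkHom g x ⟨s.1 ⟨hZ.base g x, hx⟩, Z.zSections_mem s ⟨_, hx⟩⟩ :=
  hZ.germ_appFun g U s x hx

lemma lift_fac (j : J) : hZ.lift g ≫ Z.zHomLeft (D.obj j) (b j) (hZ.dominates j) = g.app j := by
  refine lrs_hom_ext _ _ (fun x => hZ.b_base g x j) fun U s x hx hx' => ?_
  refine (hZ.lift_germ g ((Opens.map (TopCat.ofHom (b j) : Z.zTop ⟶
    (D.obj j).scheme.toTopCat)).obj U)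
    ((Z.zComorphism _ (b j) (hZ.dominates j)).app (op U) s) x hx).trans ?_
  rw [hZ.stalkHom_eq g x _ ((D.obj j).scheme.presheaf.germ U _ hx' s)]
  · exact lrs_stalkMap_germ_apply (g.app j) U x hx' s
  · refine Eq.trans ?_ (Z.zHomLeft_app_apply (D.obj j) (b j) (hZ.dominates j) U s
      (hZ.base g x) hx).symm
    have h (y : (D.obj j).scheme) (hy : y ∈ U) (e : y = (g.app j).base x) :
        (D.obj j).toField _ ((D.obj j).scheme.presheaf.germ U _ hx' s) =
          (D.obj j).toField y ((D.obj j).scheme.presheaf.germ U y hy s) := by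
      subst e; rfl
    exact h _ hx (hZ.b_base g x j)

/-- The compatible family of morphisms given by a cone. -/
def _root_.BirGeom.LRSCone.ofCone (s : Cone (D ⋙ ZSModel.toLRS F K)) : LRSCone D s.pt.left where
  app j := (s.π.app j).left
  w f := congrArg CommaMorphism.left (s.w f)

/-- The space of local rings is the limit in locally ringed spaces over `F`. -/
def isLimit : IsLimit hZ.cone where
  lift s := Over.homMk (hZ.lift (LRSCone.ofCone s)) (by
    obtain ⟨j⟩ : Nonempty J := IsCofiltered.nonempty
    have h1 : (Z.zHom (D.obj j) (b j) (hZ.dominates j)).left ≫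
        ((ZSModel.toLRS F K).obj (D.obj j)).hom = Z.zOver.hom := Over.w _
    refine (congrArg _ h1.symm).trans ?_
    refine (Category.assoc _ _ _).symm.trans ?_
    exact (congrArg (· ≫ ((ZSModel.toLRS F K).obj (D.obj j)).hom)
      (hZ.lift_fac (LRSCone.ofCone s) j)).trans (Over.w (s.π.app j)))
  fac s j := Over.OverMorphism.ext (hZ.lift_fac (LRSCone.ofCone s) j)
  uniq s m hm := Over.OverMorphism.ext (hZ.hom_ext _ _ fun j =>
    (congrArg CommaMorphism.left (hm j)).trans (hZ.lift_fac (LRSCone.ofCone s) j).symm)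

end IsZLimit

end Limit

/-! ### Construction of cofiltered limits of models -/

section Construction

variable {F K : Type u} [Field F] [Field K] [Algebra F K]
variable {J : Type v} [Category.{w} J] [IsCofiltered J] (D : J ⥤ ZSModel F K)

/-- Compatible families of points of the models `D j`. -/
def LimPoint : Type (max u v) :=
  {x : ∀ j, (D.obj j).scheme // ∀ {i j} (f : i ⟶ j), ZSModel.mor (D.map f) (x i) = x j}

namespace LimPoint

instance : TopologicalSpace (LimPoint D) := instTopologicalSpaceSubtype

variable {D}

omit [IsCofiltered J] in
/-- Elements of the local ring at a component of `x` pull back to components with smaller index. -/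
lemma exists_lift (x : LimPoint D) {i j : J} (f : i ⟶ j)
    (a : (D.obj j).scheme.presheaf.stalk (x.1 j)) :
    ∃ c, (D.obj i).toField (x.1 i) c = (D.obj j).toField (x.1 j) a ∧ (IsUnit c ↔ IsUnit a) := by
  have h := x.2 f
  generalize x.1 j = y at a h
  subst h
  exact ⟨(ZSModel.mor (D.map f)).stalkMap _ a, ZSModel.toField_mor_apply _ _ _,
    isUnit_map_iff ((ZSModel.mor (D.map f)).stalkMap (x.1 i)).hom a⟩

lemma exists_lift₂ (x : LimPoint D) {j k : J} (a : (D.obj j).scheme.presheaf.stalk (x.1 j))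
    (b : (D.obj k).scheme.presheaf.stalk (x.1 k)) :
    ∃ i c d, (D.obj i).toField (x.1 i) c = (D.obj j).toField (x.1 j) a ∧
      (D.obj i).toField (x.1 i) d = (D.obj k).toField (x.1 k) b ∧
      (IsUnit c ↔ IsUnit a) ∧ (IsUnit d ↔ IsUnit b) := by
  obtain ⟨i, p, q, -⟩ := IsCofilteredOrEmpty.cone_objs j k
  obtain ⟨c, hc, hc'⟩ := x.exists_lift p a
  obtain ⟨d, hd, hd'⟩ := x.exists_lift q b
  exact ⟨i, c, d, hc, hd, hc', hd'⟩

/-- The union in `K` of the local rings of the components of a compatible family of points. -/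
def ring (x : LimPoint D) : Subring K where
  carrier := {f | ∃ j a, (D.obj j).toField (x.1 j) a = f}
  mul_mem' := by
    rintro _ _ ⟨j, a, rfl⟩ ⟨k, b, rfl⟩
    obtain ⟨i, c, d, hc, hd, -⟩ := x.exists_lift₂ a b
    exact ⟨i, c * d, by rw [map_mul, hc, hd]⟩
  add_mem' := by
    rintro _ _ ⟨j, a, rfl⟩ ⟨k, b, rfl⟩
    obtain ⟨i, c, d, hc, hd, -⟩ := x.exists_lift₂ a b
    exact ⟨i, c + d, by rw [map_add, hc, hd]⟩
  one_mem' := by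
    obtain ⟨j⟩ : Nonempty J := IsCofiltered.nonempty
    exact ⟨j, 1, map_one _⟩
  zero_mem' := by
    obtain ⟨j⟩ : Nonempty J := IsCofiltered.nonempty
    exact ⟨j, 0, map_zero _⟩
  neg_mem' := by
    rintro _ ⟨j, a, rfl⟩
    exact ⟨j, -a, map_neg _ _⟩

/-- The union of the local rings dominates each of them. -/
lemma dominates (x : LimPoint D) (j : J) : (D.obj j).Dominates x.ring (x.1 j) where
  mem s := ⟨j, s, rfl⟩
  isUnit s t ht hst := by
    obtain ⟨k, b, rfl⟩ := ht
    obtain ⟨i, c, d, hc, hd, hu, -⟩ := x.exists_lift₂ s b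
    refine hu.1 (IsUnit.of_mul_eq_one d ((D.obj i).toField_injective _ ?_))
    rw [map_mul, map_one, hc, hd, hst]

instance (x : LimPoint D) : IsLocalRing x.ring := by
  constructor
  rintro ⟨_, j, a, rfl⟩ ⟨_, k, b, rfl⟩ hab
  obtain ⟨i, c, d, hc, hd, -⟩ := x.exists_lift₂ a b
  have h1 : c + d = 1 := (D.obj i).toField_injective _ (by
    rw [map_add, map_one, hc, hd]; exact congrArg Subtype.val hab)
  let φ := (((D.obj i).toField (x.1 i)).hom.codRestrict x.ring (x.dominates i).mem)
  rcases IsLocalRing.isUnit_or_isUnit_of_add_one h1 with h | h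
  · refine Or.inl ?_
    convert h.map φ using 1
    exact Subtype.ext hc.symm
  · refine Or.inr ?_
    convert h.map φ using 1
    exact Subtype.ext hd.symm

/-- The family of generic points. -/
def eta : LimPoint D := ⟨fun j => (D.obj j).point (IsLocalRing.closedPoint K), fun {_ j} f =>
  congrArg (fun t : Spec (CommRingCat.of K) ⟶ (D.obj j).scheme => t (IsLocalRing.closedPoint K))
    (ZSModel.point_mor (D.map f))⟩

/-- The projections. -/
def proj (j : J) : C(LimPoint D, (D.obj j).scheme) :=
  ⟨fun x => x.1 j, (continuous_apply j).comp continuous_subtype_val⟩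

end LimPoint

end Construction

section Construction

variable {F K : Type u} [Field F] [Field K] [Algebra F K]
variable {J : Type u} [SmallCategory J] [IsCofiltered J] (D : J ⥤ ZSModel F K)

namespace LimPoint

/-- The data defining the limit of the models `D j`. -/
def data : ZData F K where
  carrier := LimPoint D
  ring := ring
  isLocalRing := inferInstance
  algebraMap_mem x a := by
    obtain ⟨j⟩ : Nonempty J := IsCofiltered.nonempty
    obtain ⟨s, hs⟩ := (D.obj j).exists_toField_algebraMap (x.1 j) a
    exact ⟨j, s, hs⟩
  isOpen_mem f := by
    rw [isOpen_iff_forall_mem_open]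
    rintro x ⟨j, a, rfl⟩
    obtain ⟨U, hU, s, rfl⟩ := (D.obj j).scheme.presheaf.exists_germ_eq a
    exact ⟨proj j ⁻¹' (U : Set (D.obj j).scheme), fun y hy =>
      ⟨j, (D.obj j).scheme.presheaf.germ U (y.1 j) hy s, (D.obj j).germ_toField_apply hy hU s⟩,
      U.2.preimage (proj j).continuous, hU⟩
  eta := eta
  eta_specializes x := by
    refine Topology.IsInducing.subtypeVal.specializes_iff.1 (specializes_pi.2 ?_)
    exact fun j => (D.obj j).point_specializes (x.1 j)

/-- The space of compatible families of points is the limit of the models. -/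
lemma isZLimit : IsZLimit (data D) D proj where
  dominates j x := x.dominates j
  w f x := x.2 f
  inj _ _ h := Subtype.ext (funext h)
  surj y hy := ⟨⟨y, hy⟩, fun _ => rfl⟩
  top_eq := by
    refine (induced_iInf (ι := J)).trans ?_
    exact iInf_congr fun j => induced_compose
  exists_toField _ _ h := h

end LimPoint

end Construction

/-! ### Compatible points in cofiltered systems of noetherian spaces -/

section Ultrafilter

/-- An ultrafilter on a noetherian sober space has a generic point: a point which belongs to the
same closed sets as the ultrafilter. -/
lemma exists_generic_of_ultrafilter {X : Type*} [TopologicalSpace X] [NoetherianSpace X]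
    [QuasiSober X] (V : Ultrafilter X) : ∃ z : X, ∀ C : Set X, IsClosed C → (z ∈ C ↔ C ∈ V) := by
  have hwf : WellFounded ((· < ·) : Closeds X → Closeds X → Prop) :=
    wellFounded_lt
  let S : Set (Closeds X) := {C | (C : Set X) ∈ V}
  have hS : S.Nonempty := ⟨⊤, Filter.univ_mem⟩
  let Z := hwf.min S hS
  have hZ : (Z : Set X) ∈ V := hwf.min_mem S hS
  have hmin (C : Set X) (hC : IsClosed C) (hCV : C ∈ V) : (Z : Set X) ⊆ C := by
    have h1 : Z ⊓ ⟨C, hC⟩ ∈ S := Filter.inter_mem hZ hCV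
    have h2 := hwf.not_lt_min S h1
    have h3 : Z ⊓ ⟨C, hC⟩ = Z := by
      by_contra h
      exact h2 (lt_of_le_of_ne inf_le_left h)
    intro x hx
    rw [← h3] at hx
    exact hx.2
  have hirr : IsIrreducible (Z : Set X) := by
    refine ⟨V.nonempty_of_mem hZ, ?_⟩
    rw [isPreirreducible_iff_isClosed_union_isClosed]
    intro A B hA hB h
    rcases Ultrafilter.union_mem_iff.1 (Filter.mem_of_superset hZ h) with h | h
    · exact Or.inl (hmin A hA h)
    · exact Or.inr (hmin B hB h)
  obtain ⟨z, hz⟩ := QuasiSober.sober hirr Z.isClosed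
  refine ⟨z, fun C hC => ⟨fun h => Filter.mem_of_superset hZ ?_, fun h => hmin C hC h ?_⟩⟩
  · exact (IsGenericPoint.mem_closed_set_iff hz hC).1 h
  · exact hz.mem

/-- A cofiltered system of nonempty closed subsets of noetherian sober spaces has a compatible
family of points. -/
lemma exists_compatible_points {J : Type*} [Category J] [IsCofiltered J] (X : J → Type*)
    [∀ j, TopologicalSpace (X j)] [∀ j, NoetherianSpace (X j)] [∀ j, QuasiSober (X j)]
    [∀ j, T0Space (X j)] (p : ∀ {i j : J}, (i ⟶ j) → X i → X j)
    (hp : ∀ {i j : J} (f : i ⟶ j), Continuous (p f))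
    (hsub : ∀ {i j : J} (f g : i ⟶ j), p f = p g)
    (hcomp : ∀ {i j k : J} (f : i ⟶ j) (g : j ⟶ k) x, p (f ≫ g) x = p g (p f x))
    (C : ∀ j, Set (X j)) (hC : ∀ j, IsClosed (C j)) (hne : ∀ j, (C j).Nonempty)
    (hpC : ∀ {i j : J} (f : i ⟶ j), ∀ x ∈ C i, p f x ∈ C j) :
    ∃ x : ∀ j, X j, (∀ {i j : J} (f : i ⟶ j), p f (x i) = x j) ∧ ∀ j, x j ∈ C j := by
  classical
  choose x₀ hx₀ using hne
  have hdir : Directed (· ≥ ·) fun j : J => Filter.principal {i : J | Nonempty (i ⟶ j)} := by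
    intro j k
    obtain ⟨i, f, g, -⟩ := IsCofilteredOrEmpty.cone_objs j k
    exact ⟨i, Filter.principal_mono.2 fun l ⟨h⟩ => ⟨h ≫ f⟩,
      Filter.principal_mono.2 fun l ⟨h⟩ => ⟨h ≫ g⟩⟩
  have : Nonempty J := IsCofiltered.nonempty
  have : (⨅ j : J, Filter.principal {i : J | Nonempty (i ⟶ j)}).NeBot :=
    Filter.iInf_neBot_of_directed' hdir fun j => Filter.principal_neBot_iff.2 ⟨j, ⟨𝟙 j⟩⟩
  let U := Ultrafilter.of (⨅ j : J, Filter.principal {i : J | Nonempty (i ⟶ j)})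
  have hU (j : J) : {i : J | Nonempty (i ⟶ j)} ∈ U :=
    Ultrafilter.of_le _ (Filter.mem_iInf_of_mem j (Filter.mem_principal_self _))
  -- The images in `X j` of the points chosen in the spaces above it.
  let y (j : J) (i : J) : X j := if h : Nonempty (i ⟶ j) then p h.some (x₀ i) else x₀ j
  have hy {i j : J} (f : i ⟶ j) : y j i = p f (x₀ i) := by
    have h : Nonempty (i ⟶ j) := ⟨f⟩
    simp only [y, dif_pos h, hsub h.some f]
  choose z hz using fun j => exists_generic_of_ultrafilter (U.map (y j))
  refine ⟨z, fun {i j} f => ?_, fun j => (hz j _ (hC j)).2 ?_⟩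
  · refine Inseparable.eq (inseparable_iff_forall_isClosed.2 fun A hA => ?_)
    rw [hz j A hA]
    refine (hz i _ (hA.preimage (hp f))).trans ?_
    rw [Ultrafilter.mem_map, Ultrafilter.mem_map]
    have key : ∀ k ∈ {k : J | Nonempty (k ⟶ i)}, (k ∈ y i ⁻¹' (p f ⁻¹' A) ↔ k ∈ y j ⁻¹' A) := by
      rintro k ⟨g⟩
      rw [Set.mem_preimage, Set.mem_preimage, Set.mem_preimage, hy g, hy (g ≫ f), hcomp]
    constructor <;> intro h <;> filter_upwards [h, hU i] with k hk hk'
    · exact (key k hk').1 hk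
    · exact (key k hk').2 hk
  · rw [Ultrafilter.mem_map]
    filter_upwards [hU j] with i ⟨f⟩
    rw [Set.mem_preimage, hy f]
    exact hpC f _ (hx₀ i)

end Ultrafilter

/-! ### Separatedness and noetherianity of varieties -/

section Varieties

variable {F : Type u} [Field F]

instance (V : Var F) : V.obj.left.IsSeparated := by
  rw [Scheme.isSeparated_iff, ← terminal.comp_from V.obj.hom]
  infer_instance

instance (V : Var F) : NoetherianSpace V.obj.left := by
  have : IsLocallyNoetherian V.obj.left := LocallyOfFiniteType.isLocallyNoetherian V.obj.hom
  have : CompactSpace V.obj.left := QuasiCompact.compactSpace_of_compactSpace V.obj.hom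
  have : AlgebraicGeometry.IsNoetherian V.obj.left := {}
  infer_instance

end Varieties

/-! ### Spectra of local rings mapping to limits -/

section SpecCones

variable {F K : Type u} [Field F] [Field K] [Algebra F K]

variable (F) in
/-- Schemes over `F` as locally ringed spaces over `F`. -/
abbrev schemeLRS : Over (Spec (CommRingCat.of F)) ⥤ LRSOver F :=
  Over.post Scheme.forgetToLocallyRingedSpace

variable {J : Type v} [Category.{w} J] (D : J ⥤ ZSModel F K)

/-- The cone with vertex `Spec K` over a diagram of models of `K`. -/
def pointCone : Cone (D ⋙ ZSModel.toLRS F K) where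
  pt := (schemeLRS F).obj (specOver F K)
  π :=
    { app := fun j => (schemeLRS F).map (D.obj j).obj.hom
      naturality := fun i j f => by
        refine (Category.id_comp _).trans ?_
        refine Eq.trans ?_ ((schemeLRS F).map_comp (D.obj i).obj.hom (D.map f).hom.right.hom)
        exact congrArg (schemeLRS F).map (StructuredArrow.w (D.map f).hom).symm }

variable {D} {Z : ZData F K} {b : ∀ j, C(Z.carrier, (D.obj j).scheme)}

/-- The cone with vertex the spectrum of a local ring of a limit of models. -/
def IsZLimit.specCone (hZ : IsZLimit Z D b) (x : Z.carrier) : Cone (D ⋙ ZSModel.toLRS F K) where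
  pt := (schemeLRS F).obj (Over.mk (ZSModel.specStr (Z.ring x) (Z.algebraMap_mem x)))
  π :=
    { app := fun j => (schemeLRS F).map (Over.homMk
        ((D.obj j).fromSub (Z.ring x) (b j x) (hZ.dominates j x).mem)
        ((D.obj j).fromSub_str _ _ _ _) : _ ⟶ (D.obj j).variety.obj)
      naturality := fun i j f => by
        refine (Category.id_comp _).trans ?_
        refine Eq.trans ?_ ((schemeLRS F).map_comp _ (D.map f).hom.right.hom)
        refine congrArg (schemeLRS F).map (Over.OverMorphism.ext ?_)
        exact (ZSModel.fromSub_mor (D.map f) _ _ _ _ _).symm }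

variable [IsCofiltered J] (hZ : IsZLimit Z D b)

namespace IsZLimit

/-- The projections of the limit `Z`. -/
abbrev proj (j : J) : Z.zOver ⟶ (ZSModel.toLRS F K).obj (D.obj j) :=
  Z.zHom (D.obj j) (b j) (hZ.dominates j)

lemma over_hom_ext {X : LRSOver F} (f g : X ⟶ Z.zOver)
    (h : ∀ j, f ≫ hZ.proj j = g ≫ hZ.proj j) : f = g :=
  hZ.isLimit.hom_ext h

/-- The morphism `Spec K ⟶ Z`. -/
def pt : (schemeLRS F).obj (specOver F K) ⟶ Z.zOver := hZ.isLimit.lift (pointCone D)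

lemma pt_fac (j : J) : hZ.pt ≫ hZ.proj j = (schemeLRS F).map (D.obj j).obj.hom :=
  hZ.isLimit.fac (pointCone D) j

/-- The morphism from the spectrum of the local ring at `x` to `Z`. -/
def specHom (x : Z.carrier) :
    (schemeLRS F).obj (Over.mk (ZSModel.specStr (Z.ring x) (Z.algebraMap_mem x))) ⟶ Z.zOver :=
  hZ.isLimit.lift (hZ.specCone x)

lemma specHom_fac (x : Z.carrier) (j : J) :
    hZ.specHom x ≫ hZ.proj j = (hZ.specCone x).π.app j :=
  hZ.isLimit.fac (hZ.specCone x) j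

variable (F) in
/-- `Spec K ⟶ Spec O` as a morphism over `F`. -/
abbrev _root_.BirGeom.specInclOver (O : Subring K) (hO : ∀ a, algebraMap F K a ∈ O) :
    specOver F K ⟶ Over.mk (ZSModel.specStr O hO) :=
  Over.homMk (ZSModel.specIncl O) (ZSModel.specIncl_specStr O hO)

lemma specIncl_specHom (x : Z.carrier) :
    (schemeLRS F).map (specInclOver F (Z.ring x) (Z.algebraMap_mem x)) ≫ hZ.specHom x = hZ.pt := by
  refine hZ.over_hom_ext _ _ fun j => ?_
  rw [Category.assoc, hZ.specHom_fac, hZ.pt_fac]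
  refine ((schemeLRS F).map_comp _ _).symm.trans (congrArg (schemeLRS F).map ?_)
  exact Over.OverMorphism.ext (ZSModel.specIncl_fromSub _ _ _ _)

/-- The closed point of the spectrum of the local ring at `x` is mapped to `x`. -/
lemma specHom_closedPoint (x : Z.carrier) :
    (hZ.specHom x).left.base (IsLocalRing.closedPoint (Z.ring x) :
      Spec (CommRingCat.of (Z.ring x))) = x := by
  refine hZ.inj _ _ fun j => ?_
  have h := congrArg (fun t : (schemeLRS F).obj
      (Over.mk (ZSModel.specStr (Z.ring x) (Z.algebraMap_mem x))) ⟶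
      (ZSModel.toLRS F K).obj (D.obj j) =>
    t.left.base (IsLocalRing.closedPoint (Z.ring x) : Spec (CommRingCat.of (Z.ring x))))
    (hZ.specHom_fac x j)
  exact h.trans (hZ.dominates j x).fromSub_closedPoint

/-- The image of `Spec K` is a generic point of `Z`. -/
lemma pt_specializes (x : Z.carrier) :
    hZ.pt.left.base (IsLocalRing.closedPoint K : Spec (CommRingCat.of K)) ⤳ x := by
  have h := congrArg (fun t : (schemeLRS F).obj (specOver F K) ⟶ Z.zOver =>
    t.left.base (IsLocalRing.closedPoint K : Spec (CommRingCat.of K))) (hZ.specIncl_specHom x)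
  have h2 : ZSModel.specIncl (Z.ring x) (IsLocalRing.closedPoint K) ⤳
      (IsLocalRing.closedPoint (Z.ring x) : Spec (CommRingCat.of (Z.ring x))) :=
    IsLocalRing.specializes_closedPoint _
  have h3 := h2.map (hZ.specHom x).left.base.hom.continuous
  have h4 := hZ.specHom_closedPoint x
  exact (specializes_of_eq h.symm).trans (h3.trans (specializes_of_eq h4))

/-- The value of a section at the image of `Spec K` is its pullback to `Spec K`. -/
lemma pt_value (U : Opens Z.zTop) (s : Z.zSections U)
    (hU : hZ.pt.left.base (IsLocalRing.closedPoint K) ∈ U) :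
    (stalkClosedPointIso (CommRingCat.of K)).hom
      ((Spec (CommRingCat.of K)).presheaf.germ ((Opens.map hZ.pt.left.base).obj U)
        (IsLocalRing.closedPoint K) hU (hZ.pt.left.c.app (op U) s)) =
      s.1 ⟨_, hU⟩ := by
  obtain ⟨j, a, ha⟩ := hZ.exists_toField _ _ (Z.zSections_mem s ⟨_, hU⟩)
  have hfac : hZ.pt.left ≫ Z.zHomLeft (D.obj j) (b j) (hZ.dominates j) =
      (D.obj j).point.toLRSHom := congrArg CommaMorphism.left (hZ.pt_fac j)
  have key {k : (Spec (CommRingCat.of K)).toLocallyRingedSpace ⟶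
      (D.obj j).scheme.toLocallyRingedSpace}
      (hk : hZ.pt.left ≫ Z.zHomLeft (D.obj j) (b j) (hZ.dominates j) = k) :
      ∃ a : (D.obj j).scheme.presheaf.stalk (k.base (IsLocalRing.closedPoint K)),
        (D.obj j).toField _ a = s.1 ⟨_, hU⟩ := by
    subst hk; exact ⟨a, ha⟩
  obtain ⟨c, hc⟩ := key hfac
  have h1 := hZ.germ_eq hZ.pt.left _ hfac U s (IsLocalRing.closedPoint K) hU c hc
  refine (congrArg (stalkClosedPointIso (CommRingCat.of K)).hom h1).trans ?_
  rw [← hc]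
  have h2 : (D.obj j).toField ((D.obj j).point (IsLocalRing.closedPoint K)) =
      Scheme.stalkClosedPointTo (D.obj j).point := by
    rw [ZSModel.toField, TopCat.Presheaf.stalkSpecializes_refl, Category.id_comp]
  exact (ConcreteCategory.congr_hom h2 c).symm

lemma _root_.BirGeom.germ_app_congr {X Y : LocallyRingedSpace.{u}} {f g : X ⟶ Y} (h : f = g)
    (U : Opens Y) (s : Y.presheaf.obj (op U)) (x : X) (hx : f.base x ∈ U) (hx' : g.base x ∈ U) :
    X.presheaf.germ ((Opens.map f.base).obj U) x hx (f.c.app (op U) s) =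
      X.presheaf.germ ((Opens.map g.base).obj U) x hx' (g.c.app (op U) s) := by
  subst h; rfl

/-- Morphisms from `Z` to a variety are determined by their restrictions to `Spec K`. -/
lemma hom_ext_pt {V : Var F} (f g : Z.zOver ⟶ (Var.toLRS F).obj V)
    (h : hZ.pt ≫ f = hZ.pt ≫ g) : f = g := by
  have hb (x : Z.carrier) : f.left.base x = g.left.base x := by
    have h1 : hZ.specHom x ≫ f = hZ.specHom x ≫ g := by
      obtain ⟨p, hp⟩ := (schemeLRS F).map_surjective (Y := V.obj) (hZ.specHom x ≫ f)
      obtain ⟨q, hq⟩ := (schemeLRS F).map_surjective (Y := V.obj) (hZ.specHom x ≫ g)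
      refine hp.symm.trans (Eq.trans (congrArg (schemeLRS F).map ?_) hq)
      apply Over.OverMorphism.ext
      refine ZSModel.specIncl_cancel_of_isSeparated V.obj.hom _ _ _ ?_
      have h2 : specInclOver F (Z.ring x) (Z.algebraMap_mem x) ≫ p =
          specInclOver F (Z.ring x) (Z.algebraMap_mem x) ≫ q := by
        apply (schemeLRS F).map_injective
        refine ((schemeLRS F).map_comp _ _).trans
          (Eq.trans ?_ ((schemeLRS F).map_comp _ _).symm)
        refine (congrArg (_ ≫ ·) hp).trans (Eq.trans ?_ (congrArg (_ ≫ ·) hq).symm)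
        refine (Category.assoc _ _ _).symm.trans (Eq.trans ?_ (Category.assoc _ _ _))
        exact (congrArg (· ≫ f) (hZ.specIncl_specHom x)).trans
          (h.trans (congrArg (· ≫ g) (hZ.specIncl_specHom x)).symm)
      exact congrArg CommaMorphism.left h2
    have h2 := congrArg (fun t : (schemeLRS F).obj
        (Over.mk (ZSModel.specStr (Z.ring x) (Z.algebraMap_mem x))) ⟶ (Var.toLRS F).obj V =>
      t.left.base (IsLocalRing.closedPoint (Z.ring x) : Spec (CommRingCat.of (Z.ring x)))) h1
    have h3 := hZ.specHom_closedPoint x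
    exact (congrArg f.left.base h3).symm.trans (h2.trans (congrArg g.left.base h3))
  refine Over.OverMorphism.ext (lrs_hom_ext _ _ hb fun U s x hx hx' => ?_)
  refine (Z.zEval_bijective x).1 (Subtype.ext ?_)
  refine (Z.zEval_germ x ((Opens.map f.left.base).obj U) hx (f.left.c.app (op U) s)).trans
    (Eq.trans ?_ (Z.zEval_germ x ((Opens.map g.left.base).obj U) hx' (g.left.c.app (op U) s)).symm)
  have e := (hZ.pt_specializes x).mem_open ((Opens.map f.left.base).obj U).2 hx
  have e' := (hZ.pt_specializes x).mem_open ((Opens.map g.left.base).obj U).2 hx'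
  refine (Z.zSections_eq _ _ ⟨_, e⟩).trans (Eq.trans ?_ (Z.zSections_eq _ ⟨_, e'⟩ _))
  refine (hZ.pt_value _ _ e).symm.trans (Eq.trans ?_ (hZ.pt_value _ _ e'))
  exact congrArg (stalkClosedPointIso (CommRingCat.of K)).hom
    (germ_app_congr (congrArg CommaMorphism.left h) U s _ e e')

end IsZLimit

end SpecCones

/-! ### Morphisms from a limit of models to a variety -/

section Extension

variable {F K : Type u} [Field F] [Field K] [Algebra F K]

/-- The morphism `h` on the open set `U` of `M` restricts to `ψ` at the point `Spec K` of `M`, which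
factors through `U`. -/
def ZSModel.Extends (M : ZSModel F K) {Y : Scheme.{u}} (ψ : Spec (CommRingCat.of K) ⟶ Y)
    (U : M.scheme.Opens) (h : U.toScheme ⟶ Y) : Prop :=
  ∃ p : Spec (CommRingCat.of K) ⟶ U.toScheme, p ≫ U.ι = M.point ∧ p ≫ h = ψ

namespace ZSModel

variable (M : ZSModel F K) {Y : Scheme.{u}} {ψ : Spec (CommRingCat.of K) ⟶ Y}

instance : IsIntegral M.scheme := inferInstanceAs (IsIntegral M.variety.obj.left)

/-- Local extensions of `ψ` to `M` agree on overlaps, because `Spec K` is dense in them, and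
therefore can be glued. -/
lemma exists_extension [Y.IsSeparated]
    (h : ∀ x : M.scheme, ∃ U : M.scheme.Opens, x ∈ U ∧ ∃ h, M.Extends ψ U h) :
    ∃ g : M.scheme ⟶ Y, M.point ≫ g = ψ := by
  choose U hU g p hp hg using h
  let 𝒰 := M.scheme.openCoverOfIsOpenCover U
    (IsOpenCover.mk (top_le_iff.1 fun x _ => Opens.mem_iSup.2 ⟨x, hU x⟩))
  have hcompat (x y : M.scheme) :
      pullback.fst (U x).ι (U y).ι ≫ g x = pullback.snd (U x).ι (U y).ι ≫ g y := by
    let q := pullback.lift (p x) (p y) ((hp x).trans (hp y).symm)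
    have : IsDominant (q ≫ pullback.fst (U x).ι (U y).ι ≫ (U x).ι) := by
      rw [pullback.lift_fst_assoc, hp x]
      infer_instance
    have : IsDominant q := IsDominant.of_comp_of_isOpenImmersion q
      (pullback.fst (U x).ι (U y).ι ≫ (U x).ι)
    have : IsReduced (pullback (U x).ι (U y).ι) :=
      isReduced_of_isOpenImmersion (pullback.fst (U x).ι (U y).ι ≫ (U x).ι)
    refine ext_of_isDominant q ?_
    rw [pullback.lift_fst_assoc, pullback.lift_snd_assoc, hg, hg]
  refine ⟨𝒰.glueMorphisms g hcompat, ?_⟩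
  let x := genericPoint M.scheme
  rw [← hp x]
  have h1 : (U x).ι ≫ 𝒰.glueMorphisms g hcompat = g x := 𝒰.ι_glueMorphisms g hcompat x
  rw [Category.assoc, h1, hg]

variable {M} in
/-- Local extensions of `ψ` pull back along morphisms of models. -/
lemma Extends.preimage {N : ZSModel F K} (f : N ⟶ M) {U : M.scheme.Opens} {h : U.toScheme ⟶ Y}
    (hU : M.Extends ψ U h) : N.Extends ψ (mor f ⁻¹ᵁ U) (mor f ∣_ U ≫ h) := by
  obtain ⟨p, hp, hg⟩ := hU
  have hr : Set.range N.point ⊆ Set.range (mor f ⁻¹ᵁ U).ι := by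
    rintro _ ⟨z, rfl⟩
    rw [Scheme.Opens.range_ι]
    change mor f (N.point z) ∈ U
    have h1 : mor f (N.point z) = U.ι (p z) := by
      rw [← Scheme.Hom.comp_apply, ← Scheme.Hom.comp_apply, point_mor, hp]
    rw [h1]
    exact (p z).2
  refine ⟨IsOpenImmersion.lift (mor f ⁻¹ᵁ U).ι N.point hr, IsOpenImmersion.lift_fac _ _ _, ?_⟩
  rw [← hg, ← Category.assoc]
  congr 1
  rw [← cancel_mono U.ι, Category.assoc, morphismRestrict_ι, IsOpenImmersion.lift_fac_assoc,
    point_mor, hp]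

/-- A morphism from the spectrum of a local ring of `M` to a scheme of finite type extends to an
open neighbourhood. -/
lemma exists_extends_of_stalk (x : M.scheme) (s : Y ⟶ Spec (CommRingCat.of F))
    [LocallyOfFiniteType s] (χ : Spec (M.scheme.presheaf.stalk x) ⟶ Y)
    (hχ : Spec.map (M.toField x) ≫ χ = ψ)
    (hψ : ψ ≫ s = Spec.map (CommRingCat.ofHom (algebraMap F K))) :
    ∃ U : M.scheme.Opens, x ∈ U ∧ ∃ h, M.Extends ψ U h := by
  have h1 : χ ≫ s = M.scheme.fromSpecStalk x ≫ M.str := by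
    obtain ⟨a, ha⟩ := Spec.map_surjective (χ ≫ s)
    obtain ⟨b, hb⟩ := Spec.map_surjective (M.scheme.fromSpecStalk x ≫ M.str)
    rw [← ha, ← hb]
    congr 1
    have h2 : a ≫ M.toField x = b ≫ M.toField x := by
      apply Spec.map_injective
      rw [Spec.map_comp, Spec.map_comp, ha, hb, reassoc_of% hχ, hψ, reassoc_of% SpecMap_toField,
        point_str]
    ext r
    exact M.toField_injective x (ConcreteCategory.congr_hom h2 r)
  obtain ⟨U, hxU, f, hf, -⟩ := spread_out_of_isGermInjective' M.str s χ h1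
  refine ⟨U, hxU, f, Spec.map (M.toField x) ≫ U.fromSpecStalkOfMem x hxU, ?_, ?_⟩
  · rw [Category.assoc, Scheme.Opens.fromSpecStalkOfMem_ι, SpecMap_toField]
  · rw [Category.assoc, ← hf, hχ]

end ZSModel

/-- A homomorphism to `K` from an algebra of finite type with values in the local ring of a limit
of models takes values in the local ring of one of them. -/
lemma LimPoint.exists_forall_mem_range {J : Type u} [SmallCategory J] [IsCofiltered J]
    {D : J ⥤ ZSModel F K} (z : LimPoint D) {B : Type u} [CommRing B] (φ : F →+* B)
    (hφ : φ.FiniteType) (θ : B →+* K) (hθ : θ.comp φ = algebraMap F K) (h : ∀ b, θ b ∈ z.ring) :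
    ∃ j, ∀ b, θ b ∈ ((D.obj j).toField (z.1 j)).hom.range := by
  classical
  algebraize [φ]
  obtain ⟨S, hS⟩ := hφ.out
  have hfin (T : Finset B) : ∃ j, ∀ b ∈ T, θ b ∈ ((D.obj j).toField (z.1 j)).hom.range := by
    induction T using Finset.induction with
    | empty =>
      obtain ⟨j⟩ : Nonempty J := IsCofiltered.nonempty
      exact ⟨j, by simp⟩
    | insert b T _ ih =>
      obtain ⟨j, hj⟩ := ih
      obtain ⟨k, a, ha⟩ := h b
      obtain ⟨i, p, q, -⟩ := IsCofilteredOrEmpty.cone_objs j k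
      refine ⟨i, fun c hc => ?_⟩
      rcases Finset.mem_insert.1 hc with rfl | hc
      · obtain ⟨e, he, -⟩ := z.exists_lift q a
        exact ⟨e, he.trans ha⟩
      · obtain ⟨a', ha'⟩ := hj c hc
        obtain ⟨e, he, -⟩ := z.exists_lift p a'
        exact ⟨e, he.trans ha'⟩
  obtain ⟨j, hj⟩ := hfin S
  refine ⟨j, fun b => ?_⟩
  have hb : b ∈ Algebra.adjoin F (S : Set B) := hS ▸ Algebra.mem_top
  induction hb using Algebra.adjoin_induction with
  | mem x hx => exact hj x hx
  | algebraMap a =>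
    obtain ⟨s, hs⟩ := (D.obj j).exists_toField_algebraMap (z.1 j) a
    exact ⟨s, hs.trans (RingHom.congr_fun hθ a).symm⟩
  | add x y _ _ hx hy => rw [map_add]; exact add_mem hx hy
  | mul x y _ _ hx hy => rw [map_mul]; exact mul_mem hx hy

lemma exists_ringHom_comp_eq {A B K : Type*} [CommRing A] [CommRing B] [CommRing K] (ι : A →+* K)
    (hι : Function.Injective ι) (θ : B →+* K) (h : ∀ b, θ b ∈ ι.range) :
    ∃ β : B →+* A, ι.comp β = θ := by
  choose β hβ using h
  refine ⟨{ toFun := β, map_one' := hι ?_, map_zero' := hι ?_, map_mul' := fun a b => hι ?_,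
            map_add' := fun a b => hι ?_ }, RingHom.ext hβ⟩
  all_goals simp [hβ]

/-- A morphism from the spectrum of a local ring factors through an affine open subset. -/
lemma exists_factor_fromSpec {R : CommRingCat.{u}} [IsLocalRing R] {Y : Scheme.{u}}
    (χ : Spec R ⟶ Y) :
    ∃ (W : Y.Opens) (hW : IsAffineOpen W) (α : Γ(Y, W) ⟶ R), Spec.map α ≫ hW.fromSpec = χ := by
  obtain ⟨W, hW, hy, -⟩ := exists_isAffineOpen_mem_and_subset
    (U := (⊤ : Y.Opens)) (x := χ (IsLocalRing.closedPoint R)) trivial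
  refine ⟨W, hW, Y.presheaf.germ W _ hy ≫ Scheme.stalkClosedPointTo χ, ?_⟩
  rw [Spec.map_comp, Category.assoc]
  refine Eq.trans (congrArg (_ ≫ ·) (hW.fromSpecStalk_eq_fromSpecStalk hy)) ?_
  exact Scheme.Spec_stalkClosedPointTo_fromSpecStalk χ

/-- A morphism from the spectrum of the local ring of a limit of models to a scheme of finite type
comes from a morphism of the spectrum of the local ring of one of the models. -/
lemma LimPoint.exists_stalk_hom {J : Type u} [SmallCategory J] [IsCofiltered J]
    {D : J ⥤ ZSModel F K} (z : LimPoint D) {Y : Scheme.{u}} (s : Y ⟶ Spec (CommRingCat.of F))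
    [LocallyOfFiniteType s] (χ : Spec (CommRingCat.of z.ring) ⟶ Y)
    (hs : ZSModel.specIncl z.ring ≫ χ ≫ s = Spec.map (CommRingCat.ofHom (algebraMap F K))) :
    ∃ (j : J) (χ' : Spec ((D.obj j).scheme.presheaf.stalk (z.1 j)) ⟶ Y),
      Spec.map ((D.obj j).toField (z.1 j)) ≫ χ' = ZSModel.specIncl z.ring ≫ χ := by
  have : IsLocalRing (CommRingCat.of z.ring) := inferInstanceAs (IsLocalRing z.ring)
  obtain ⟨W, hW, α, hα⟩ := exists_factor_fromSpec χ
  obtain ⟨φ, hφ⟩ := Spec.map_surjective (hW.fromSpec ≫ s)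
  have hfin : φ.hom.FiniteType := by
    have h1 : LocallyOfFiniteType (Spec.map φ) := by rw [hφ]; infer_instance
    exact (HasRingHomProperty.Spec_iff (P := @LocallyOfFiniteType)).1 h1
  have hθ : (z.ring.subtype.comp α.hom).comp φ.hom = algebraMap F K := by
    have h1 : φ ≫ α ≫ CommRingCat.ofHom z.ring.subtype = CommRingCat.ofHom (algebraMap F K) := by
      apply Spec.map_injective
      rw [Spec.map_comp, Spec.map_comp, Category.assoc, hφ, reassoc_of% hα, hs]
    exact congrArg CommRingCat.Hom.hom h1
  obtain ⟨j, hj⟩ := z.exists_forall_mem_range φ.hom hfin _ hθ fun b => (α b).2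
  obtain ⟨β, hβ⟩ := exists_ringHom_comp_eq _ ((D.obj j).toField_injective (z.1 j)) _ hj
  let β' : Γ(Y, W) ⟶ (D.obj j).scheme.presheaf.stalk (z.1 j) := CommRingCat.ofHom β
  have hβ' : β' ≫ (D.obj j).toField (z.1 j) = α ≫ CommRingCat.ofHom z.ring.subtype :=
    CommRingCat.hom_ext hβ
  refine ⟨j, Spec.map β' ≫ hW.fromSpec, ?_⟩
  rw [← Spec.map_comp_assoc, hβ', Spec.map_comp_assoc, hα]

end Extension

section Factor

variable {F K : Type u} [Field F] [Field K] [Algebra F K]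
variable {J : Type u} [SmallCategory J] [IsCofiltered J] {D : J ⥤ ZSModel F K}

lemma ZSModel.hom_ext_point (M : ZSModel F K) {V : Var F} (g g' : M.variety ⟶ V)
    (h : M.point ≫ g.hom.left = M.point ≫ g'.hom.left) : g = g' := by
  apply ObjectProperty.hom_ext
  apply Over.OverMorphism.ext
  exact ext_of_isDominant_of_isSeparated V.obj.hom
    ((Over.w g.hom).trans (Over.w g'.hom).symm) M.point h

/-- Morphisms from one of the models are determined by their pullbacks to the limit. -/
lemma LimPoint.factor_unique {V : Var F} (j : J) (g g' : (D.obj j).variety ⟶ V)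
    (h : (isZLimit D).proj j ≫ (Var.toLRS F).map g = (isZLimit D).proj j ≫ (Var.toLRS F).map g') :
    g = g' := by
  refine (D.obj j).hom_ext_point g g' ?_
  have h1 := congrArg ((isZLimit D).pt ≫ ·) h
  have h2 (g : (D.obj j).variety ⟶ V) :
      (isZLimit D).pt ≫ (isZLimit D).proj j ≫ (Var.toLRS F).map g =
      (schemeLRS F).map ((D.obj j).obj.hom ≫ g.hom) := by
    refine (Category.assoc _ _ _).symm.trans ?_
    refine (congrArg (· ≫ (Var.toLRS F).map g) ((isZLimit D).pt_fac j)).trans ?_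
    exact ((schemeLRS F).map_comp _ _).symm
  have h3 := (schemeLRS F).map_injective ((h2 g).symm.trans (h1.trans (h2 g')))
  exact congrArg CommaMorphism.left h3

/-- Every morphism from the limit to a variety factors through one of the models: otherwise, by
compactness, its restriction to `Spec K` does not extend to a neighbourhood of some point of the
limit, against the finite presentation of morphisms to a variety. -/
lemma LimPoint.exists_factor {V : Var F} (φ : (data D).zOver ⟶ (Var.toLRS F).obj V) :
    ∃ (j : J) (g : (D.obj j).variety ⟶ V), (isZLimit D).proj j ≫ (Var.toLRS F).map g = φ := by
  obtain ⟨ψ, hψ⟩ := (schemeLRS F).map_surjective (Y := V.obj) ((isZLimit D).pt ≫ φ)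
  have hψw : ψ.left ≫ V.obj.hom = Spec.map (CommRingCat.ofHom (algebraMap F K)) := Over.w ψ
  suffices h : ∃ (j : J) (g : (D.obj j).scheme ⟶ V.obj.left), (D.obj j).point ≫ g = ψ.left by
    obtain ⟨j, g, hg⟩ := h
    have hgw : g ≫ V.obj.hom = (D.obj j).str := by
      refine ext_of_isDominant (D.obj j).point ?_
      rw [reassoc_of% hg, hψw, ZSModel.point_str]
    refine ⟨j, ObjectProperty.homMk (Over.homMk g hgw), (isZLimit D).hom_ext_pt _ _ ?_⟩
    refine Eq.trans ?_ hψ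
    refine (Category.assoc _ _ _).symm.trans ?_
    refine (congrArg (· ≫ _) ((isZLimit D).pt_fac j)).trans ?_
    refine ((schemeLRS F).map_comp _ _).symm.trans (congrArg (schemeLRS F).map ?_)
    exact Over.OverMorphism.ext hg
  -- Otherwise the points of the models at which `ψ` does not extend locally form nonempty closed
  -- sets, which have a compatible family of points.
  by_contra hcon
  push Not at hcon
  let C (j : J) : Set (D.obj j).scheme := {x | ¬ ∃ U : (D.obj j).scheme.Opens, x ∈ U ∧
    ∃ h, (D.obj j).Extends ψ.left U h}
  obtain ⟨x, hx, hxC⟩ := exists_compatible_points (fun j => (D.obj j).scheme)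
    (fun f => ZSModel.mor (D.map f)) (fun f => (ZSModel.mor (D.map f)).continuous)
    (fun f g => by rw [Subsingleton.elim (D.map f) (D.map g)])
    (fun f g x => by rw [D.map_comp]; rfl) C
    (fun j => by
      rw [← isOpen_compl_iff, isOpen_iff_forall_mem_open]
      intro x hx
      obtain ⟨U, hU, h, hh⟩ := not_not.1 hx
      exact ⟨U, fun y hy => not_not.2 ⟨U, hy, h, hh⟩, U.2, hU⟩)
    (fun j => by
      rw [Set.nonempty_iff_ne_empty]
      intro hC
      obtain ⟨g, hg⟩ := (D.obj j).exists_extension (ψ := ψ.left) fun x => by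
        by_contra h
        exact (hC ▸ (show x ∈ C j from h) : x ∈ (∅ : Set _))
      exact hcon j g hg)
    (fun {i j} f x hx ⟨U, hU, h, hh⟩ => hx ⟨ZSModel.mor (D.map f) ⁻¹ᵁ U, hU, _, hh.preimage _⟩)
  -- At this point of the limit `φ` provides an extension of `ψ` to the spectrum of the local ring,
  -- which comes from the local ring of some model and spreads out to an open set of it.
  let z : LimPoint D := ⟨x, hx⟩
  obtain ⟨χ, hχ⟩ := (schemeLRS F).map_surjective (Y := V.obj) ((isZLimit D).specHom z ≫ φ)
  have hχψ : ZSModel.specIncl z.ring ≫ χ.left = ψ.left := by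
    have h1 : specInclOver F ((data D).ring z) ((data D).algebraMap_mem z) ≫ χ = ψ := by
      apply (schemeLRS F).map_injective
      refine ((schemeLRS F).map_comp _ _).trans (Eq.trans ?_ hψ.symm)
      refine (congrArg (_ ≫ ·) hχ).trans ?_
      refine (Category.assoc _ _ _).symm.trans ?_
      exact congrArg (· ≫ φ) ((isZLimit D).specIncl_specHom z)
    exact congrArg CommaMorphism.left h1
  obtain ⟨j, χ', hχ'⟩ := z.exists_stalk_hom V.obj.hom χ.left
    ((Category.assoc _ _ _).symm.trans ((congrArg (· ≫ V.obj.hom) hχψ).trans hψw))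
  exact hxC j ((D.obj j).exists_extends_of_stalk (x j) V.obj.hom χ' (hχ'.trans hχψ) hψw)

end Factor

/-! ### Points with values in a field and birational morphisms -/

section Points

variable {K : Type u} [Field K]

lemma apply_closedPoint_eq_genericPoint {X : Scheme.{u}} [IsIntegral X]
    (q : Spec (CommRingCat.of K) ⟶ X) [IsDominant q] :
    q (IsLocalRing.closedPoint K) = genericPoint X := by
  refine ((?_ : q (IsLocalRing.closedPoint K) ⤳ genericPoint X).antisymm
    (genericPoint_specializes _)).eq
  rw [specializes_iff_mem_closure]
  refine closure_mono ?_ (q.denseRange (genericPoint X))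
  rintro _ ⟨z, rfl⟩
  exact congrArg q (Subsingleton.elim (α := PrimeSpectrum K) z _)

lemma isDominant_of_apply_eq_genericPoint {X Z : Scheme.{u}} [IsIntegral X] (q : Z ⟶ X) (z : Z)
    (h : q z = genericPoint X) : IsDominant q := by
  constructor
  rw [DenseRange, dense_iff_closure_eq, ← Set.univ_subset_iff]
  refine (genericPoint_spec X).symm.subset.trans (closure_mono ?_)
  rw [Set.singleton_subset_iff]
  exact ⟨z, h⟩

lemma exists_eq_SpecMap_fromSpecStalk {X : Scheme.{u}} (q : Spec (CommRingCat.of K) ⟶ X) (x : X)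
    (hx : q (IsLocalRing.closedPoint K) = x) :
    ∃ φ : X.presheaf.stalk x ⟶ CommRingCat.of K, Spec.map φ ≫ X.fromSpecStalk x = q := by
  subst hx
  exact ⟨_, Scheme.Spec_stalkClosedPointTo_fromSpecStalk q⟩

lemma apply_genericPoint_of_isDominant {X Y : Scheme.{u}} [IsIntegral X] [IsIntegral Y] (f : X ⟶ Y)
    [IsDominant f] : f (genericPoint X) = genericPoint Y := by
  refine ((?_ : f (genericPoint X) ⤳ genericPoint Y).antisymm (genericPoint_specializes _)).eq
  rw [specializes_iff_mem_closure]
  refine closure_minimal ?_ isClosed_closure (f.denseRange (genericPoint Y))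
  rintro _ ⟨z, rfl⟩
  exact specializes_iff_mem_closure.1 ((genericPoint_specializes z).map f.continuous)

/-- Dominant points with values in a field lift uniquely along birational morphisms, because they
are given by embeddings of the function field. -/
lemma IsBirational.existsUnique_lift {X Y : Scheme.{u}} [IsIntegral X] [IsIntegral Y] {f : X ⟶ Y}
    (hf : IsBirational f) (q : Spec (CommRingCat.of K) ⟶ Y) [IsDominant q] :
    ∃! q' : Spec (CommRingCat.of K) ⟶ X, IsDominant q' ∧ q' ≫ f = q := by
  have := hf.dominant
  have := hf.isIso
  obtain ⟨φ, hφ⟩ := exists_eq_SpecMap_fromSpecStalk q (f (genericPoint X)) (by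
    rw [apply_closedPoint_eq_genericPoint, apply_genericPoint_of_isDominant])
  refine ⟨Spec.map (inv (f.stalkMap (genericPoint X)) ≫ φ) ≫ X.fromSpecStalk _, ⟨?_, ?_⟩, ?_⟩
  · refine isDominant_of_apply_eq_genericPoint _ (IsLocalRing.closedPoint K) ?_
    have h : Spec.map (inv (f.stalkMap (genericPoint X)) ≫ φ) (IsLocalRing.closedPoint K) =
        IsLocalRing.closedPoint (X.presheaf.stalk (genericPoint X)) :=
      Subsingleton.elim (α := PrimeSpectrum X.functionField) _ _
    exact (congrArg (X.fromSpecStalk _) h).trans Scheme.fromSpecStalk_closedPoint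
  · rw [Category.assoc, ← Scheme.SpecMap_stalkMap_fromSpecStalk, ← Spec.map_comp_assoc,
      IsIso.hom_inv_id_assoc, hφ]
  · rintro q' ⟨hq', hq⟩
    obtain ⟨φ', hφ'⟩ := exists_eq_SpecMap_fromSpecStalk q' _ (apply_closedPoint_eq_genericPoint q')
    rw [← hφ', Category.assoc, ← Scheme.SpecMap_stalkMap_fromSpecStalk, ← hφ,
      ← Spec.map_comp_assoc, cancel_mono] at hq
    rw [← hφ', ← Spec.map_injective hq, IsIso.inv_hom_id_assoc]

end Points

/-- A cofiltered system of sets with bijective transition maps has a section. -/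
lemma exists_section_of_bijective {J : Type u} [Category.{v} J] [IsCofiltered J] (G : J ⥤ Type w)
    (hG : ∀ {i j : J} (f : i ⟶ j), Function.Bijective (G.map f)) {j₀ : J} (x : G.obj j₀) :
    ∃ s : ∀ j, G.obj j, ∀ {i j : J} (f : i ⟶ j), G.map f (s i) = s j := by
  have h : G.IsEventuallyConstantTo j₀ := fun _ f => (isIso_iff_bijective _).2 (hG f)
  exact ⟨fun j => h.cone.π.app j x, fun f => ConcreteCategory.congr_hom (h.cone.w f) x⟩

namespace ProVar

variable {F : Type u} [Field F]

section Model

variable (P : ProVar F) (K : Type u) [Field K] [Algebra F K]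

/-- The system of the dominant `K`-valued points of a pro-variety. -/
def points : P.J ⥤ Type u where
  obj j := {q : specOver F K ⟶ (P.diag.obj j).obj // IsDominant q.left}
  map {i j} f := ↾fun q => ⟨q.1 ≫ (P.diag.map f).hom, by
    have := q.2
    have := (P.birational f).dominant
    change IsDominant (q.1.left ≫ (P.diag.map f).hom.left)
    infer_instance⟩
  map_id j := by
    refine ConcreteCategory.hom_ext _ _ fun q => Subtype.ext ?_
    refine (congrArg (fun t : P.diag.obj j ⟶ P.diag.obj j => q.1 ≫ t.hom)
      (P.diag.map_id j)).trans ?_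
    exact Category.comp_id _
  map_comp {i j k} f g := by
    refine ConcreteCategory.hom_ext _ _ fun q => Subtype.ext ?_
    refine (congrArg (fun t : P.diag.obj i ⟶ P.diag.obj k => q.1 ≫ t.hom)
      (P.diag.map_comp f g)).trans ?_
    exact (Category.assoc _ _ _).symm

lemma points_map_bijective {i j : P.J} (f : i ⟶ j) :
    Function.Bijective ((P.points K).map f) := by
  constructor
  · intro q q' h
    have h1 : q.1.left ≫ (P.diag.map f).hom.left = q'.1.left ≫ (P.diag.map f).hom.left :=
      congrArg (fun t => t.1.left) h
    have := q.2
    have := (P.birational f).dominant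
    exact Subtype.ext (Over.OverMorphism.ext
      (((P.birational f).existsUnique_lift (q.1.left ≫ (P.diag.map f).hom.left)).unique
        ⟨q.2, rfl⟩ ⟨q'.2, h1.symm⟩))
  · intro q
    have := q.2
    obtain ⟨q', ⟨hq', h⟩, -⟩ := (P.birational f).existsUnique_lift q.1.left
    refine ⟨⟨Over.homMk q' ?_, hq'⟩, Subtype.ext (Over.OverMorphism.ext h)⟩
    rw [← Over.w (P.diag.map f).hom, reassoc_of% h]
    exact Over.w q.1

variable {K} in
/-- A pro-variety with compatible dominant `K`-valued points, as a system of models of `K`. -/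
def toModels (q : ∀ j, specOver F K ⟶ (P.diag.obj j).obj) (hq : ∀ j, IsDominant (q j).left)
    (hw : ∀ {i j : P.J} (f : i ⟶ j), q i ≫ (P.diag.map f).hom = q j) : P.J ⥤ ZSModel F K where
  obj j := ⟨StructuredArrow.mk (S := specOver F K) (T := (isVariety F).ι) (q j), hq j⟩
  map f := ObjectProperty.homMk (StructuredArrow.homMk (P.diag.map f) (hw f))
  map_id j := ObjectProperty.hom_ext _ (StructuredArrow.ext _ _ (P.diag.map_id j))
  map_comp f g := ObjectProperty.hom_ext _ (StructuredArrow.ext _ _ (P.diag.map_comp f g))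

end Model

/-- A variety has a dominant point with values in its function field. -/
lemma _root_.BirGeom.exists_dominant_point (X : Var F) :
    ∃ (K : Type u) (_ : Field K) (_ : Algebra F K) (q : specOver F K ⟶ X.obj),
      IsDominant q.left := by
  obtain ⟨φ, hφ⟩ := Spec.map_surjective (R := CommRingCat.of F) (S := X.obj.left.functionField)
    (X.obj.left.fromSpecStalk (genericPoint X.obj.left) ≫ X.obj.hom)
  let _ : Algebra F X.obj.left.functionField := φ.hom.toAlgebra
  refine ⟨X.obj.left.functionField, inferInstance, inferInstance,
    Over.homMk (X.obj.left.fromSpecStalk _) hφ.symm, ?_⟩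
  exact isDominant_of_apply_eq_genericPoint _ (IsLocalRing.closedPoint _)
    Scheme.fromSpecStalk_closedPoint

variable (P : ProVar F)

/-- A pro-variety underlies a system of models of one field: the function field of any of its
members. -/
lemma exists_toModels : ∃ (K : Type u) (_ : Field K) (_ : Algebra F K)
    (q : ∀ j, specOver F K ⟶ (P.diag.obj j).obj), (∀ j, IsDominant (q j).left) ∧
      ∀ {i j : P.J} (f : i ⟶ j), q i ≫ (P.diag.map f).hom = q j := by
  obtain ⟨j₀⟩ : Nonempty P.J := IsCofiltered.nonempty
  obtain ⟨K, _, _, q, hq⟩ := exists_dominant_point (P.diag.obj j₀)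
  obtain ⟨s, hs⟩ := exists_section_of_bijective (P.points K) (P.points_map_bijective K)
    (j₀ := j₀) ⟨q, hq⟩
  exact ⟨K, _, _, fun j => (s j).1, fun j => (s j).2, fun f => congrArg Subtype.val (hs f)⟩

end ProVar

/-! ### The comparison map and the category of limits -/

namespace ProVar

variable {F : Type u} [Field F] {P Q : ProVar F}

/-- The canonical maps for two cones are compatible with morphisms of cones. -/
lemma eval_comp {c d : Cone P.lrsDiag} (e : c.pt ⟶ d.pt) (he : ∀ j, e ≫ d.π.app j = c.π.app j)
    (V : Var F) (x : P.homTo.obj V) : eval c V x = e ≫ eval d V x := by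
  obtain ⟨j, g, rfl⟩ := P.exists_cls x
  rw [eval_cls, eval_cls, ← he j, Category.assoc]

/-- The system `P` has a limit such that morphisms from members of the system to varieties are
determined by their pullbacks to the limit, and such that every morphism from the limit to a variety
is a pullback of this kind. -/
lemma exists_limit (P : ProVar F) : ∃ (c : Cone P.lrsDiag) (_ : IsLimit c),
    (∀ (V : Var F) (j : P.J) (g g' : P.diag.obj j ⟶ V),
      c.π.app j ≫ (Var.toLRS F).map g = c.π.app j ≫ (Var.toLRS F).map g' → g = g') ∧
    ∀ (V : Var F) (φ : c.pt ⟶ (Var.toLRS F).obj V), ∃ (j : P.J) (g : P.diag.obj j ⟶ V),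
      c.π.app j ≫ (Var.toLRS F).map g = φ := by
  obtain ⟨K, _, _, q, hq, hw⟩ := P.exists_toModels
  let D := P.toModels q hq hw
  exact ⟨(LimPoint.isZLimit D).cone, (LimPoint.isZLimit D).isLimit,
    fun V j g g' h => LimPoint.factor_unique (D := D) j g g' h,
    fun V φ => LimPoint.exists_factor (D := D) φ⟩

/-- Morphisms from the limit of a pro-variety to a variety are germs of morphisms from its members.
-/
lemma eval_bijective {c : Cone P.lrsDiag} (hc : IsLimit c) (V : Var F) :
    Function.Bijective (eval c V) := by
  obtain ⟨d, hd, hinj, hsurj⟩ := P.exists_limit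
  let e := hc.conePointUniqueUpToIso hd
  have he := eval_comp e.hom (hc.conePointUniqueUpToIso_hom_comp hd) V
  constructor
  · intro x y hxy
    rw [he, he, cancel_epi] at hxy
    obtain ⟨j, g, rfl⟩ := P.exists_cls x
    obtain ⟨k, g', rfl⟩ := P.exists_cls y
    obtain ⟨i, a, b, -⟩ := IsCofilteredOrEmpty.cone_objs j k
    rw [← P.cls_map a, ← P.cls_map b, eval_cls, eval_cls] at hxy
    rw [← P.cls_map a, ← P.cls_map b, hinj V i _ _ hxy]
  · intro φ
    obtain ⟨j, g, hg⟩ := hsurj V (e.inv ≫ φ)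
    exact ⟨P.cls j g, by rw [he, eval_cls, hg, Iso.hom_inv_id_assoc]⟩

lemma limMap_π (c : Cone P.lrsDiag) {d : Cone Q.lrsDiag} (hd : IsLimit d) (s : P ⟶ Q) (β : Q.J) :
    limMap c hd s ≫ d.π.app β = eval c (Q.diag.obj β) (s.app β) :=
  hd.fac _ β

/-- The functor `lim` is fully faithful: a morphism to `lim Q` is a compatible family of morphisms
to the members of `Q`. -/
lemma limMap_bijective {c : Cone P.lrsDiag} (hc : IsLimit c) {d : Cone Q.lrsDiag} (hd : IsLimit d) :
    Function.Bijective (limMap c hd : (P ⟶ Q) → (c.pt ⟶ d.pt)) := by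
  constructor
  · intro s t h
    refine Hom.ext (funext fun β => (eval_bijective hc _).1 ?_)
    rw [← limMap_π c hd, ← limMap_π c hd, h]
  · intro φ
    choose x hx using fun β => (eval_bijective hc (Q.diag.obj β)).2 (φ ≫ d.π.app β)
    let s : P ⟶ Q :=
      { app := x
        w := fun {β β'} b => (eval_bijective hc _).1 (by
          rw [eval_map, hx, hx, Category.assoc]
          exact congrArg (φ ≫ ·) (d.w b)) }
    refine ⟨s, hd.hom_ext fun β => ?_⟩
    rw [limMap_π, ← hx]

/-- The canonical maps turn composition of morphisms of pro-objects into composition of morphisms.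
-/
lemma eval_act (c : Cone P.lrsDiag) {d : Cone Q.lrsDiag} (hd : IsLimit d) (s : P ⟶ Q) {V : Var F}
    (x : Q.homTo.obj V) : eval c V (s.act V x) = limMap c hd s ≫ eval d V x := by
  obtain ⟨β, g, rfl⟩ := Q.exists_cls x
  rw [Hom.act_cls, eval_map, eval_cls, ← Category.assoc, limMap_π]

lemma limMap_id {c : Cone P.lrsDiag} (hc : IsLimit c) : limMap c hc (𝟙 P) = 𝟙 c.pt := by
  refine hc.hom_ext fun α => ?_
  rw [limMap_π, Category.id_comp]
  refine (eval_cls c α (𝟙 _)).trans ?_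
  rw [CategoryTheory.Functor.map_id]
  exact Category.comp_id _

lemma limMap_comp {R : ProVar F} (c : Cone P.lrsDiag) {d : Cone Q.lrsDiag} (hd : IsLimit d)
    {e : Cone R.lrsDiag} (he : IsLimit e) (s : P ⟶ Q) (t : Q ⟶ R) :
    limMap c he (s ≫ t) = limMap c hd s ≫ limMap d he t := by
  refine he.hom_ext fun γ => ?_
  rw [limMap_π, Category.assoc, limMap_π]
  exact eval_act c hd s (t.app γ)

end ProVar

variable (F : Type u) [Field F]

lemma nonempty_limFunctor : Nonempty (LimFunctor F) := by
  choose c hc _ using fun P : ProVar F => P.exists_limit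
  exact ⟨{
    functor :=
      { obj := fun P => ⟨(c P).pt, P, (c P).π, ⟨hc P⟩⟩
        map := fun {P Q} s => ObjectProperty.homMk (ProVar.limMap (c P) (hc Q) s)
        map_id := fun P => ObjectProperty.hom_ext _ (ProVar.limMap_id (hc P))
        map_comp := fun {P Q R} s t =>
          ObjectProperty.hom_ext _ (ProVar.limMap_comp (c P) (hc Q) (hc R) s t) }
    π := fun P => (c P).π
    isLimit := hc
    map_eq := fun _ => rfl }⟩

variable {F} in
/-- Any limit functor is fully faithful by `ProVar.limMap_bijective`, and essentially surjective by
the definition of its target. -/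
lemma LimFunctor.isEquivalence (L : LimFunctor F) : L.functor.IsEquivalence where
  faithful := ⟨fun {P Q} s t h => (ProVar.limMap_bijective (L.isLimit P) (L.isLimit Q)).1 (by
    rw [← L.map_eq, ← L.map_eq, h])⟩
  full := ⟨fun {P Q} f => by
    obtain ⟨s, hs⟩ := (ProVar.limMap_bijective (L.isLimit P) (L.isLimit Q)).2 f.hom
    exact ⟨s, ObjectProperty.hom_ext _ ((L.map_eq s).trans hs)⟩⟩
  essSurj := ⟨fun X => by
    obtain ⟨P, π, ⟨h⟩⟩ := X.property
    exact ⟨P, ⟨ObjectProperty.isoMk _ ((L.isLimit P).conePointUniqueUpToIso h)⟩⟩⟩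

/-! ### Centres of valuations on proper models -/

section Centre

variable {F K : Type u} [Field F] [Field K] [Algebra F K]

/-- The image in `K` of an `F`-algebra of finite type. -/
lemma exists_fg_subalgebra_of_finiteType {B : Type*} [CommRing B] (φ : F →+* B)
    (hφ : φ.FiniteType) (θ : B →+* K) (hθ : θ.comp φ = algebraMap F K) :
    ∃ R : Subalgebra F K, R.FG ∧ ∀ r, r ∈ R ↔ ∃ b, θ b = r := by
  algebraize [φ]
  let θ' : B →ₐ[F] K := { θ with commutes' := fun a => RingHom.congr_fun hθ a }
  refine ⟨θ'.range, ?_, fun r => Iff.rfl⟩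
  rw [← Algebra.map_top]
  exact hφ.out.map _

namespace ZSModel

variable (M : ZSModel F K)

instance (v : RPoint F K) : IsLocalRing v.ring.toSubring := inferInstanceAs (IsLocalRing v.ring)

/-- On a proper model every valuation has a centre, by the valuative criterion. -/
lemma exists_dominates (hM : isProper F K M) (v : RPoint F K) :
    ∃ x : M.scheme, M.Dominates v.ring.toSubring x := by
  have hM : IsProper M.str := hM
  rw [IsProper.eq_valuativeCriterion] at hM
  have : ValuationRing v.ring.toSubring := inferInstanceAs (ValuationRing v.ring)
  have : IsFractionRing v.ring.toSubring K := inferInstanceAs (IsFractionRing v.ring K)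
  let S : ValuativeCommSq M.str :=
    { R := v.ring.toSubring
      K := K
      i₁ := M.point
      i₂ := specStr v.ring.toSubring fun a => v.algebraMap_mem a
      commSq := ⟨by rw [point_str]; exact (specIncl_specStr _ _).symm⟩ }
  obtain ⟨⟨l⟩⟩ := hM.1.1.1.existence S
  exact ⟨_, M.dominates_of_spec v.ring.toSubring l.l l.fac_left⟩

lemma Dominates.isCentre {M : ZSModel F K} {v : RPoint F K} {x : M.scheme}
    (h : M.Dominates v.ring.toSubring x) : M.IsCentre v x := by
  refine fun s => ⟨h.mem s, fun hs => ?_⟩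
  rw [IsLocalRing.mem_maximalIdeal, mem_nonunits_iff] at hs ⊢
  intro hu
  obtain ⟨t, ht⟩ := hu.exists_right_inv
  exact hs (h.isUnit s t t.2 (congrArg Subtype.val ht))

/-- An open neighbourhood `U` of `x` contains a point dominated by each local ring in `K` which
contains the functions on an affine neighbourhood of `x` in `U`. -/
lemma exists_fg_subalgebra (x : M.scheme) (U : M.scheme.Opens) (hx : x ∈ U) :
    ∃ R : Subalgebra F K, R.FG ∧ (∀ r ∈ R, ∃ s, M.toField x s = r) ∧
      ∀ (O : Subring K) [IsLocalRing O], (∀ r ∈ R, r ∈ O) → ∃ y ∈ U, M.Dominates O y := by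
  obtain ⟨W, hW, hxW, hWU⟩ := exists_isAffineOpen_mem_and_subset hx
  obtain ⟨φ, hφ⟩ := Spec.map_surjective (hW.fromSpec ≫ M.str)
  have hfin : φ.hom.FiniteType := by
    have h1 : LocallyOfFiniteType (Spec.map φ) := by rw [hφ]; infer_instance
    exact (HasRingHomProperty.Spec_iff (P := @LocallyOfFiniteType)).1 h1
  let θ : Γ(M.scheme, W) ⟶ CommRingCat.of K := M.scheme.presheaf.germ W x hxW ≫ M.toField x
  have hθ : Spec.map θ ≫ hW.fromSpec = M.point := by
    rw [Spec.map_comp, Category.assoc]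
    refine Eq.trans (congrArg (_ ≫ ·) (hW.fromSpecStalk_eq_fromSpecStalk hxW)) ?_
    exact M.SpecMap_toField x
  have hθφ : φ ≫ θ = CommRingCat.ofHom (algebraMap F K) := by
    apply Spec.map_injective
    rw [Spec.map_comp, hφ, reassoc_of% hθ, point_str]
  obtain ⟨R, hR, hRθ⟩ := exists_fg_subalgebra_of_finiteType φ.hom hfin θ.hom
    (congrArg CommRingCat.Hom.hom hθφ)
  refine ⟨R, hR, fun r hr => ?_, fun O _ hO => ?_⟩
  · obtain ⟨b, rfl⟩ := (hRθ r).1 hr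
    exact ⟨M.scheme.presheaf.germ W x hxW b, rfl⟩
  · have hO' (b) : θ.hom b ∈ O := hO _ ((hRθ _).2 ⟨b, rfl⟩)
    let ρ : Γ(M.scheme, W) ⟶ CommRingCat.of O := CommRingCat.ofHom (θ.hom.codRestrict O hO')
    have h2 : ρ ≫ CommRingCat.ofHom O.subtype = θ := rfl
    have h1 : specIncl O ≫ Spec.map ρ ≫ hW.fromSpec = M.point := by
      rw [← hθ, ← h2, Spec.map_comp_assoc]
    refine ⟨_, hWU ?_, M.dominates_of_spec O (Spec.map ρ ≫ hW.fromSpec) h1⟩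
    exact hW.range_fromSpec.subset ⟨_, rfl⟩

variable {M}

/-- The map which sends a valuation to its centre on a proper model. -/
def centre (hM : isProper F K M) (v : RPoint F K) : M.scheme := (M.exists_dominates hM v).choose

lemma dominates_centre (hM : isProper F K M) (v : RPoint F K) :
    M.Dominates v.ring.toSubring (centre hM v) :=
  (M.exists_dominates hM v).choose_spec

/-- The centre map is continuous: a neighbourhood of the centre of `v` contains the spectrum of a
finitely generated algebra `R`, and the centres of all valuations in `E(R)` lie in it. -/
lemma continuous_centre (hM : isProper F K M) : Continuous (centre hM) := by
  refine continuous_def.2 fun U hU => isOpen_iff_forall_mem_open.2 fun v hv => ?_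
  obtain ⟨R, hR, hRx, hRU⟩ := M.exists_fg_subalgebra (centre hM v) ⟨U, hU⟩ hv
  refine ⟨RPoint.E R, fun w hw => ?_, RPoint.isOpen_E hR, fun r hr => ?_⟩
  · obtain ⟨y, hy, hwy⟩ := hRU w.ring.toSubring hw
    rw [Set.mem_preimage, (dominates_centre hM w).unique hwy]
    exact hy
  · obtain ⟨s, rfl⟩ := hRx r hr
    exact (dominates_centre hM v).mem s

end ZSModel

end Centre

/-! ### Scheme-theoretic images and joins of models -/

section Image

/-- The sections of the scheme-theoretic image are sections of the source; in particular the image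
of an integral scheme is integral. -/
lemma toImage_app_injective {X Y : Scheme.{u}} (f : X ⟶ Y) [QuasiCompact f] (V : f.image.Opens) :
    Function.Injective (f.toImage.app V) := by
  rw [injective_iff_map_eq_zero]
  intro s hs
  refine TopCat.Presheaf.section_ext f.image.sheaf V _ _ fun x hx => ?_
  refine f.stalkFunctor_toImage_injective x ?_
  have h (t : Γ(f.image, V)) := ConcreteCategory.congr_hom
    (TopCat.Presheaf.stalkFunctor_map_germ V x hx f.toImage.c) t
  refine (h s).trans (Eq.trans ?_ (h 0).symm)
  have h1 : f.toImage.c.app (op V) s = f.toImage.c.app (op V) 0 := hs.trans (map_zero _).symm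
  exact congrArg (((TopCat.Presheaf.pushforward CommRingCat f.toImage.base).obj
    X.presheaf).germ V x hx) h1

instance {X Y : Scheme.{u}} (f : X ⟶ Y) [QuasiCompact f] [IsIntegral X] : IsIntegral f.image where
  nonempty := (inferInstance : Nonempty X).map f.toImage
  component_integral V _ := by
    obtain ⟨z, hz⟩ := f.toImage.denseRange.exists_mem_open V.2 (Set.nonempty_coe_sort.1 ‹_›)
    have : Nonempty (f.toImage ⁻¹ᵁ V) := ⟨⟨z, hz⟩⟩
    exact (toImage_app_injective f V).isDomain (f.toImage.app V).hom

variable {F K : Type u} [Field F] [Field K] [Algebra F K]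

namespace ZSModel

/-- The scheme-theoretic image of `Spec K` in a proper `F`-scheme is a proper Zariski–Samuel model.
-/
lemma exists_of_isProper {Y : Scheme.{u}} (s : Y ⟶ Spec (CommRingCat.of F)) [IsProper s]
    (q : Spec (CommRingCat.of K) ⟶ Y)
    (hq : q ≫ s = Spec.map (CommRingCat.ofHom (algebraMap F K))) :
    ∃ (M : ZSModel F K) (i : M.scheme ⟶ Y), isProper F K M ∧ M.point ≫ i = q ∧ i ≫ s = M.str :=
  have : QuasiCompact q := by
    have : QuasiCompact (q ≫ s) := by rw [hq]; infer_instance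
    exact .of_comp q s
  have hi : IsProper (q.imageι ≫ s) := inferInstance
  ⟨mk' q.image (q.imageι ≫ s) q.toImage (by rw [q.toImage_imageι_assoc, hq]), q.imageι,
    hi, q.toImage_imageι, rfl⟩

/-- Two proper Zariski–Samuel models are dominated by a third one, in their product. -/
lemma exists_join {M N : ZSModel F K} (hM : isProper F K M) (hN : isProper F K N) :
    ∃ L : ZSModel F K, isProper F K L ∧ Nonempty (L ⟶ M) ∧ Nonempty (L ⟶ N) := by
  have : IsProper M.str := hM
  have : IsProper N.str := hN
  obtain ⟨L, i, hL, hp, hs⟩ := exists_of_isProper (pullback.fst M.str N.str ≫ M.str)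
    (pullback.lift M.point N.point (M.point_str.trans N.point_str.symm))
    (by rw [pullback.lift_fst_assoc, point_str])
  refine ⟨L, hL, ⟨homMk' (i ≫ pullback.fst _ _) ?_ ?_⟩, ⟨homMk' (i ≫ pullback.snd _ _) ?_ ?_⟩⟩
  · rw [Category.assoc, hs]
  · rw [reassoc_of% hp, pullback.lift_fst]
  · rw [Category.assoc, ← pullback.condition, hs]
  · rw [reassoc_of% hp, pullback.lift_snd]

/-- The image of `Spec K` in `Spec F` is a proper Zariski–Samuel model. -/
lemma exists_isProper : ∃ M : ZSModel F K, isProper F K M := by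
  obtain ⟨M, -, hM, -⟩ := exists_of_isProper (F := F) (K := K) (𝟙 _)
    (Spec.map (CommRingCat.ofHom (algebraMap F K))) (Category.comp_id _)
  exact ⟨M, hM⟩

end ZSModel

end Image

/-! ### Models in projective spaces -/

section Projective

open MvPolynomial HomogeneousLocalization

attribute [local instance] MvPolynomial.gradedAlgebra

variable {F K : Type u} [Field F] [Field K] [Algebra F K] {σ : Type u} [Fintype σ]

local notation "grading" => homogeneousSubmodule σ F

omit [Fintype σ] in
/-- Polynomials are generated by the variables over those of degree `0`, which are the constants. -/
lemma adjoin_range_X_eq_top :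
    Algebra.adjoin (grading 0) (Set.range (X : σ → MvPolynomial σ F)) = ⊤ := by
  refine top_le_iff.1 fun p _ => ?_
  have hp : p ∈ Algebra.adjoin F (Set.range (X : σ → MvPolynomial σ F)) :=
    adjoin_range_X (R := F) (σ := σ) ▸ Algebra.mem_top
  induction hp using Algebra.adjoin_induction with
  | mem x hx => exact Algebra.subset_adjoin hx
  | algebraMap a => exact Subalgebra.algebraMap_mem _ (⟨C a, isHomogeneous_C σ a⟩ : grading 0)
  | add x y _ _ hx hy => exact add_mem (hx trivial) (hy trivial)
  | mul x y _ _ hx hy => exact mul_mem (hx trivial) (hy trivial)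

instance : Algebra.FiniteType (grading 0) (MvPolynomial σ F) := by
  classical
  exact ⟨⟨Finset.univ.image X, by simpa using adjoin_range_X_eq_top⟩⟩

variable (F σ) in
/-- The constant coefficient, as a homomorphism on polynomials of degree `0`. Base change along it
makes `Proj`, which is proper over the spectrum of the degree `0` part, a proper `F`-scheme. -/
def degreeZeroHom : CommRingCat.of (grading 0) ⟶ CommRingCat.of F :=
  CommRingCat.ofHom (constantCoeff.comp (algebraMap (grading 0) (MvPolynomial σ F)))

variable (e : σ → K) (he : ∀ i, e i ≠ 0)

include he in
lemma isUnit_aeval_prod : IsUnit ((aeval (R := F) e).toRingHom (∏ i, X i : MvPolynomial σ F)) := by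
  have h : (aeval (R := F) e).toRingHom (∏ i, X i : MvPolynomial σ F) = ∏ i, e i := by simp
  rw [h]
  exact (Finset.prod_ne_zero_iff.2 fun i _ => he i).isUnit

/-- Evaluation at the point with coordinates `e` of fractions whose denominator is a power of the
product of all coordinates. -/
def evalProd : Away grading (∏ i, X i : MvPolynomial σ F) →+* K :=
  (Localization.awayLift (aeval (R := F) e).toRingHom _ (isUnit_aeval_prod e he)).comp
  (algebraMap (Away grading (∏ i, X i : MvPolynomial σ F)) _)

/-- Evaluation at `e` is the inclusion of `F` on constants. -/
lemma evalProd_fromZeroRingHom (a : grading 0) : evalProd e he (fromZeroRingHom grading _ a) =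
    algebraMap F K (constantCoeff (a : MvPolynomial σ F)) := by
  obtain ⟨p, hp⟩ := a
  obtain ⟨c, rfl⟩ : ∃ c, p = C c := ⟨_, totalDegree_eq_zero_iff_eq_C.1
    ((totalDegree_zero_iff_isHomogeneous σ).2 hp)⟩
  have h : algebraMap (Away grading (∏ i, X i : MvPolynomial σ F)) (Localization.Away
      (∏ i, X i : MvPolynomial σ F)) (fromZeroRingHom grading _ ⟨C c, hp⟩) =
        algebraMap (MvPolynomial σ F) _ (C c) :=
    Localization.mk_one_eq_algebraMap _
  rw [evalProd, RingHom.comp_apply, h]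
  refine (IsLocalization.Away.lift_eq _ _ _).trans ?_
  simp

omit [Fintype σ] in
variable (F) in
lemma X_mem (i : σ) : (X i : MvPolynomial σ F) ∈ grading 1 := isHomogeneous_X F i

omit [Fintype σ] in
variable (F) in
lemma X_mem' (i : σ) : (X i : MvPolynomial σ F) ∈ grading (1 • 1) := isHomogeneous_X F i

/-- The value at `e` of a fraction with the product of all coordinates as denominator. -/
lemma evalProd_mk_mul {d : ℕ} (hd : (∏ k, X k : MvPolynomial σ F) ∈ grading d)
    (p : MvPolynomial σ F) (hp : p ∈ grading (1 • d)) :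
    evalProd e he (Away.mk grading hd 1 p hp) * ∏ k, e k = aeval e p := by
  have h1 (q : MvPolynomial σ F) : Localization.awayLift (aeval (R := F) e).toRingHom _
      (isUnit_aeval_prod e he) (algebraMap _ _ q) = aeval e q := IsLocalization.Away.lift_eq _ _ q
  let r : Submonoid.powers (∏ k, X k : MvPolynomial σ F) := ⟨(∏ k, X k) ^ 1, 1, rfl⟩
  have h2 : Localization.mk p r *
      algebraMap (MvPolynomial σ F) (Localization.Away (∏ k, X k : MvPolynomial σ F)) (∏ i, X i) =
        algebraMap (MvPolynomial σ F) _ p := by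
    rw [Localization.mk_eq_mk']
    refine Eq.trans ?_ (IsLocalization.mk'_spec _ p r)
    exact congrArg (fun t => _ * algebraMap (MvPolynomial σ F) _ t) (pow_one _).symm
  have h3 := h1 p
  rw [← h2, map_mul, h1] at h3
  refine Eq.trans ?_ h3
  rw [map_prod]
  simp only [aeval_X]
  rfl

/-- The value at `e` of the quotient `X j / X i` of two coordinates. -/
lemma evalProd_awayMap {n : ℕ} (i j : σ) (g : MvPolynomial σ F) (hg : g ∈ grading n)
    (hx : (∏ k, X k : MvPolynomial σ F) = X i * g)
    (hj : (X j : MvPolynomial σ F) ∈ grading (1 • 1)) :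
    evalProd e he (awayMap grading hg hx
      (Away.mk grading (X_mem F i) 1 (X j) hj)) = e j / e i := by
  have h1 : ∏ k, e k = e i * aeval e g := by
    have h := congrArg (aeval (R := F) e) hx
    simpa using h
  have h2 : ∏ k, e k ≠ 0 := Finset.prod_ne_zero_iff.2 fun i _ => he i
  rw [awayMap_mk]
  refine mul_right_cancel₀ h2 ((evalProd_mk_mul e he _ _ _).trans ?_)
  rw [h1, map_mul, aeval_X, pow_one, ← mul_assoc, div_mul_cancel₀ _ (he i)]

omit [Fintype σ] in
lemma prod_X_mem (s : Finset σ) : (∏ k ∈ s, X k : MvPolynomial σ F) ∈ grading s.card := by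
  have h := IsHomogeneous.prod s (fun k => (X k : MvPolynomial σ F)) (fun _ => 1)
    fun i _ => isHomogeneous_X F i
  simpa using h

variable [Nonempty σ]

/-- The chart of projective space on which all coordinates are invertible. -/
abbrev prodChart : Spec (.of (Away grading (∏ i, X i : MvPolynomial σ F))) ⟶ Proj grading :=
  Proj.awayι grading (∏ i, X i : MvPolynomial σ F) (prod_X_mem Finset.univ)
    (Finset.card_pos.2 Finset.univ_nonempty)

/-- The point of projective space with homogeneous coordinates `e`. -/
def projPoint : Spec (CommRingCat.of K) ⟶ Proj (homogeneousSubmodule σ F) :=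
  Spec.map (CommRingCat.ofHom (evalProd e he)) ≫ prodChart

lemma projPoint_toSpecZero : projPoint e he ≫ Proj.toSpecZero grading =
    Spec.map (CommRingCat.ofHom (algebraMap F K)) ≫ Spec.map (degreeZeroHom F σ) := by
  rw [projPoint, Category.assoc, Proj.awayι_toSpecZero, ← Spec.map_comp, ← Spec.map_comp]
  congr 1
  ext a
  exact evalProd_fromZeroRingHom e he a

/-- Restriction of the point with coordinates `e` to a standard chart. -/
lemma exists_projPoint_eq (i : σ) : ∃ ρ : Away grading (X i : MvPolynomial σ F) →+* K,
    Spec.map (CommRingCat.ofHom ρ) ≫ Proj.awayι grading (X i) (X_mem F i) one_pos =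
      projPoint e he ∧ ∀ j hj, ρ (Away.mk grading (X_mem F i) 1 (X j) hj) = e j / e i := by
  classical
  have hx : (∏ k, X k : MvPolynomial σ F) = X i * ∏ k ∈ Finset.univ.erase i, X k :=
    (Finset.mul_prod_erase _ _ (Finset.mem_univ i)).symm
  refine ⟨(evalProd e he).comp (awayMap grading (prod_X_mem (Finset.univ.erase i)) hx), ?_,
    fun j hj => evalProd_awayMap e he i j _ _ hx hj⟩
  rw [CommRingCat.ofHom_comp, Spec.map_comp, Category.assoc, Proj.SpecMap_awayMap_awayι]
  rfl

lemma range_subset_of_closedPoint_mem {R : CommRingCat.{u}} [IsLocalRing R]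
    {Y : Scheme.{u}} (χ : Spec R ⟶ Y) (U : Y.Opens) (h : χ (IsLocalRing.closedPoint R) ∈ U) :
    Set.range χ ⊆ U := by
  rintro _ ⟨z, rfl⟩
  exact ((IsLocalRing.specializes_closedPoint z).map χ.continuous).mem_open U.2 h

include he in
/-- The closure of the point with homogeneous coordinates `e` in projective space is a proper model;
on each of its local rings, the quotients of all coordinates by one of them are regular. -/
lemma exists_projective_model : ∃ M : ZSModel F K, ZSModel.isProper F K M ∧
    ∀ x : M.scheme, ∃ i, ∀ j, ∃ s, M.toField x s = e j / e i := by
  obtain ⟨M, ι, hM, hp, -⟩ := ZSModel.exists_of_isProper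
    (pullback.fst (Spec.map (degreeZeroHom F σ)) (Proj.toSpecZero grading))
    (pullback.lift _ _ (projPoint_toSpecZero e he).symm) (pullback.lift_fst _ _ _)
  refine ⟨M, hM, fun x => ?_⟩
  let π := pullback.snd (Spec.map (degreeZeroHom F σ)) (Proj.toSpecZero grading)
  -- A chart `D₊(X i)` which contains the image of `x` contains the image of `Spec O_{M,x}`, so
  -- that the functions `X j / X i` define elements of `O_{M,x}`; their values in `K` are computed
  -- at `Spec K`.
  let ω := M.scheme.fromSpecStalk x ≫ ι ≫ π
  have hω : Spec.map (M.toField x) ≫ ω = projPoint e he := by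
    rw [reassoc_of% ZSModel.SpecMap_toField, ← Category.assoc, hp, pullback.lift_snd]
  have hcov := Proj.iSup_basicOpen_eq_top' grading (X : σ → MvPolynomial σ F)
    (fun i => ⟨1, isHomogeneous_X F i⟩) adjoin_range_X_eq_top
  obtain ⟨i, hi⟩ := Opens.mem_iSup.1 (hcov.ge (Opens.mem_top (ω (IsLocalRing.closedPoint _))))
  let ζ := Proj.awayι grading (X i : MvPolynomial σ F) (X_mem F i) one_pos
  have hr : Set.range ω ⊆ Set.range ζ := by
    have h1 := range_subset_of_closedPoint_mem ω _ hi
    rw [← Proj.opensRange_awayι grading (X i : MvPolynomial σ F) (X_mem F i) one_pos] at h1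
    exact h1
  obtain ⟨l, hl⟩ := Spec.map_surjective (IsOpenImmersion.lift ζ ω hr)
  have hlζ : Spec.map l ≫ ζ = ω := by rw [hl, IsOpenImmersion.lift_fac]
  obtain ⟨ρ, hρ, hρe⟩ := exists_projPoint_eq (F := F) e he i
  have h1 : l ≫ M.toField x = CommRingCat.ofHom ρ := by
    apply Spec.map_injective
    rw [← cancel_mono ζ, Spec.map_comp, Category.assoc, hlζ, hω, hρ]
  refine ⟨i, fun j => ⟨l (Away.mk grading (X_mem F i) 1 (X j) (X_mem' F j)), ?_⟩⟩
  refine Eq.trans ?_ (hρe j (X_mem' F j))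
  exact ConcreteCategory.congr_hom h1 _

end Projective

/-! ### The Riemann variety as a limit of proper models -/

section RiemannLimit

variable {F K : Type u} [Field F] [Field K] [Algebra F K]

/-- The trivial valuation belongs to every nonempty open set. -/
lemma dense_eta : Dense {(RPoint.eta : RPoint F K)} := fun v =>
  specializes_iff_mem_closure.1 ((rData F K).eta_specializes v)

namespace ZSModel

/-- For each `f` there is a proper model (the closure of the point `(1 : f)` of the projective line)
on every local ring of which `f` or `f⁻¹` is regular. -/
lemma exists_mem_or_inv_mem (f : K) : ∃ M : ZSModel F K, isProper F K M ∧
    ∀ x : M.scheme, (∃ s, M.toField x s = f) ∨ (f ≠ 0 ∧ ∃ s, M.toField x s = f⁻¹) := by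
  by_cases hf : f = 0
  · obtain ⟨M, hM⟩ := exists_isProper (F := F) (K := K)
    exact ⟨M, hM, fun x => Or.inl ⟨0, by rw [map_zero, hf]⟩⟩
  · obtain ⟨M, hM, h⟩ := exists_projective_model (F := F) (σ := ULift.{u} Bool)
      (fun b => cond b.down f 1) (by rintro ⟨_ | _⟩ <;> simp [hf])
    refine ⟨M, hM, fun x => ?_⟩
    obtain ⟨⟨_ | _⟩, hi⟩ := h x
    · obtain ⟨s, hs⟩ := hi ⟨true⟩
      exact Or.inl ⟨s, by simpa using hs⟩
    · obtain ⟨s, hs⟩ := hi ⟨false⟩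
      exact Or.inr ⟨hf, s, by simpa using hs⟩

/-- Each element of a local ring in `K` comes from the local ring which it dominates on a suitable
proper model. -/
lemma exists_model_of_mem (f : K) : ∃ M : ZSModel F K, isProper F K M ∧
    ∀ (O : Subring K) (x : M.scheme), M.Dominates O x → f ∈ O → ∃ s, M.toField x s = f := by
  obtain ⟨M, hM, h⟩ := exists_mem_or_inv_mem (F := F) f
  refine ⟨M, hM, fun O x hx hfO => ?_⟩
  rcases h x with h | ⟨hf, s, hs⟩
  · exact h
  · obtain ⟨t, ht⟩ := (hx.isUnit s f hfO (by rw [hs, inv_mul_cancel₀ hf])).exists_right_inv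
    refine ⟨t, ?_⟩
    have h1 := congrArg (M.toField x) ht
    rw [map_mul, map_one, hs] at h1
    exact (eq_of_inv_mul_eq_one h1).symm

/-- Local rings grow along morphisms of models. -/
lemma exists_toField_of_hom {M N : ZSModel F K} (φ : M ⟶ N) (x : M.scheme) {y : N.scheme}
    (hy : mor φ x = y) {f : K} (h : ∃ s, N.toField y s = f) : ∃ s, M.toField x s = f := by
  subst hy
  obtain ⟨s, rfl⟩ := h
  exact ⟨(mor φ).stalkMap x s, toField_mor_apply φ x s⟩

section Criterion

open scoped Topology

variable {S : ObjectProperty (ZSModel F K)} (hS : S ≤ isProper F K)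
  (hcof : ∀ M, isProper F K M → ∃ N, S N ∧ Nonempty (N ⟶ M))

include hS hcof in
/-- Joins make the system cofiltered, since there is at most one morphism between two models. -/
lemma isCofiltered_of_cofinal : IsCofiltered S.FullSubcategory where
  cone_objs M N := by
    obtain ⟨L, hL, ⟨p⟩, ⟨q⟩⟩ := exists_join (hS _ M.property) (hS _ N.property)
    obtain ⟨L', hL', ⟨r⟩⟩ := hcof L hL
    exact ⟨⟨L', hL'⟩, ObjectProperty.homMk (r ≫ p), ObjectProperty.homMk (r ≫ q), trivial⟩
  cone_maps M N f g := ⟨M, 𝟙 M, by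
    rw [ObjectProperty.hom_ext _ (Subsingleton.elim f.hom g.hom)]⟩
  nonempty := by
    obtain ⟨M, hM⟩ := exists_isProper (F := F) (K := K)
    obtain ⟨N, hN, -⟩ := hcof M hM
    exact ⟨⟨N, hN⟩⟩

include hcof in
lemma exists_cofinal_model_of_mem (f : K) : ∃ M : S.FullSubcategory,
    ∀ (O : Subring K) (x : M.obj.scheme), M.obj.Dominates O x → f ∈ O →
      ∃ s, M.obj.toField x s = f := by
  obtain ⟨M, hM, h⟩ := exists_model_of_mem (F := F) f
  obtain ⟨N, hN, ⟨φ⟩⟩ := hcof M hM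
  exact ⟨⟨N, hN⟩, fun O x hx hf => exists_toField_of_hom φ x rfl (h O _ (hx.mor φ) hf)⟩

/-- The union of the local rings at compatible points of sufficiently many proper models is a
valuation ring. -/
def valuationOfPoint [IsCofiltered S.FullSubcategory] (y : LimPoint S.ι)
    (hcof : ∀ M, isProper F K M → ∃ N, S N ∧ Nonempty (N ⟶ M)) : RPoint F K :=
  ⟨{ y.ring with
      mem_or_inv_mem' := fun f => by
        obtain ⟨M, hM, h⟩ := exists_mem_or_inv_mem (F := F) f
        obtain ⟨N, hN, ⟨φ⟩⟩ := hcof M hM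
        rcases h (mor φ (y.1 ⟨N, hN⟩)) with h | ⟨-, h⟩
        · exact Or.inl ⟨⟨N, hN⟩, exists_toField_of_hom φ _ rfl h⟩
        · exact Or.inr ⟨⟨N, hN⟩, exists_toField_of_hom φ _ rfl h⟩ }, by
    rintro _ ⟨a, rfl⟩
    obtain ⟨N⟩ : Nonempty S.FullSubcategory := IsCofiltered.nonempty
    exact ⟨N, N.obj.exists_toField_algebraMap _ a⟩⟩

/-- The centre map of a member of `S`, as a continuous map. -/
def centreMap (M : S.FullSubcategory) : C(RPoint F K, M.obj.scheme) :=
  ⟨centre (hS _ M.property), continuous_centre _⟩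

lemma dominates_centreMap (M : S.FullSubcategory) (v : RPoint F K) :
    M.obj.Dominates v.ring.toSubring (centreMap hS M v) :=
  dominates_centre (hS _ M.property) v

include hcof in
/-- In the limit topology, the valuation rings containing `f` form an open set: on a model where `f`
belongs to the local ring at the centre of `v`, it is regular near this centre. -/
lemma isOpen_setOf_mem_iInf (f : K) :
    IsOpen[⨅ M : S.FullSubcategory, induced (centreMap hS M) inferInstance]
      {v : RPoint F K | f ∈ v.ring} := by
  obtain ⟨M, hM⟩ := exists_cofinal_model_of_mem hcof f
  refine (iInf_le (fun M : S.FullSubcategory => induced (centreMap hS M) inferInstance) M) _ ?_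
  let _ : TopologicalSpace (RPoint F K) := induced (centreMap hS M) inferInstance
  refine isOpen_iff_forall_mem_open.2 fun v hv => ?_
  obtain ⟨s, hs⟩ := hM _ _ (dominates_centreMap hS M v) hv
  obtain ⟨U, hU, t, rfl⟩ := M.obj.scheme.presheaf.exists_germ_eq s
  refine ⟨centreMap hS M ⁻¹' (U : Set M.obj.scheme), fun w hw => ?_, ⟨U, U.2, rfl⟩, hU⟩
  have h := (dominates_centreMap hS M w).mem (M.obj.scheme.presheaf.germ U _ hw t)
  rw [M.obj.germ_toField_apply hw hU, hs] at h
  exact h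

include hcof in
lemma isOpen_E_iInf {R : Subalgebra F K} (hR : R.FG) :
    IsOpen[⨅ M : S.FullSubcategory, induced (centreMap hS M) inferInstance] (RPoint.E R) := by
  obtain ⟨T, rfl⟩ := hR
  have h : RPoint.E (Algebra.adjoin F (T : Set K)) = ⋂ f ∈ T, {v : RPoint F K | f ∈ v.ring} := by
    ext v
    simp only [Set.mem_iInter]
    refine ⟨fun hv f hf => hv f (Algebra.subset_adjoin hf), fun hv r hr => ?_⟩
    induction hr using Algebra.adjoin_induction with
    | mem x hx => exact hv x hx
    | algebraMap a => exact v.algebraMap_mem a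
    | add x y _ _ hx hy => exact add_mem hx hy
    | mul x y _ _ hx hy => exact mul_mem hx hy
  rw [h]
  let _ : TopologicalSpace (RPoint F K) :=
    ⨅ M : S.FullSubcategory, induced (centreMap hS M) inferInstance
  exact isOpen_biInter_finset fun f _ => isOpen_setOf_mem_iInf hS hcof f

include hcof in
/-- The Riemann variety satisfies the criterion for limits of models: by
`exists_cofinal_model_of_mem` valuation rings are the unions of the local rings at their centres,
and by `valuationOfPoint` every compatible family of points consists of the centres of a valuation.
-/
lemma isZLimit_rData : IsZLimit (rData F K) S.ι (centreMap hS) where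
  dominates M (v : RPoint F K) := dominates_centreMap hS M v
  w {M N} φ (v : RPoint F K) :=
    ((dominates_centreMap hS M v).mor φ.hom).unique (dominates_centreMap hS N v)
  inj := by
    have key (v w : RPoint F K) (h : ∀ M : S.FullSubcategory, centreMap hS M v = centreMap hS M w)
        (f : K) (hf : f ∈ v.ring) : f ∈ w.ring := by
      obtain ⟨M, hM⟩ := exists_cofinal_model_of_mem hcof f
      obtain ⟨s, rfl⟩ := hM _ _ (dominates_centreMap hS M v) hf
      have h1 := (dominates_centreMap hS M w).mem
      rw [← h M] at h1
      exact h1 s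
    exact fun v w h => Subtype.ext (ValuationSubring.ext _ _ fun f =>
      ⟨key v w h f, key w v (fun M => (h M).symm) f⟩)
  surj y hy := by
    have := isCofiltered_of_cofinal hS hcof
    let z : LimPoint S.ι := ⟨y, hy⟩
    refine ⟨valuationOfPoint z hcof, fun M => ?_⟩
    exact (dominates_centreMap hS M (valuationOfPoint z hcof)).unique (z.dominates M)
  top_eq := by
    refine le_antisymm (le_iInf fun M => (centreMap hS M).continuous.le_induced) ?_
    refine le_generateFrom_iff_subset_isOpen.2 ?_
    rintro _ ⟨R, hR, rfl⟩
    exact isOpen_E_iInf hS hcof hR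
  exists_toField v f hf := by
    obtain ⟨M, hM⟩ := exists_cofinal_model_of_mem hcof f
    exact ⟨M, hM _ _ (dominates_centreMap hS M v) hf⟩

include hS hcof in
/-- The Riemann variety is the limit of any system of proper models such that every proper model
receives a morphism from a member of the system. -/
lemma isRiemannLimit_of_cofinal : IsRiemannLimit F K S := by
  have := isCofiltered_of_cofinal hS hcof
  refine ⟨this, (isZLimit_rData hS hcof).cone.π, fun M => ⟨fun v => ?_, fun U s v hv => ?_⟩,
    ⟨(isZLimit_rData hS hcof).isLimit⟩⟩
  · exact (dominates_centreMap hS M v).isCentre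
  · exact (rData F K).zHomLeft_app_apply M.obj (centreMap hS M) (dominates_centreMap hS M) U s v hv

end Criterion

/-! ### Models with function field `K` -/

lemma exists_toField_point {M : ZSModel F K} (x : M.scheme) {f : K} (h : ∃ s, M.toField x s = f) :
    ∃ s, M.toField (M.point (IsLocalRing.closedPoint K)) s = f := by
  obtain ⟨s, rfl⟩ := h
  obtain ⟨U, hU, t, rfl⟩ := M.scheme.presheaf.exists_germ_eq s
  exact ⟨_, M.germ_toField_apply ((M.point_specializes x).mem_open U.2 hU) hU t⟩

/-- A Zariski–Samuel model is a model if the union of its local rings is `K`. -/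
lemma isModel_iff {M : ZSModel F K} : isModel F K M ↔ ∀ f, ∃ x s, M.toField x s = f := by
  have h1 : M.point.stalkMap (IsLocalRing.closedPoint K) ≫
      (stalkClosedPointIso (CommRingCat.of K)).hom =
        M.toField (M.point (IsLocalRing.closedPoint K)) := by
    rw [ZSModel.toField, TopCat.Presheaf.stalkSpecializes_refl, Category.id_comp]
    rfl
  have h2 : IsIso (M.point.stalkMap (IsLocalRing.closedPoint K)) ↔
      IsIso (M.toField (M.point (IsLocalRing.closedPoint K))) := by
    rw [← h1]
    exact (isIso_comp_right_iff _ _).symm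
  have h3 : IsIso (M.toField (M.point (IsLocalRing.closedPoint K))) ↔
      ∀ f, ∃ x s, M.toField x s = f := by
    rw [ConcreteCategory.isIso_iff_bijective]
    refine ⟨fun h f => ⟨_, h.2 f⟩, fun h => ⟨M.toField_injective _, fun f => ?_⟩⟩
    obtain ⟨x, hx⟩ := h f
    exact exists_toField_point x hx
  have h4 : genericPoint (Spec (CommRingCat.of K)) = IsLocalRing.closedPoint K :=
    Subsingleton.elim (α := PrimeSpectrum K) _ _
  rw [← h3, ← h2, ← h4]
  exact ⟨fun h => h.isIso, fun h => ⟨inferInstance, h⟩⟩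

/-- A Zariski–Samuel model above a model is a model. -/
lemma isModel_of_hom {M N : ZSModel F K} (φ : M ⟶ N) (hN : isModel F K N) : isModel F K M := by
  refine isModel_iff.2 fun f => ?_
  obtain ⟨x, hx⟩ := isModel_iff.1 hN f
  refine ⟨M.point (IsLocalRing.closedPoint K), exists_toField_of_hom φ _ ?_
    (exists_toField_point x hx)⟩
  rw [← point_mor φ]
  rfl

/-- A finitely generated field extension has a proper model, the closure of a point of projective
space with coordinates `1` and generators of the extension. -/
lemma exists_proper_model (hK : (⊤ : IntermediateField F K).FG) :
    ∃ M : ZSModel F K, isProper F K M ∧ isModel F K M := by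
  classical
  obtain ⟨T, hT⟩ := hK
  let T' : Finset K := insert 1 (T.erase 0)
  have : Nonempty T' := ⟨⟨1, Finset.mem_insert_self _ _⟩⟩
  -- The generators different from `0`, and `1`, serve as homogeneous coordinates.
  obtain ⟨M, hM, h⟩ := exists_projective_model (F := F) (σ := T') Subtype.val (by
    rintro ⟨a, ha⟩
    rcases Finset.mem_insert.1 ha with rfl | ha
    · exact one_ne_zero
    · exact Finset.ne_of_mem_erase ha)
  refine ⟨M, hM, isModel_iff.2 fun f => ⟨genericPoint M.scheme, ?_⟩⟩
  -- The function field of `M` contains the quotients of the coordinates by one of them; one of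
  -- these quotients is the inverse of the denominator.
  let ι : M.scheme.functionField →+* K := (M.toField (genericPoint M.scheme)).hom
  let L : IntermediateField F K := ι.fieldRange.toIntermediateField fun a =>
    M.exists_toField_algebraMap (genericPoint M.scheme) a
  obtain ⟨i, hi⟩ := h (genericPoint M.scheme)
  have hL (j : T') : (j : K) / i ∈ L := hi j
  have hi' : (i : K) ∈ L := by
    have h1 := inv_mem (hL ⟨1, Finset.mem_insert_self _ _⟩)
    simpa using h1
  have hL' : (⊤ : IntermediateField F K) ≤ L := by
    rw [← hT, IntermediateField.adjoin_le_iff]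
    intro a ha
    by_cases h0 : a = 0
    · rw [h0]; exact zero_mem L
    · have hi0 : (i : K) ≠ 0 := by
        obtain ⟨a, ha⟩ := i
        rcases Finset.mem_insert.1 ha with rfl | ha
        · exact one_ne_zero
        · exact Finset.ne_of_mem_erase ha
      have h1 := mul_mem (hL ⟨a, Finset.mem_insert_of_mem (Finset.mem_erase.2 ⟨h0, ha⟩)⟩) hi'
      rwa [div_mul_cancel₀ _ hi0] at h1
  exact hL' (IntermediateField.mem_top (x := f))

/-- Every proper Zariski–Samuel model receives a morphism from a proper model. -/
lemma exists_proper_model_over (hK : (⊤ : IntermediateField F K).FG) (M : ZSModel F K)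
    (hM : isProper F K M) : ∃ N, (isProper F K ⊓ isModel F K) N ∧ Nonempty (N ⟶ M) := by
  obtain ⟨N, hN, hN'⟩ := exists_proper_model hK
  obtain ⟨L, hL, hLM, ⟨q⟩⟩ := exists_join hM hN
  exact ⟨L, ⟨hL, isModel_of_hom q hN'⟩, hLM⟩

/-- A variety which maps birationally to a Zariski–Samuel model is a Zariski–Samuel model. -/
lemma exists_of_isBirational (M : ZSModel F K) (Y : Var F) (s : Y ⟶ M.variety)
    (hs : IsBirational s.hom.left) : ∃ N : ZSModel F K, N.variety = Y ∧ Nonempty (N ⟶ M) := by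
  obtain ⟨q, ⟨hq, hqs⟩, -⟩ := hs.existsUnique_lift M.point
  have hw : q ≫ Y.obj.hom = Spec.map (CommRingCat.ofHom (algebraMap F K)) := by
    rw [← Over.w s.hom, reassoc_of% hqs, point_str]
  let N : ZSModel F K := ⟨StructuredArrow.mk (S := specOver F K) (T := (isVariety F).ι)
    (Y := Y) (Over.homMk q hw), hq⟩
  exact ⟨N, rfl, ⟨ObjectProperty.homMk (StructuredArrow.homMk s (Over.OverMorphism.ext hqs))⟩⟩

end ZSModel

end RiemannLimit

end BirGeom

end

theorem mainTheorem5 (F : Type u) [Field F] :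
    (∀ (K : Type u) [Field K] [Algebra F K], (⊤ : IntermediateField F K).FG →
      Dense {(BirGeom.RPoint.eta : BirGeom.RPoint F K)} ∧
      BirGeom.ZSModel.IsRiemannLimit F K (BirGeom.ZSModel.isProper F K) ∧
      BirGeom.ZSModel.IsRiemannLimit F K
        (BirGeom.ZSModel.isProper F K ⊓ BirGeom.ZSModel.isModel F K) ∧
      ∀ C : ObjectProperty (BirGeom.Var F),
        (∀ X : BirGeom.Var F, C X → IsProper X.obj.hom) →
        (∀ X : BirGeom.Var F, IsProper X.obj.hom →
          ∃ (Y : BirGeom.Var F) (s : Y ⟶ X), C Y ∧ BirGeom.IsBirational s.hom.left) →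
        BirGeom.ZSModel.IsRiemannLimit F K
          ((fun M => C M.variety) ⊓ BirGeom.ZSModel.isModel F K)) ∧
    (∀ (P Q : BirGeom.ProVar F) (c : Cone P.lrsDiag) (d : Cone Q.lrsDiag)
      (_ : IsLimit c) (hd : IsLimit d),
      Function.Bijective
        (BirGeom.ProVar.limMap c hd : (P ⟶ Q) → (c.pt ⟶ d.pt))) ∧
    Nonempty (BirGeom.LimFunctor F) ∧
    ∀ L : BirGeom.LimFunctor F, L.functor.IsEquivalence := by
  refine ⟨fun K _ _ hK => ⟨BirGeom.dense_eta, ?_, ?_, fun C hC hCb => ?_⟩,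
    fun P Q c d hc hd => BirGeom.ProVar.limMap_bijective hc hd, BirGeom.nonempty_limFunctor F,
    fun L => L.isEquivalence⟩
  · exact BirGeom.ZSModel.isRiemannLimit_of_cofinal le_rfl fun M hM => ⟨M, hM, ⟨𝟙 M⟩⟩
  · exact BirGeom.ZSModel.isRiemannLimit_of_cofinal inf_le_left
      (BirGeom.ZSModel.exists_proper_model_over hK)
  · refine BirGeom.ZSModel.isRiemannLimit_of_cofinal (fun M hM => hC _ hM.1) fun M hM => ?_
    obtain ⟨N, ⟨hN, hN'⟩, ⟨φ⟩⟩ := BirGeom.ZSModel.exists_proper_model_over hK M hM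
    obtain ⟨Y, s, hY, hs⟩ := hCb N.variety hN
    obtain ⟨L, rfl, ⟨ψ⟩⟩ := BirGeom.ZSModel.exists_of_isBirational N Y s hs
    exact ⟨L, ⟨hY, BirGeom.ZSModel.isModel_of_hom ψ hN'⟩, ⟨ψ ≫ φ⟩⟩
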